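/- **Setting.** For each sample size $n$ let $p=p_n\ge 2$ and $K=K_n\ge 2$, and consider a $K$-class Gaussian model on $\mathbb{R}^p$: class probabilities $\pi_1,\dots,\pi_K>0$ with $\sum_k\pi_k=1$, class means $\mu_1,\dots,\mu_K\in\mathbb{R}^p$ with $\sum_k\pi_k\mu_k=0$, and a common within-class covariance matrix $\Sigma_W$ with diagonal entries $\sigma_j^2$ (all depending on $n$). Let $(x_i,z_i)$, $i=1,\dots,n$, be independent with $P(z_i=k)=\pi_k$ and $x_i\mid z_i=k\sim\mathcal{N}(\mu_k,\Sigma_W)$. Let $\Sigma_T=\mathrm{cov}(x_i)$, $\tau=\max_j\sqrt{\sigma_j^2+\max_k\mu_{kj}^2}$, and let $\Delta\in\mathbb{R}^{p\times(K-1)}$ have columns $$\Delta_r=\frac{\sqrt{\pi_{r+1}}\sum_{k=1}^r\pi_k(\mu_k-\mu_{r+1})}{\sqrt{\sum_{k=1}^r\pi_k\sum_{k=1}^{r+1}\pi_k}},\qquad r=1,\dots,K-1 .$$ Let $B^*\in\mathbb{R}^{p\times(K-1)}$ satisfy $\Sigma_TB^*=\Delta$; so $B^*=\Sigma_T^{-1}\Delta$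 when $\Sigma_T$ is invertible. Let $X\in\mathbb{R}^{n\times p}$ be the matrix with rows $x_i^\top$, either column-centered or not. Let $n_k$ be the number of $i$ with $z_i=k$, $Z\in\{0,1\}^{n\times K}$ the class indicator matrix, and $Y=Z\widetilde\Theta$, where the $l$-th column of $\widetilde\Theta\in\mathbb{R}^{K\times(K-1)}$ is $$\widetilde\Theta_l=\Big(\underbrace{\sqrt{\tfrac{n\,n_{l+1}}{\sum_{i\le l}n_i\sum_{i\le l+1}n_i}},\dots}_{l\text{ times}},\;-\sqrt{\tfrac{n\sum_{i\le l}n_i}{n_{l+1}\sum_{i\le l+1}n_i}},\;0,\dots,0\Big)^{\top}$$ (a quotient with denominator $0$ is read as $0$). For a matrix $A$ with rows $a_i$ let $\|A\|_{1,2}=\sum_i\|a_i\|_2$, and let $\widehat B$ be any minimizer over $B\in\mathbb{R}^{p\times(K-1)}$ of $$(2n)^{-1}\|Y-XB\|_F^2+\lambda\|B\|_{1,2}.$$ **Assumptions.** The class probabilities are of the same order: $\pi_k\ge c/K$ for all $k$ and $n$, with a constant $c>0$. Moreover $\log p=o(n)$. No sparsity or restricted-eigenvalue condition is assumed. **Theorem.**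 There are an absolute constant $C>0$ and constants $C_\varepsilon>0$ depending only on $\varepsilon$ such that the following holds for every such sequence of models. Put $r_n=\tau\sqrt{(K-1)\log p/n}$ and $\rho_n=\{1\vee\tau\|B^*\|_{1,2}\}\,\tau\|B^*\|_{1,2}\sqrt{(K-1)\log p/n}$, and suppose $\lambda\le C'r_n$ for all large $n$, with some constant $C'$. 1. If $p_n\to\infty$ and $\lambda\ge C r_n$ for all large $n$, then $$\mathrm{Tr}\{(\widehat B-B^*)^\top\Sigma_T(\widehat B-B^*)\}=O_p(\rho_n),$$ and if, in addition, $\lambda_{\min}(\Sigma_T)>0$ for all $n$, then $$\|\widehat B-B^*\|_F^2=O_p\big(\rho_n/\lambda_{\min}(\Sigma_T)\big).$$ 2. Without $p_n\to\infty$: for every $\varepsilon>0$, if $\lambda\ge C_\varepsilon r_n$ for all large $n$, there is $M$ such that for all large $n$ $$P\big(\mathrm{Tr}\{(\widehat B-B^*)^\top\Sigma_T(\widehat B-B^*)\}>M\rho_n\big)<\varepsilon,$$ and if, in addition, $\lambda_{\min}(\Sigma_T)>0$ for all $n$, there is $M$ such that for all large $n$ also $P\big(\|\widehat B-B^*\|_F^2>M\rho_n/\lambda_{\min}(\Sigma_T)\big)<\varepsilon$.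 Here $b_n=O_p(a_n)$ means that for every $\varepsilon>0$ there is $M$ with $P(|b_n|>Ma_n)<\varepsilon$ for all large $n$. -/

import Mathlib

open MeasureTheory ProbabilityTheory Filter
open scoped Matrix

noncomputable section

/-- Parameters of the `K`-class Gaussian model in `ℝ^p`: positive class probabilities `π_k` summing
to one, class means `μ_k` with overall mean `∑ π_k μ_k = 0`, and a common within-class covariance
matrix `Σ_W` (symmetric positive semidefinite, possibly singular). -/
structure ClassModel (p K : ℕ) where
  prob : Fin K → ℝ
  mean : Fin K → EuclideanSpace ℝ (Fin p)
  covW : Matrix (Fin p) (Fin p) ℝ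
  prob_pos : ∀ k, 0 < prob k
  prob_sum : ∑ k, prob k = 1
  covW_posSemidef : covW.PosSemidef
  mean_zero : ∑ k, prob k • mean k = 0

namespace ClassModel

variable {p K : ℕ} (M : ClassModel p K)

/-- Joint law of a pair (features, class label): label `k` has probability `π_k`, and given label
`k` the features are `N(μ_k, Σ_W)`. -/
def law : Measure (EuclideanSpace ℝ (Fin p) × Fin K) :=
  ∑ k, ENNReal.ofReal (M.prob k) •
    (multivariateGaussian (M.mean k) M.covW).map (fun x => (x, k))

/-- Marginal law of the features. -/
def featureLaw : Measure (EuclideanSpace ℝ (Fin p)) := M.law.map Prod.fst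

/-- Marginal covariance matrix `Σ_T` of the features. -/
def totalCov : Matrix (Fin p) (Fin p) ℝ :=
  Matrix.of fun j j' => covariance (fun x => x j) (fun x => x j') M.featureLaw

/-- `τ = max_j √(σ_j² + max_k μ_{kj}²)`, with `σ_j²` the diagonal entries of `Σ_W`. -/
def tau : ℝ := ⨆ j : Fin p, √(M.covW j j + ⨆ k : Fin K, (M.mean k j) ^ 2)

end ClassModel

/-- Partial sum `q_0 + ⋯ + q_m` of weights of the classes (classes are numbered from `0`). -/
def cumWeight {K : ℕ} (q : Fin K → ℝ) (m : ℕ) : ℝ :=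
  ∑ k ∈ Finset.univ.filter (fun k : Fin K => (k : ℕ) ≤ m), q k

/-- For the contrast number `r` (counted from `0`), the class that is compared with classes
`0, …, r`, that is class `r + 1`. -/
def nextClass {K : ℕ} (r : Fin (K - 1)) : Fin K := ⟨(r : ℕ) + 1, by omega⟩

/-- The `p × (K-1)` matrix `Δ` of orthogonal mean contrasts; its `r`-th column is
`√π_{r+1} ∑_{k ≤ r} π_k (μ_k - μ_{r+1}) / √(∑_{k ≤ r} π_k ∑_{k ≤ r+1} π_k)`. -/
def ClassModel.contrasts {p K : ℕ} (M : ClassModel p K) : Matrix (Fin p) (Fin (K - 1)) ℝ :=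
  Matrix.of fun j r =>
    √(M.prob (nextClass r)) *
      (∑ k ∈ Finset.univ.filter (fun k : Fin K => (k : ℕ) ≤ r),
        M.prob k * (M.mean k j - M.mean (nextClass r) j)) /
      √(cumWeight M.prob r * cumWeight M.prob (r + 1))

/-- Number `n_k` of sample points with label `k`. -/
def classCount {n K : ℕ} (z : Fin n → Fin K) (k : Fin K) : ℝ :=
  ((Finset.univ.filter (fun i => z i = k)).card : ℝ)

/-- The `n × K` class indicator matrix `Z`. -/
def indicatorMatrix {n K : ℕ} (z : Fin n → Fin K) : Matrix (Fin n) (Fin K) ℝ :=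
  Matrix.of fun i k => if z i = k then 1 else 0

/-- The `K × (K-1)` matrix of optimal scores computed from the class counts. -/
def scores {n K : ℕ} (z : Fin n → Fin K) : Matrix (Fin K) (Fin (K - 1)) ℝ :=
  Matrix.of fun k l =>
    if (k : ℕ) ≤ l then
      √(n * classCount z (nextClass l) /
        (cumWeight (classCount z) l * cumWeight (classCount z) (l + 1)))
    else if (k : ℕ) = l + 1 then
      -√(n * cumWeight (classCount z) l /
        (classCount z (nextClass l) * cumWeight (classCount z) (l + 1)))
    else 0

/-- The `n × (K-1)` response matrix `Y`, the indicator matrix times the scores. -/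
def response {n K : ℕ} (z : Fin n → Fin K) : Matrix (Fin n) (Fin (K - 1)) ℝ :=
  indicatorMatrix z * scores z

/-- The `n × p` matrix whose rows are the feature vectors. -/
def dataMatrix {n p : ℕ} (x : Fin n → EuclideanSpace ℝ (Fin p)) : Matrix (Fin n) (Fin p) ℝ :=
  Matrix.of fun i j => x i j

/-- Column-centering: subtract from every column its average. -/
def centerColumns {n p : ℕ} (X : Matrix (Fin n) (Fin p) ℝ) : Matrix (Fin n) (Fin p) ℝ :=
  Matrix.of fun i j => X i j - (n : ℝ)⁻¹ * ∑ i', X i' j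

/-- `‖A‖_{1,2}`, the sum of the Euclidean norms of the rows. -/
def norm12 {a b : ℕ} (A : Matrix (Fin a) (Fin b) ℝ) : ℝ := ∑ i, √(∑ j, A i j ^ 2)

/-- `‖A‖_F²`, the squared Frobenius norm. -/
def frobSq {a b : ℕ} (A : Matrix (Fin a) (Fin b) ℝ) : ℝ := ∑ i, ∑ j, A i j ^ 2

/-- The least eigenvalue of a (real symmetric) matrix. -/
def lambdaMin {p : ℕ} (S : Matrix (Fin p) (Fin p) ℝ) : ℝ := sInf (spectrum ℝ S)

/-- The penalized criterion `(2n)⁻¹ ‖Y - X B‖_F² + lam ‖B‖_{1,2}`. -/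
def penalizedLoss {n p m : ℕ} (X : Matrix (Fin n) (Fin p) ℝ) (Y : Matrix (Fin n) (Fin m) ℝ)
    (lam : ℝ) (B : Matrix (Fin p) (Fin m) ℝ) : ℝ :=
  (2 * (n : ℝ))⁻¹ * frobSq (Y - X * B) + lam * norm12 B

/-- Out-of-sample prediction error `Tr{(B - B*)ᵀ S (B - B*)}`. -/
def predError {p m : ℕ} (S : Matrix (Fin p) (Fin p) ℝ) (B Bstar : Matrix (Fin p) (Fin m) ℝ) : ℝ :=
  ((B - Bstar)ᵀ * S * (B - Bstar)).trace

/-- `τ √((K-1) log p / n)`, the scale of the tuning parameter. -/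
def tuningScale {p K : ℕ} (M : ClassModel p K) (n : ℕ) : ℝ :=
  M.tau * √(((K : ℝ) - 1) * Real.log p / n)

/-- The slow rate `{1 ∨ τ‖B*‖_{1,2}} τ‖B*‖_{1,2} √((K-1) log p / n)`. -/
def slowRate {p K : ℕ} (M : ClassModel p K) (Bstar : Matrix (Fin p) (Fin (K - 1)) ℝ) (n : ℕ) : ℝ :=
  max 1 (M.tau * norm12 Bstar) * (M.tau * norm12 Bstar) * √(((K : ℝ) - 1) * Real.log p / n)

/-- `|b_n| ≤ M a_n` with probability more than `1 - ε` for some constant `M` and all large `n`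
(outer probability if `b_n` is not measurable). -/
def BoundedAtLevel {Ω : ℕ → Type*} [∀ n, MeasurableSpace (Ω n)] (P : ∀ n, Measure (Ω n))
    (b : ∀ n, Ω n → ℝ) (a : ℕ → ℝ) (ε : ℝ) : Prop :=
  ∃ M : ℝ, ∀ᶠ n in atTop, (P n).real {ω | M * a n < |b n ω|} < ε

/-- `b_n = O_p(a_n)`. -/
def IsBigOp {Ω : ℕ → Type*} [∀ n, MeasurableSpace (Ω n)] (P : ∀ n, Measure (Ω n))
    (b : ∀ n, Ω n → ℝ) (a : ℕ → ℝ) : Prop :=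
  ∀ ε : ℝ, 0 < ε → BoundedAtLevel P b a ε

end

/-!
The group lasso of optimal scores is analysed without any sparsity. The basic inequality for the
penalized criterion (`predError_le_of_isMinOn`) bounds the prediction error by
`3 λ ‖B*‖ + 16 ε ‖B*‖²`, with `‖·‖ = ‖·‖_{1,2}`, as soon as `λ / 2` dominates the Euclidean norms of
the rows of the gradient `n⁻¹ Xᵀ (Y - X B*)` and `ε` dominates the entries of `Σ_T - n⁻¹ Xᵀ X`. So
it has to be shown that the rows of the gradient are at most of the order `τ √((K - 1) log p / n)`,
uniformly in the `p` rows, with a constant that does not depend on `c`, and that the entries of the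
Gram matrix deviate by at most `τ` times as much.

The gradient splits into three parts (`ClassModel.gradient_eq`).

* The mean contrasts formed with empirical instead of population class frequencies. Since
  contrasts are coefficients in an orthonormal system of functions of the class, a Hardy-type
  argument (`sum_contrast_sub_sq_le`) bounds the change by the chi-square distance of the
  frequencies, which has expectation at most `K / n` (`measure_chiSq_le`), whatever the probabilities are.
* The effect of the class frequencies on the fitted class means. The fit `B*ᵀ x` is the projection
  of orthonormal scores, hence its covariance is at most the identity
  (`ClassModel.fitted_cov_le`), and Bessel's inequality again leads to the chi-square distance.
* An average of linear and centred bilinear forms of the Gaussian observations, independent given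
  the labels. Its row has `K - 1` coordinates; Jensen's inequality for `y ↦ cosh (s √y)`
  (`cosh_mul_sqrt_sum_le`) reduces the moment generating function of the Euclidean norm to those of
  single coordinates, so that `measure_obsForm_tail` costs no union bound over the coordinates.
  The variance depends on the empirical mean of the squared fitted class means; only there the
  constant `c` enters, through an error probability `2 / (c n)` (`measure_fittedMean_le`).

With `λ ≥ 80 A τ √((K - 1) log p / n)` the exceptional probability is at most
`2 / (A² log p) + 2 / (c n) + 8 p ^ (34 - A)` (`measure_not_wellBehaved_le`). For `A = 35` it
vanishes if `p → ∞`; for bounded `p` it is made small by the choice of `A`.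
-/

/-! ### One Gaussian observation -/

section GaussianObservation

variable {p : ℕ} {μ : EuclideanSpace ℝ (Fin p)} {S : Matrix (Fin p) (Fin p) ℝ}

/-- A centred linear form of a multivariate Gaussian vector is a centred real Gaussian variable. -/
lemma hasLaw_linearForm (hS : S.PosSemidef) (a : Fin p → ℝ) :
    HasLaw (fun x : EuclideanSpace ℝ (Fin p) => ∑ j, a j * (x j - μ j))
      (gaussianReal 0 (a ⬝ᵥ S *ᵥ a).toNNReal) (multivariateGaussian μ S) := by
  have h1 : HasLaw (fun x : EuclideanSpace ℝ (Fin p) => ∑ j, a j * x j)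
      (gaussianReal (∑ j, a j * μ j) (a ⬝ᵥ S *ᵥ a).toNNReal) (multivariateGaussian μ S) := by
    refine ⟨Measurable.aemeasurable (by fun_prop), ?_⟩
    have hL : (fun x : EuclideanSpace ℝ (Fin p) => ∑ j, a j * x j)
        = innerSL ℝ (WithLp.toLp 2 a) := by
      ext x
      simp [PiLp.inner_apply, mul_comm]
    rw [hL, IsGaussian.map_eq_gaussianReal]
    congr 1
    · rw [ContinuousLinearMap.integral_comp_id_comm IsGaussian.integrable_id,
        integral_id_multivariateGaussian]
      simp [PiLp.inner_apply, mul_comm]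
    · congr 1
      have := covarianceBilin_multivariateGaussian (μ := μ) hS (WithLp.toLp 2 a) (WithLp.toLp 2 a)
      rw [covarianceBilin_self IsGaussian.memLp_two_id] at this
      simpa using this
  have h2 := gaussianReal_sub_const h1 (∑ j, a j * μ j)
  simpa [mul_sub, Finset.sum_sub_distrib] using h2

lemma lintegral_exp_mul_gaussianReal (v : NNReal) (θ : ℝ) :
    ∫⁻ u, ENNReal.ofReal (Real.exp (θ * u)) ∂(gaussianReal 0 v)
      = ENNReal.ofReal (Real.exp (v * θ ^ 2 / 2)) := by
  rw [← ofReal_integral_eq_lintegral_ofReal (integrable_exp_mul_gaussianReal θ)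
    (ae_of_all _ fun _ => (Real.exp_pos _).le)]
  have := congrFun (mgf_id_gaussianReal (μ := 0) (v := v)) θ
  simp only [mgf, id, zero_mul, zero_add] at this
  rw [this]

/-- The quadratic lower bound `log (1 - z) ≥ -z - z²` near zero. -/
lemma exp_neg_sub_sq_le_one_sub {z : ℝ} (hz : |z| ≤ 1 / 2) : Real.exp (-z - z ^ 2) ≤ 1 - z := by
  obtain ⟨h1, h2⟩ := abs_le.1 hz
  have key : 1 ≤ Real.exp (z + z ^ 2) * (1 - z) := by
    rcases le_total 0 z with h | h
    · have hq := Real.quadratic_le_exp_of_nonneg (x := z + z ^ 2) (by positivity)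
      have : 1 ≤ (1 + (z + z ^ 2) + (z + z ^ 2) ^ 2 / 2) * (1 - z) := by
        have h3 : 2 * z ≤ (1 + z) ^ 2 * (1 - z) := by nlinarith [sq_nonneg (z - 1 / 2)]
        nlinarith [mul_le_mul_of_nonneg_left h3 (sq_nonneg z)]
      exact this.trans (by gcongr; linarith)
    · have hq := Real.add_one_le_exp (z + z ^ 2)
      have : 1 ≤ (z + z ^ 2 + 1) * (1 - z) := by
        nlinarith [mul_nonneg (sq_nonneg z) (neg_nonneg.2 h)]
      exact this.trans (by gcongr; linarith)
  have hneg : -z - z ^ 2 = -(z + z ^ 2) := by ring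
  rw [hneg, Real.exp_neg]
  exact (inv_le_iff_one_le_mul₀' (Real.exp_pos _)).2 key

/-- Sub-exponential bound for the square of a centred Gaussian variable. -/
lemma lintegral_exp_sq_gaussianReal_le (v : NNReal) {θ : ℝ} (hθ : |θ| * v ≤ 1 / 4) :
    ∫⁻ u, ENNReal.ofReal (Real.exp (θ * (u ^ 2 - v))) ∂(gaussianReal 0 v)
      ≤ ENNReal.ofReal (Real.exp (2 * θ ^ 2 * v ^ 2)) := by
  rcases eq_or_ne v 0 with rfl | hv
  · simp [gaussianReal_zero_var]
  have hv' : (0 : ℝ) < v := by positivity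
  have hab : |2 * (θ * v)| ≤ 1 / 2 := by
    rw [abs_mul, abs_mul, abs_of_pos hv', abs_two]; linarith
  have hy : 0 < 1 - 2 * (θ * v) := by have := (abs_le.1 hab).2; linarith
  have hb : 0 < 1 / (2 * (v : ℝ)) - θ := by
    have : 1 / (2 * (v : ℝ)) - θ = (1 - 2 * (θ * v)) / (2 * v) := by field_simp
    rw [this]; positivity
  -- The integrand is the density of another Gaussian law, up to a constant factor.
  have hpt : ∀ u : ℝ, gaussianPDFReal 0 v u * Real.exp (θ * (u ^ 2 - v))
      = (√(2 * Real.pi * v))⁻¹ * Real.exp (-(θ * v)) *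
        Real.exp (-(1 / (2 * (v : ℝ)) - θ) * u ^ 2) := by
    intro u
    rw [gaussianPDFReal, mul_assoc (√(2 * Real.pi * v))⁻¹, mul_assoc (√(2 * Real.pi * v))⁻¹,
      ← Real.exp_add, ← Real.exp_add]
    congr 2
    field_simp
    ring
  rw [gaussianReal_of_var_ne_zero _ hv, lintegral_withDensity_eq_lintegral_mul _
    (measurable_gaussianPDF 0 v) (by fun_prop)]
  have hfun : ∀ u : ℝ, (gaussianPDF 0 v * fun u => ENNReal.ofReal (Real.exp (θ * (u ^ 2 - v)))) u
      = ENNReal.ofReal ((√(2 * Real.pi * v))⁻¹ * Real.exp (-(θ * v)) *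
        Real.exp (-(1 / (2 * (v : ℝ)) - θ) * u ^ 2)) := by
    intro u
    rw [Pi.mul_apply, gaussianPDF, ← ENNReal.ofReal_mul (gaussianPDFReal_nonneg _ _ _), hpt]
  simp_rw [hfun]
  rw [← ofReal_integral_eq_lintegral_ofReal ((integrable_exp_neg_mul_sq hb).const_mul _)
    (ae_of_all _ fun _ => by positivity), integral_const_mul, integral_gaussian]
  apply ENNReal.ofReal_le_ofReal
  have h1 : (√(2 * Real.pi * v))⁻¹ * Real.exp (-(θ * v)) * √(Real.pi / (1 / (2 * (v : ℝ)) - θ))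
      = Real.exp (-(θ * v)) * (√(1 - 2 * (θ * v)))⁻¹ := by
    have : Real.pi / (1 / (2 * (v : ℝ)) - θ) = (2 * Real.pi * v) * (1 - 2 * (θ * v))⁻¹ := by
      have : 1 / (2 * (v : ℝ)) - θ = (1 - 2 * (θ * v)) / (2 * v) := by field_simp
      rw [this]; field_simp
    rw [this, Real.sqrt_mul (by positivity) (1 - 2 * (θ * ↑v))⁻¹, Real.sqrt_inv]
    have : √(2 * Real.pi * v) ≠ 0 := by positivity
    field_simp
  rw [h1, ← div_eq_mul_inv, div_le_iff₀ (Real.sqrt_pos.2 hy)]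
  have h2 := exp_neg_sub_sq_le_one_sub hab
  have h3 : Real.exp (-(θ * v) - 2 * θ ^ 2 * v ^ 2) ≤ √(1 - 2 * (θ * v)) := by
    apply Real.le_sqrt_of_sq_le
    rw [← Real.exp_nat_mul]
    refine le_trans (le_of_eq ?_) h2
    congr 1
    push_cast; ring
  calc Real.exp (-(θ * v))
      = Real.exp (2 * θ ^ 2 * v ^ 2) * Real.exp (-(θ * v) - 2 * θ ^ 2 * v ^ 2) := by
        rw [← Real.exp_add]; congr 1; ring
    _ ≤ _ := by gcongr

/-- Convexity of the exponential, for the mean of four numbers. -/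
lemma exp_add_four_le (a b c d : ℝ) : Real.exp (a + b + c + d)
    ≤ 1 / 4 * (Real.exp (4 * a) + Real.exp (4 * b) + Real.exp (4 * c) + Real.exp (4 * d)) := by
  have e : ∀ t : ℝ, Real.exp (4 * t) = Real.exp t ^ 4 := by
    intro t; rw [← Real.exp_nat_mul]; norm_num
  simp only [e, Real.exp_add]
  have h1 := Real.exp_pos a
  have h2 := Real.exp_pos b
  have h3 := Real.exp_pos c
  have h4 := Real.exp_pos d
  generalize Real.exp a = x at *
  generalize Real.exp b = y at *
  generalize Real.exp c = z at *
  generalize Real.exp d = w at *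
  nlinarith [sq_nonneg (x * y - z * w), sq_nonneg (x ^ 2 - y ^ 2), sq_nonneg (z ^ 2 - w ^ 2)]

lemma dotProduct_mulVec_comm_of_posSemidef (hS : S.PosSemidef) (a b : Fin p → ℝ) :
    a ⬝ᵥ S *ᵥ b = b ⬝ᵥ S *ᵥ a := by
  have hT : Sᵀ = S := by simpa using hS.isHermitian.eq
  rw [Matrix.dotProduct_mulVec, ← Matrix.mulVec_transpose, hT, dotProduct_comm]

/-- Moment generating function of a linear plus a centred bilinear form of one Gaussian
observation. The four summands that result from polarizing the product of the linear forms
`a` and `b` are separated by convexity of the exponential, so that only real Gaussian variables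
occur. -/
lemma lintegral_exp_observation_le (hS : S.PosSemidef) (a b : Fin p → ℝ) {τ ν : ℝ} (hτ : 0 < τ)
    (hν : 0 < ν) (ha : a ⬝ᵥ S *ᵥ a ≤ τ ^ 2) (hb : b ⬝ᵥ S *ᵥ b ≤ ν ^ 2) (α β γ θ : ℝ)
    (hγ : |γ| ≤ 1) (hθ : |θ| * (τ * ν) ≤ 1 / 16) :
    ∫⁻ x, ENNReal.ofReal (Real.exp (θ * (α * (∑ j, a j * (x j - μ j))
        + β * (∑ j, b j * (x j - μ j))
        + γ * ((∑ j, a j * (x j - μ j)) * (∑ j, b j * (x j - μ j)) - a ⬝ᵥ S *ᵥ b))))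
        ∂(multivariateGaussian μ S)
      ≤ ENNReal.ofReal (Real.exp
          (32 * θ ^ 2 * (α ^ 2 * τ ^ 2 + β ^ 2 * ν ^ 2 + τ ^ 2 * ν ^ 2))) := by
  -- `r` balances the two linear forms: `r² τ² = ν² / r² = τ ν`.
  obtain ⟨r, hr, hr2⟩ : ∃ r : ℝ, 0 < r ∧ r ^ 2 = ν / τ :=
    ⟨√(ν / τ), by positivity, Real.sq_sqrt (by positivity)⟩
  set W : (Fin p → ℝ) → EuclideanSpace ℝ (Fin p) → ℝ := fun c x => ∑ j, c j * (x j - μ j) with hW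
  set q : (Fin p → ℝ) → ℝ := fun c => c ⬝ᵥ S *ᵥ c with hq
  have hq0 : ∀ c, 0 ≤ q c := fun c => by simpa using hS.dotProduct_mulVec_nonneg c
  have hWm : ∀ c, Measurable (W c) := fun c => by simp only [hW]; fun_prop
  set cp : Fin p → ℝ := r • a + r⁻¹ • b with hcp
  set cm : Fin p → ℝ := r • a - r⁻¹ • b with hcm
  have hWp : ∀ x, W cp x = r * W a x + r⁻¹ * W b x := by
    intro x
    simp only [hW, hcp, Finset.mul_sum, ← Finset.sum_add_distrib]
    refine Finset.sum_congr rfl fun j _ => ?_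
    simp; ring
  have hWmm : ∀ x, W cm x = r * W a x - r⁻¹ * W b x := by
    intro x
    simp only [hW, hcm, Finset.mul_sum, ← Finset.sum_sub_distrib]
    refine Finset.sum_congr rfl fun j _ => ?_
    simp; ring
  have hqp : q cp = r ^ 2 * q a + 2 * (a ⬝ᵥ S *ᵥ b) + r⁻¹ ^ 2 * q b := by
    simp only [hq, hcp, Matrix.mulVec_add, Matrix.mulVec_smul, dotProduct_add, add_dotProduct,
      dotProduct_smul, smul_dotProduct, smul_eq_mul]
    rw [dotProduct_mulVec_comm_of_posSemidef hS b a]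
    field_simp
    ring
  have hqm : q cm = r ^ 2 * q a - 2 * (a ⬝ᵥ S *ᵥ b) + r⁻¹ ^ 2 * q b := by
    simp only [hq, hcm, Matrix.mulVec_sub, Matrix.mulVec_smul, dotProduct_sub, sub_dotProduct,
      dotProduct_smul, smul_dotProduct, smul_eq_mul]
    rw [dotProduct_mulVec_comm_of_posSemidef hS b a]
    field_simp
    ring
  -- The variances of `r a ± b / r` have sum `2 (r² q(a) + q(b) / r²) ≤ 4 τ ν`.
  have hra : r ^ 2 * q a ≤ τ * ν := by
    calc r ^ 2 * q a ≤ r ^ 2 * τ ^ 2 := by gcongr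
      _ = τ * ν := by rw [hr2]; field_simp
  have hrb : r⁻¹ ^ 2 * q b ≤ τ * ν := by
    calc r⁻¹ ^ 2 * q b ≤ r⁻¹ ^ 2 * ν ^ 2 := by gcongr
      _ = τ * ν := by rw [inv_pow, hr2]; field_simp
  have hqp4 : q cp ≤ 4 * (τ * ν) := by linarith [hq0 cm]
  have hqm4 : q cm ≤ 4 * (τ * ν) := by linarith [hq0 cp]
  have hlin : ∀ c : Fin p → ℝ, ∀ t : ℝ,
      ∫⁻ x, ENNReal.ofReal (Real.exp (t * W c x)) ∂(multivariateGaussian μ S)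
        = ENNReal.ofReal (Real.exp (q c * t ^ 2 / 2)) := by
    intro c t
    rw [(hasLaw_linearForm (μ := μ) hS c).lintegral_comp
      (f := fun u => ENNReal.ofReal (Real.exp (t * u))) (by fun_prop),
      lintegral_exp_mul_gaussianReal, Real.coe_toNNReal _ (hq0 c)]
  have hquad : ∀ c : Fin p → ℝ, ∀ t : ℝ, |t| * q c ≤ 1 / 4 →
      ∫⁻ x, ENNReal.ofReal (Real.exp (t * (W c x ^ 2 - q c))) ∂(multivariateGaussian μ S)
        ≤ ENNReal.ofReal (Real.exp (2 * t ^ 2 * q c ^ 2)) := by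
    intro c t ht
    have h := lintegral_exp_sq_gaussianReal_le (q c).toNNReal (θ := t)
      (by rwa [Real.coe_toNNReal _ (hq0 c)])
    rw [Real.coe_toNNReal _ (hq0 c)] at h
    rwa [(hasLaw_linearForm (μ := μ) hS c).lintegral_comp
      (f := fun u => ENNReal.ofReal (Real.exp (t * (u ^ 2 - q c)))) (by fun_prop)]
  set T : ℝ := Real.exp (32 * θ ^ 2 * (α ^ 2 * τ ^ 2 + β ^ 2 * ν ^ 2 + τ ^ 2 * ν ^ 2)) with hT
  have hpoint : ∀ x, ENNReal.ofReal (Real.exp (θ * (α * W a x + β * W b x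
        + γ * (W a x * W b x - a ⬝ᵥ S *ᵥ b))))
      ≤ ENNReal.ofReal (1 / 4) * (ENNReal.ofReal (Real.exp ((4 * θ * α) * W a x))
        + ENNReal.ofReal (Real.exp ((4 * θ * β) * W b x))
        + ENNReal.ofReal (Real.exp ((θ * γ) * (W cp x ^ 2 - q cp)))
        + ENNReal.ofReal (Real.exp ((-(θ * γ)) * (W cm x ^ 2 - q cm)))) := by
    intro x
    rw [← ENNReal.ofReal_add (by positivity) (by positivity),
      ← ENNReal.ofReal_add (by positivity) (by positivity),
      ← ENNReal.ofReal_add (by positivity) (by positivity), ← ENNReal.ofReal_mul (by norm_num)]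
    apply ENNReal.ofReal_le_ofReal
    refine le_trans (le_of_eq ?_) ((exp_add_four_le (θ * α * W a x) (θ * β * W b x)
      (θ * γ / 4 * (W cp x ^ 2 - q cp)) (-(θ * γ / 4) * (W cm x ^ 2 - q cm))).trans (le_of_eq ?_))
    · congr 1
      rw [hWp, hWmm, hqp, hqm]
      field_simp
      ring
    · congr 1
      ring_nf
  have hθγ : |θ * γ| ≤ |θ| := by
    rw [abs_mul]; exact mul_le_of_le_one_right (abs_nonneg _) hγ
  have hsq : (θ * γ) ^ 2 ≤ θ ^ 2 := sq_le_sq.2 hθγ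
  have hα2 : (0 : ℝ) ≤ θ ^ 2 * (α ^ 2 * τ ^ 2) := by positivity
  have hβ2 : (0 : ℝ) ≤ θ ^ 2 * (β ^ 2 * ν ^ 2) := by positivity
  have hγ2 : (0 : ℝ) ≤ θ ^ 2 * (τ ^ 2 * ν ^ 2) := by positivity
  have hcond : ∀ c, q c ≤ 4 * (τ * ν) → |θ * γ| * q c ≤ 1 / 4 := by
    intro c hc
    calc |θ * γ| * q c ≤ |θ| * (4 * (τ * ν)) := by gcongr; exact hq0 c
      _ ≤ 1 / 4 := by linarith
  have hbd : ∀ c, q c ≤ 4 * (τ * ν) → 2 * (θ * γ) ^ 2 * q c ^ 2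
      ≤ 32 * θ ^ 2 * (α ^ 2 * τ ^ 2 + β ^ 2 * ν ^ 2 + τ ^ 2 * ν ^ 2) := by
    intro c hc
    calc 2 * (θ * γ) ^ 2 * q c ^ 2 ≤ 2 * θ ^ 2 * (4 * (τ * ν)) ^ 2 := by
          gcongr; exact hq0 c
      _ = 32 * (θ ^ 2 * (τ ^ 2 * ν ^ 2)) := by ring
      _ ≤ _ := by linarith
  refine (lintegral_mono hpoint).trans ?_
  rw [lintegral_const_mul _ (by fun_prop), lintegral_add_right _ (by fun_prop),
    lintegral_add_right _ (by fun_prop), lintegral_add_right _ (by fun_prop)]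
  have i1 : ∫⁻ x, ENNReal.ofReal (Real.exp ((4 * θ * α) * W a x)) ∂(multivariateGaussian μ S)
      ≤ ENNReal.ofReal T := by
    rw [hlin]
    apply ENNReal.ofReal_le_ofReal
    apply Real.exp_le_exp.2
    calc q a * (4 * θ * α) ^ 2 / 2 ≤ τ ^ 2 * (4 * θ * α) ^ 2 / 2 := by gcongr
      _ = 8 * (θ ^ 2 * (α ^ 2 * τ ^ 2)) := by ring
      _ ≤ _ := by linarith
  have i2 : ∫⁻ x, ENNReal.ofReal (Real.exp ((4 * θ * β) * W b x)) ∂(multivariateGaussian μ S)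
      ≤ ENNReal.ofReal T := by
    rw [hlin]
    apply ENNReal.ofReal_le_ofReal
    apply Real.exp_le_exp.2
    calc q b * (4 * θ * β) ^ 2 / 2 ≤ ν ^ 2 * (4 * θ * β) ^ 2 / 2 := by gcongr
      _ = 8 * (θ ^ 2 * (β ^ 2 * ν ^ 2)) := by ring
      _ ≤ _ := by linarith
  have i3 : ∫⁻ x, ENNReal.ofReal (Real.exp ((θ * γ) * (W cp x ^ 2 - q cp)))
      ∂(multivariateGaussian μ S) ≤ ENNReal.ofReal T :=
    (hquad cp _ (hcond cp hqp4)).trans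
      (ENNReal.ofReal_le_ofReal (Real.exp_le_exp.2 (hbd cp hqp4)))
  have i4 : ∫⁻ x, ENNReal.ofReal (Real.exp ((-(θ * γ)) * (W cm x ^ 2 - q cm)))
      ∂(multivariateGaussian μ S) ≤ ENNReal.ofReal T := by
    refine (hquad cm _ (by rw [abs_neg]; exact hcond cm hqm4)).trans
      (ENNReal.ofReal_le_ofReal (Real.exp_le_exp.2 ?_))
    rw [neg_sq]
    exact hbd cm hqm4
  calc _ ≤ ENNReal.ofReal (1 / 4) *
        (ENNReal.ofReal T + ENNReal.ofReal T + ENNReal.ofReal T + ENNReal.ofReal T) := by gcongr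
    _ = ENNReal.ofReal T := by
        have hT0 : 0 ≤ T := (Real.exp_pos _).le
        rw [← ENNReal.ofReal_add hT0 hT0, ← ENNReal.ofReal_add (by positivity) hT0,
          ← ENNReal.ofReal_add (by positivity) hT0, ← ENNReal.ofReal_mul (by norm_num)]
        congr 1; ring

end GaussianObservation

/-! ### A tail bound for the Euclidean norm of a sum of independent observations -/

/-- Jensen's inequality for the convex function `y ↦ cosh (s √y)`. It bounds a function of the
Euclidean norm of a vector by functions of single coordinates, without a loss that depends on the
dimension. -/
lemma cosh_mul_sqrt_sum_le {ι : Type*} [Fintype ι] (w u : ι → ℝ) (hw : ∀ l, 0 ≤ w l)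
    (hw1 : ∑ l, w l = 1) (s : ℝ) :
    Real.cosh (s * √(∑ l, w l * u l ^ 2)) ≤ ∑ l, w l * Real.cosh (s * u l) := by
  have h1 := Real.hasSum_cosh (s * √(∑ l, w l * u l ^ 2))
  have h2 := hasSum_sum (s := Finset.univ)
    fun l (_ : l ∈ Finset.univ) => (Real.hasSum_cosh (s * u l)).mul_left (w l)
  refine hasSum_le (fun k => ?_) h1 h2
  have hsq : (s * √(∑ l, w l * u l ^ 2)) ^ (2 * k) = (s ^ 2) ^ k * (∑ l, w l * u l ^ 2) ^ k := by
    rw [pow_mul, mul_pow, Real.sq_sqrt (Finset.sum_nonneg fun l _ =>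
      mul_nonneg (hw l) (sq_nonneg _)), mul_pow]
  have hpm := Real.pow_arith_mean_le_arith_mean_pow Finset.univ w (fun l => u l ^ 2)
    (fun l _ => hw l) hw1 (fun l _ => sq_nonneg _) k
  rw [hsq]
  calc (s ^ 2) ^ k * (∑ l, w l * u l ^ 2) ^ k / ((2 * k).factorial : ℝ)
      ≤ (s ^ 2) ^ k * (∑ l, w l * (u l ^ 2) ^ k) / ((2 * k).factorial : ℝ) := by gcongr
    _ = _ := by
        rw [Finset.mul_sum, Finset.sum_div]
        refine Finset.sum_congr rfl fun l _ => ?_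
        rw [pow_mul, mul_pow, mul_pow]
        ring

section Sample

variable {n p K : ℕ} {M : ClassModel p K} {Ω : Type*} [MeasurableSpace Ω] {P : Measure Ω}
  {x : Fin n → Ω → EuclideanSpace ℝ (Fin p)} {z : Fin n → Ω → Fin K}

lemma ClassModel.lintegral_law (M : ClassModel p K)
    {F : EuclideanSpace ℝ (Fin p) × Fin K → ENNReal} (hF : Measurable F) :
    ∫⁻ y, F y ∂M.law
      = ∑ k, ENNReal.ofReal (M.prob k) *
          ∫⁻ y, F (y, k) ∂(multivariateGaussian (M.mean k) M.covW) := by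
  rw [ClassModel.law, lintegral_finsetSum_measure]
  refine Finset.sum_congr rfl fun k _ => ?_
  rw [lintegral_smul_measure, lintegral_map hF (by fun_prop), smul_eq_mul]

/-- Expectations of products over an independent sample factorize. -/
lemma lintegral_prod_sample [IsProbabilityMeasure P]
    (hlaw : ∀ i, HasLaw (fun ω => (x i ω, z i ω)) M.law P)
    (hind : iIndepFun (fun i ω => (x i ω, z i ω)) P)
    {F : Fin n → EuclideanSpace ℝ (Fin p) × Fin K → ENNReal} (hF : ∀ i, Measurable (F i)) :
    ∫⁻ ω, ∏ i, F i (x i ω, z i ω) ∂P = ∏ i, ∫⁻ y, F i y ∂M.law := by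
  have hm : ∀ i, AEMeasurable (fun ω => (x i ω, z i ω)) P := fun i => (hlaw i).aemeasurable
  -- The observations are only almost everywhere measurable, so they are replaced by measurable
  -- versions.
  have hae : ∀ i, (fun ω => (x i ω, z i ω)) =ᵐ[P] (hm i).mk := fun i => (hm i).ae_eq_mk
  have hind' : iIndepFun (fun i => (hm i).mk) P := hind.congr hae
  have hcomp : iIndepFun (fun i => F i ∘ (hm i).mk) P := hind'.comp F hF
  have hall : ∀ᵐ ω ∂P, ∀ i, (x i ω, z i ω) = (hm i).mk _ ω := ae_all_iff.2 hae
  rw [lintegral_congr_ae (g := fun ω => ∏ i, (F i ∘ (hm i).mk) ω)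
    (by filter_upwards [hall] with ω hω; simp [hω]),
    lintegral_prod_eq_prod_lintegral_of_indepFun _ _ hcomp
      (fun i => (hF i).comp (hm i).measurable_mk)]
  refine Finset.prod_congr rfl fun i _ => ?_
  rw [← (hlaw i).lintegral_comp (hF i).aemeasurable]
  refine lintegral_congr_ae ?_
  filter_upwards [hae i] with ω hω
  simp [hω]

/-- Probability of the label sequence `κ`. -/
noncomputable def ClassModel.labelProb (M : ClassModel p K) (κ : Fin n → Fin K) : ENNReal :=
  ∏ i, ENNReal.ofReal (M.prob (κ i))

lemma ClassModel.sum_labelProb (M : ClassModel p K) :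
    ∑ κ : Fin n → Fin K, M.labelProb κ = 1 := by
  have h := Finset.prod_univ_sum (fun _ : Fin n => (Finset.univ : Finset (Fin K)))
    (fun _ k => ENNReal.ofReal (M.prob k))
  rw [Fintype.piFinset_univ] at h
  simp only [ClassModel.labelProb]
  rw [← h, ← ENNReal.ofReal_sum_of_nonneg (fun k _ => (M.prob_pos k).le), M.prob_sum]
  simp

open Classical in
/-- Given the labels, the feature vectors are independent Gaussian vectors. -/
lemma lintegral_prod_given_labels [IsProbabilityMeasure P]
    (hlaw : ∀ i, HasLaw (fun ω => (x i ω, z i ω)) M.law P)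
    (hind : iIndepFun (fun i ω => (x i ω, z i ω)) P) (κ : Fin n → Fin K)
    {H : Fin n → EuclideanSpace ℝ (Fin p) → ENNReal} (hH : ∀ i, Measurable (H i)) :
    ∫⁻ ω, ∏ i, (if z i ω = κ i then H i (x i ω) else 0) ∂P
      = M.labelProb κ *
        ∏ i, ∫⁻ y, H i y ∂(multivariateGaussian (M.mean (κ i)) M.covW) := by
  have hF : ∀ i, Measurable fun y : EuclideanSpace ℝ (Fin p) × Fin K =>
      if y.2 = κ i then H i y.1 else 0 := fun i =>
    Measurable.ite (measurableSet_eq_fun (by fun_prop) (by fun_prop)) (by fun_prop) (by fun_prop)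
  rw [lintegral_prod_sample hlaw hind hF, ClassModel.labelProb, ← Finset.prod_mul_distrib]
  refine Finset.prod_congr rfl fun i _ => ?_
  rw [M.lintegral_law (hF i), Finset.sum_eq_single (κ i)]
  · simp
  · intro k _ hk
    simp [hk]
  · simp

/-- A linear plus centred bilinear form of one observation with mean `μ` and covariance `S`. -/
def obsForm (μ : EuclideanSpace ℝ (Fin p)) (S : Matrix (Fin p) (Fin p) ℝ) (a b : Fin p → ℝ)
    (α β γ : ℝ) (y : EuclideanSpace ℝ (Fin p)) : ℝ :=
  α * (∑ j, a j * (y j - μ j)) + β * (∑ j, b j * (y j - μ j))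
    + γ * ((∑ j, a j * (y j - μ j)) * (∑ j, b j * (y j - μ j)) - a ⬝ᵥ S *ᵥ b)

lemma measurable_obsForm (μ : EuclideanSpace ℝ (Fin p)) (S : Matrix (Fin p) (Fin p) ℝ)
    (a b : Fin p → ℝ) (α β γ : ℝ) : Measurable (obsForm μ S a b α β γ) := by
  unfold obsForm; fun_prop

open Classical in
/-- Given the labels, the moment generating function of an average of forms of the observations. -/
lemma lintegral_exp_obsForm_given_labels [IsProbabilityMeasure P]
    (hlaw : ∀ i, HasLaw (fun ω => (x i ω, z i ω)) M.law P)
    (hind : iIndepFun (fun i ω => (x i ω, z i ω)) P) (κ : Fin n → Fin K)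
    (a b : Fin p → ℝ) {τ ν : ℝ} (hτ : 0 < τ) (hν : 0 < ν) (ha : a ⬝ᵥ M.covW *ᵥ a ≤ τ ^ 2)
    (hb : b ⬝ᵥ M.covW *ᵥ b ≤ ν ^ 2) (α β : Fin n → ℝ) {γ θ c : ℝ} (hγ : |γ| ≤ 1)
    (hθ : |θ| * (τ * ν) ≤ 1 / 16) (hα : ∑ i, α i ^ 2 ≤ n * (ν ^ 2 * c)) (hβ : ∀ i, |β i| ≤ τ) :
    ∫⁻ ω, ∏ i, (if z i ω = κ i then ENNReal.ofReal (Real.exp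
        (θ * obsForm (M.mean (κ i)) M.covW a b (α i) (β i) γ (x i ω))) else 0) ∂P
      ≤ M.labelProb κ
        * ENNReal.ofReal (Real.exp (32 * θ ^ 2 * (n * (τ ^ 2 * ν ^ 2 * (2 + c))))) := by
  have hm : ∀ i, Measurable fun y => ENNReal.ofReal (Real.exp
        (θ * obsForm (M.mean (κ i)) M.covW a b (α i) (β i) γ y)) := fun i =>
    ((measurable_obsForm _ _ _ _ _ _ _).const_mul _).exp.ennreal_ofReal
  rw [lintegral_prod_given_labels hlaw hind κ hm]
  refine mul_le_mul_right ?_ _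
  calc ∏ i, ∫⁻ y, ENNReal.ofReal (Real.exp
          (θ * obsForm (M.mean (κ i)) M.covW a b (α i) (β i) γ y))
          ∂(multivariateGaussian (M.mean (κ i)) M.covW)
      ≤ ∏ i, ENNReal.ofReal (Real.exp
          (32 * θ ^ 2 * (α i ^ 2 * τ ^ 2 + β i ^ 2 * ν ^ 2 + τ ^ 2 * ν ^ 2))) :=
        Finset.prod_le_prod' fun i _ =>
          lintegral_exp_observation_le M.covW_posSemidef a b hτ hν ha hb _ _ _ _ hγ hθ
    _ = ENNReal.ofReal (Real.exp (∑ i,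
          32 * θ ^ 2 * (α i ^ 2 * τ ^ 2 + β i ^ 2 * ν ^ 2 + τ ^ 2 * ν ^ 2))) := by
        rw [Real.exp_sum, ENNReal.ofReal_prod_of_nonneg fun i _ => (Real.exp_pos _).le]
    _ ≤ _ := by
        apply ENNReal.ofReal_le_ofReal
        apply Real.exp_le_exp.2
        rw [← Finset.mul_sum]
        gcongr
        calc ∑ i, (α i ^ 2 * τ ^ 2 + β i ^ 2 * ν ^ 2 + τ ^ 2 * ν ^ 2)
            ≤ ∑ i : Fin n, (α i ^ 2 * τ ^ 2 + τ ^ 2 * ν ^ 2 + τ ^ 2 * ν ^ 2) := by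
              refine Finset.sum_le_sum fun i _ => ?_
              have h := sq_le_sq.2 ((hβ i).trans (le_abs_self τ))
              linarith [mul_le_mul_of_nonneg_right h (sq_nonneg ν)]
          _ = (∑ i, α i ^ 2) * τ ^ 2 + n * (2 * (τ ^ 2 * ν ^ 2)) := by
              rw [Finset.sum_add_distrib, Finset.sum_add_distrib, ← Finset.sum_mul]
              simp; ring
          _ ≤ (n * (ν ^ 2 * c)) * τ ^ 2 + n * (2 * (τ ^ 2 * ν ^ 2)) := by gcongr
          _ = _ := by ring

/-- Given the labels, the Euclidean norm of a vector of averages of forms of the observations has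
an exponential tail beyond the multiple `A s` of the square root of its second moment. The bound
does not depend on the number `m` of coordinates, and the coordinates may have different
variances: only the sum of the constants `c l` matters. -/
lemma measure_obsForm_tail_given_labels [IsProbabilityMeasure P]
    (hlaw : ∀ i, HasLaw (fun ω => (x i ω, z i ω)) M.law P)
    (hind : iIndepFun (fun i ω => (x i ω, z i ω)) P) (hn : 0 < n) (κ : Fin n → Fin K) {m : ℕ}
    (hm : 0 < m) (a : Fin p → ℝ) (b : Fin m → Fin p → ℝ) {τ ν : ℝ} (hτ : 0 < τ) (hν : 0 < ν)
    (ha : a ⬝ᵥ M.covW *ᵥ a ≤ τ ^ 2) (hb : ∀ l, b l ⬝ᵥ M.covW *ᵥ b l ≤ ν ^ 2)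
    (α β : Fin n → Fin m → ℝ) {γ : ℝ} (c : Fin m → ℝ) (hγ : |γ| ≤ 1)
    (hα : ∀ l, ∑ i, α i l ^ 2 ≤ n * (ν ^ 2 * c l)) (hβ : ∀ i l, |β i l| ≤ τ)
    (hc : ∑ l, c l ≤ 6 * m) {s A : ℝ} (hs : 0 ≤ s) (hsn : 256 * s ^ 2 ≤ n) :
    P {ω | (∀ i, z i ω = κ i) ∧ 8 * m * (τ ^ 2 * ν ^ 2) / n * (A * s) ^ 2 <
        ∑ l, ((n : ℝ)⁻¹ * ∑ i,
          obsForm (M.mean (κ i)) M.covW a (b l) (α i l) (β i l) γ (x i ω)) ^ 2}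
      ≤ M.labelProb κ * ENNReal.ofReal (2 * Real.exp ((32 - A) * s ^ 2)) := by
  classical
  have hn0 : (0 : ℝ) < n := by exact_mod_cast hn
  have hm0 : (0 : ℝ) < m := by exact_mod_cast hm
  have hc0 : ∀ l, 0 ≤ c l := by
    intro l
    have h := (Finset.sum_nonneg fun i _ => sq_nonneg (α i l)).trans (hα l)
    have h2 : 0 < (n : ℝ) * ν ^ 2 := by positivity
    rw [← mul_assoc] at h
    exact nonneg_of_mul_nonneg_right h h2
  set N : Fin m → Ω → ℝ := fun l ω => (n : ℝ)⁻¹ * ∑ i,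
    obsForm (M.mean (κ i)) M.covW a (b l) (α i l) (β i l) γ (x i ω) with hN
  -- proxies for the standard deviations of the coordinates
  set B : Fin m → ℝ := fun l => √(τ ^ 2 * ν ^ 2 / n * (2 + c l)) with hB
  have hBpos : ∀ l, 0 < B l := fun l => by
    have := hc0 l
    simp only [hB]; positivity
  have hBsq : ∀ l, B l ^ 2 = τ ^ 2 * ν ^ 2 / n * (2 + c l) := fun l => by
    have := hc0 l
    exact Real.sq_sqrt (by positivity)
  set T2 : ℝ := ∑ l, B l ^ 2 with hT2
  have hT2pos : 0 < T2 := by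
    have : Nonempty (Fin m) := ⟨⟨0, hm⟩⟩
    exact Finset.sum_pos (fun l _ => by have := hBpos l; positivity) Finset.univ_nonempty
  have hT2le : T2 ≤ 8 * m * (τ ^ 2 * ν ^ 2) / n := by
    calc T2 = τ ^ 2 * ν ^ 2 / n * (2 * m + ∑ l, c l) := by
          simp only [hT2, hBsq, ← Finset.mul_sum, Finset.sum_add_distrib, Finset.sum_const,
            Finset.card_univ, Fintype.card_fin, nsmul_eq_mul]
          ring
      _ ≤ τ ^ 2 * ν ^ 2 / n * (2 * m + 6 * m) := by gcongr
      _ = _ := by ring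
  -- With weights proportional to the variances, the weighted mean of the squared standardized
  -- coordinates is the squared norm divided by `T2`.
  set w : Fin m → ℝ := fun l => B l ^ 2 / T2 with hw
  have hw0 : ∀ l, 0 ≤ w l := fun l => by simp only [hw]; positivity
  have hw1 : ∑ l, w l = 1 := by
    simp only [hw, ← Finset.sum_div]; exact div_self hT2pos.ne'
  set F : ℝ → Fin m → Ω → ENNReal := fun θ l ω => ∏ i, (if z i ω = κ i then
    ENNReal.ofReal (Real.exp (θ *
      obsForm (M.mean (κ i)) M.covW a (b l) (α i l) (β i l) γ (x i ω))) else 0) with hF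
  -- `t l * n * N l = s * (N l / B l)`, so all coordinates have moment generating function
  -- at most `exp (32 s²)` at `± t l`.
  set t : Fin m → ℝ := fun l => s / (B l * n) with ht
  have hFint : ∀ l, ∀ θ, |θ| = t l → ∫⁻ ω, F θ l ω ∂P
      ≤ M.labelProb κ * ENNReal.ofReal (Real.exp (32 * s ^ 2)) := by
    intro l θ hθ
    have hB0 := hBpos l
    have hθle : |θ| * (τ * ν) ≤ 1 / 16 := by
      have h1 : 16 * s * (τ * ν) ≤ B l * n := by
        refine (abs_le_of_sq_le_sq' ?_ (by positivity)).2
        calc (16 * s * (τ * ν)) ^ 2 = 256 * s ^ 2 * (τ ^ 2 * ν ^ 2) := by ring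
          _ ≤ n * (τ ^ 2 * ν ^ 2) * (2 + c l) := by
              have : (1 : ℝ) ≤ 2 + c l := by linarith [hc0 l]
              calc 256 * s ^ 2 * (τ ^ 2 * ν ^ 2) ≤ n * (τ ^ 2 * ν ^ 2) := by gcongr
                _ ≤ _ := le_mul_of_one_le_right (by positivity) this
          _ = (B l * n) ^ 2 := by rw [mul_pow, hBsq]; field_simp
      rw [hθ]
      simp only [ht]
      rw [div_mul_eq_mul_div, div_le_iff₀ (by positivity)]
      linarith
    refine (lintegral_exp_obsForm_given_labels hlaw hind κ a (b l) hτ hν ha (hb l)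
      (fun i => α i l) (fun i => β i l) hγ hθle (hα l) (fun i => hβ i l)).trans (le_of_eq ?_)
    congr 3
    rw [← sq_abs θ, hθ]
    simp only [ht]
    have : (n : ℝ) * (τ ^ 2 * ν ^ 2 * (2 + c l)) = n ^ 2 * B l ^ 2 := by
      rw [hBsq]; field_simp
    rw [this]
    field_simp
  -- `Ψ` is the weighted mean of `cosh (s N l / B l)` on the event that the labels are `κ`.
  set Ψ : Ω → ENNReal := fun ω =>
    ∑ l, ENNReal.ofReal (w l / 2) * (F (t l) l ω + F (-t l) l ω) with hΨ
  have hzm : ∀ i, AEMeasurable (fun ω => (x i ω, z i ω)) P := fun i => (hlaw i).aemeasurable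
  have hFm : ∀ θ l, AEMeasurable (F θ l) P := by
    intro θ l
    refine Finset.aemeasurable_fun_prod _ fun i _ => ?_
    have hmeas : Measurable fun y : EuclideanSpace ℝ (Fin p) × Fin K => if y.2 = κ i then
      ENNReal.ofReal (Real.exp (θ *
        obsForm (M.mean (κ i)) M.covW a (b l) (α i l) (β i l) γ y.1)) else 0 :=
      Measurable.ite (measurableSet_eq_fun (by fun_prop) (by fun_prop))
        (((measurable_obsForm _ _ _ _ _ _ _).comp measurable_fst).const_mul _).exp.ennreal_ofReal
        (by fun_prop)
    exact hmeas.comp_aemeasurable (hzm i)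
  have hFadd : ∀ l, AEMeasurable (fun ω => F (t l) l ω + F (-t l) l ω) P :=
    fun l => (hFm _ l).add (hFm _ l)
  have hΨl : ∀ l ∈ Finset.univ, AEMeasurable
      (fun ω => ENNReal.ofReal (w l / 2) * (F (t l) l ω + F (-t l) l ω)) P :=
    fun l _ => (hFadd l).const_mul _
  have hΨm : AEMeasurable Ψ P := Finset.aemeasurable_fun_sum _ hΨl
  have hΨint : ∫⁻ ω, Ψ ω ∂P ≤ M.labelProb κ * ENNReal.ofReal (Real.exp (32 * s ^ 2)) := by
    have htpos : ∀ l, 0 ≤ t l := fun l => by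
      have := hBpos l
      simp only [ht]; positivity
    simp only [hΨ]
    rw [lintegral_finsetSum' _ hΨl]
    calc ∑ l, ∫⁻ ω, ENNReal.ofReal (w l / 2) * (F (t l) l ω + F (-t l) l ω) ∂P
        ≤ ∑ l, ENNReal.ofReal (w l / 2) *
          (2 * (M.labelProb κ * ENNReal.ofReal (Real.exp (32 * s ^ 2)))) := by
          gcongr with l
          rw [lintegral_const_mul'' _ (hFadd l), lintegral_add_left' (hFm _ l),
            two_mul]
          gcongr
          · exact hFint l _ (abs_of_nonneg (htpos l))
          · exact hFint l _ (by rw [abs_neg]; exact abs_of_nonneg (htpos l))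
      _ = M.labelProb κ * ENNReal.ofReal (Real.exp (32 * s ^ 2)) := by
          rw [← Finset.sum_mul, ← ENNReal.ofReal_sum_of_nonneg fun l _ => by
            have := hw0 l; positivity]
          rw [← Finset.sum_div, hw1, ← mul_assoc]
          have : ENNReal.ofReal (1 / 2) * 2 = 1 := by
            rw [show (2 : ENNReal) = ENNReal.ofReal 2 by simp,
              ← ENNReal.ofReal_mul (by norm_num)]
            norm_num
          rw [this, one_mul]
  have hsub : {ω | (∀ i, z i ω = κ i) ∧ 8 * m * (τ ^ 2 * ν ^ 2) / n * (A * s) ^ 2 <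
      ∑ l, N l ω ^ 2} ⊆ {ω | ENNReal.ofReal (Real.exp (A * s ^ 2) / 2) ≤ Ψ ω} := by
    rintro ω ⟨hz, hbig⟩
    simp only [Set.mem_ofPred_eq]
    have hFval : ∀ θ l, F θ l ω = ENNReal.ofReal (Real.exp (θ * (n * N l ω))) := by
      intro θ l
      simp only [hF, hz, if_true]
      rw [← ENNReal.ofReal_prod_of_nonneg fun i _ => (Real.exp_pos _).le, ← Real.exp_sum,
        ← Finset.mul_sum]
      simp only [hN]
      rw [mul_inv_cancel_left₀ hn0.ne']
    have hΨval : Ψ ω = ENNReal.ofReal (∑ l, w l * Real.cosh (s * (N l ω / B l))) := by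
      rw [ENNReal.ofReal_sum_of_nonneg fun l _ => mul_nonneg (hw0 l) (Real.cosh_pos _).le]
      simp only [hΨ, hFval]
      refine Finset.sum_congr rfl fun l _ => ?_
      rw [← ENNReal.ofReal_add (Real.exp_pos _).le (Real.exp_pos _).le,
        ← ENNReal.ofReal_mul (by have := hw0 l; positivity), Real.cosh_eq]
      have hB0 := hBpos l
      have e1 : t l * (n * N l ω) = s * (N l ω / B l) := by
        simp only [ht]; field_simp
      rw [e1, neg_mul, e1]
      congr 1; ring
    rw [hΨval]
    apply ENNReal.ofReal_le_ofReal
    refine le_trans ?_ (cosh_mul_sqrt_sum_le w (fun l => N l ω / B l) hw0 hw1 s)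
    have hsum : ∑ l, w l * (N l ω / B l) ^ 2 = (∑ l, N l ω ^ 2) / T2 := by
      rw [Finset.sum_div]
      refine Finset.sum_congr rfl fun l _ => ?_
      have hB0 := hBpos l
      simp only [hw]; field_simp
    have hle : A * s ≤ √(∑ l, w l * (N l ω / B l) ^ 2) := by
      apply Real.le_sqrt_of_sq_le
      rw [hsum, le_div_iff₀ hT2pos]
      calc (A * s) ^ 2 * T2 ≤ (A * s) ^ 2 * (8 * m * (τ ^ 2 * ν ^ 2) / n) := by gcongr
        _ ≤ ∑ l, N l ω ^ 2 := by linarith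
    calc Real.exp (A * s ^ 2) / 2
        ≤ Real.exp (s * √(∑ l, w l * (N l ω / B l) ^ 2)) / 2 := by
          refine div_le_div_of_nonneg_right (Real.exp_le_exp.2 ?_) two_pos.le
          calc A * s ^ 2 = s * (A * s) := by ring
            _ ≤ _ := by gcongr
      _ ≤ _ := by
          rw [Real.cosh_eq]
          have := Real.exp_pos (-(s * √(∑ l, w l * (N l ω / B l) ^ 2)))
          linarith
  refine (measure_mono hsub).trans ?_
  have hmarkov := mul_meas_ge_le_lintegral₀ hΨm (ENNReal.ofReal (Real.exp (A * s ^ 2) / 2))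
  have hpos : ENNReal.ofReal (Real.exp (A * s ^ 2) / 2) ≠ 0 := by
    have := Real.exp_pos (A * s ^ 2)
    simp [this]
  rw [mul_comm, ← ENNReal.le_div_iff_mul_le (Or.inl hpos) (Or.inl ENNReal.ofReal_ne_top)] at hmarkov
  refine hmarkov.trans ((ENNReal.div_le_div_right hΨint _).trans (le_of_eq ?_))
  rw [mul_div_assoc, ← ENNReal.ofReal_div_of_pos (by positivity)]
  congr 2
  rw [sub_mul, Real.exp_sub]
  field_simp

/-- The tail bound of `measure_obsForm_tail_given_labels`, averaged over the label sequences in a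
set `G`; all coefficients may depend on the labels. -/
lemma measure_obsForm_tail [IsProbabilityMeasure P]
    (hlaw : ∀ i, HasLaw (fun ω => (x i ω, z i ω)) M.law P)
    (hind : iIndepFun (fun i ω => (x i ω, z i ω)) P) (hn : 0 < n) (G : Set (Fin n → Fin K))
    {m : ℕ} (hm : 0 < m) (a : Fin p → ℝ) (b : Fin m → Fin p → ℝ) {τ ν : ℝ} (hτ : 0 < τ)
    (hν : 0 < ν) (ha : a ⬝ᵥ M.covW *ᵥ a ≤ τ ^ 2) (hb : ∀ l, b l ⬝ᵥ M.covW *ᵥ b l ≤ ν ^ 2)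
    (α β : (Fin n → Fin K) → Fin n → Fin m → ℝ) {γ : ℝ} (c : (Fin n → Fin K) → Fin m → ℝ)
    (hγ : |γ| ≤ 1) (hα : ∀ κ ∈ G, ∀ l, ∑ i, α κ i l ^ 2 ≤ n * (ν ^ 2 * c κ l))
    (hβ : ∀ κ ∈ G, ∀ i l, |β κ i l| ≤ τ) (hc : ∀ κ ∈ G, ∑ l, c κ l ≤ 6 * m) {s A : ℝ}
    (hs : 0 ≤ s) (hsn : 256 * s ^ 2 ≤ n) :
    P {ω | (fun i => z i ω) ∈ G ∧ 8 * m * (τ ^ 2 * ν ^ 2) / n * (A * s) ^ 2 <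
        ∑ l, ((n : ℝ)⁻¹ * ∑ i, obsForm (M.mean (z i ω)) M.covW a (b l)
          (α (fun i => z i ω) i l) (β (fun i => z i ω) i l) γ (x i ω)) ^ 2}
      ≤ ENNReal.ofReal (2 * Real.exp ((32 - A) * s ^ 2)) := by
  classical
  have hsub : {ω | (fun i => z i ω) ∈ G ∧ 8 * m * (τ ^ 2 * ν ^ 2) / n * (A * s) ^ 2 <
        ∑ l, ((n : ℝ)⁻¹ * ∑ i, obsForm (M.mean (z i ω)) M.covW a (b l)
          (α (fun i => z i ω) i l) (β (fun i => z i ω) i l) γ (x i ω)) ^ 2}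
      ⊆ ⋃ κ ∈ Finset.univ.filter (· ∈ G),
        {ω | (∀ i, z i ω = κ i) ∧ 8 * m * (τ ^ 2 * ν ^ 2) / n * (A * s) ^ 2 <
        ∑ l, ((n : ℝ)⁻¹ * ∑ i,
          obsForm (M.mean (κ i)) M.covW a (b l) (α κ i l) (β κ i l) γ (x i ω)) ^ 2} := by
    rintro ω ⟨hG, h⟩
    simp only [Set.mem_iUnion, Finset.mem_filter, Finset.mem_univ, true_and]
    exact ⟨fun i => z i ω, hG, fun i => rfl, h⟩
  calc _ ≤ _ := measure_mono hsub
    _ ≤ ∑ κ ∈ Finset.univ.filter (· ∈ G), _ := measure_biUnion_finset_le _ _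
    _ ≤ ∑ κ ∈ Finset.univ.filter (· ∈ G),
        M.labelProb κ * ENNReal.ofReal (2 * Real.exp ((32 - A) * s ^ 2)) := by
        refine Finset.sum_le_sum fun κ hκ => ?_
        have hκG : κ ∈ G := by simpa using hκ
        exact measure_obsForm_tail_given_labels hlaw hind hn κ hm a b hτ hν ha hb (α κ) (β κ)
          (c κ) hγ (hα κ hκG) (hβ κ hκG) (hc κ hκG) hs hsn
    _ ≤ ∑ κ : Fin n → Fin K,
        M.labelProb κ * ENNReal.ofReal (2 * Real.exp ((32 - A) * s ^ 2)) :=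
        Finset.sum_le_sum_of_subset (Finset.filter_subset _ _)
    _ = _ := by rw [← Finset.sum_mul, M.sum_labelProb, one_mul]

end Sample

/-! ### Population moments -/

section Moments

variable {n p K : ℕ} (M : ClassModel p K)

lemma ClassModel.integral_law {F : EuclideanSpace ℝ (Fin p) × Fin K → ℝ} (hF : Measurable F)
    (hint : ∀ k, Integrable (fun y => F (y, k)) (multivariateGaussian (M.mean k) M.covW)) :
    ∫ y, F y ∂M.law
      = ∑ k, M.prob k * ∫ y, F (y, k) ∂(multivariateGaussian (M.mean k) M.covW) := by
  have hm : ∀ k : Fin K, Measurable fun y : EuclideanSpace ℝ (Fin p) => (y, k) := fun k =>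
    measurable_id.prodMk measurable_const
  rw [ClassModel.law, integral_finsetSum_measure]
  · refine Finset.sum_congr rfl fun k _ => ?_
    rw [integral_smul_measure, integral_map (hm k).aemeasurable hF.aestronglyMeasurable,
      ENNReal.toReal_ofReal (M.prob_pos k).le, smul_eq_mul]
  · intro k _
    refine Integrable.smul_measure ?_ ENNReal.ofReal_ne_top
    exact (integrable_map_measure hF.aestronglyMeasurable (hm k).aemeasurable).2 (hint k)

lemma memLp_two_eval_multivariateGaussian (μ : EuclideanSpace ℝ (Fin p))
    (S : Matrix (Fin p) (Fin p) ℝ) (j : Fin p) :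
    MemLp (fun x : EuclideanSpace ℝ (Fin p) => x j) 2 (multivariateGaussian μ S) := by
  have h := (EuclideanSpace.proj j : EuclideanSpace ℝ (Fin p) →L[ℝ] ℝ).comp_memLp'
    (IsGaussian.memLp_two_id (μ := multivariateGaussian μ S))
  exact h

lemma integral_eval_multivariateGaussian (μ : EuclideanSpace ℝ (Fin p))
    (S : Matrix (Fin p) (Fin p) ℝ) (j : Fin p) :
    ∫ x, x j ∂(multivariateGaussian μ S) = μ j := by
  have h := ContinuousLinearMap.integral_comp_id_comm
    (IsGaussian.integrable_id (μ := multivariateGaussian μ S))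
    (EuclideanSpace.proj j : EuclideanSpace ℝ (Fin p) →L[ℝ] ℝ)
  rw [integral_id_multivariateGaussian] at h
  exact h

lemma integral_eval_mul_eval_multivariateGaussian (μ : EuclideanSpace ℝ (Fin p))
    {S : Matrix (Fin p) (Fin p) ℝ} (hS : S.PosSemidef) (j j' : Fin p) :
    ∫ x, x j * x j' ∂(multivariateGaussian μ S) = S j j' + μ j * μ j' := by
  have h := covariance_eq_sub (memLp_two_eval_multivariateGaussian μ S j)
    (memLp_two_eval_multivariateGaussian μ S j')
  rw [covariance_eval_multivariateGaussian hS, integral_eval_multivariateGaussian,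
    integral_eval_multivariateGaussian] at h
  simp only [Pi.mul_apply] at h
  linarith

/-- The total covariance is the sum of the within-class and the between-class covariance. -/
lemma ClassModel.totalCov_apply (j j' : Fin p) :
    M.totalCov j j' = M.covW j j' + ∑ k, M.prob k * (M.mean k j * M.mean k j') := by
  have hmean : ∀ i, ∫ x, x i ∂M.featureLaw = 0 := by
    intro i
    rw [ClassModel.featureLaw, integral_map measurable_fst.aemeasurable
      (Measurable.aestronglyMeasurable (by fun_prop)),
      M.integral_law (F := fun y => y.1 i) (by fun_prop)
      fun k => (memLp_two_eval_multivariateGaussian _ _ i).integrable (by norm_num)]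
    simp only [integral_eval_multivariateGaussian]
    have := congrArg (fun v : EuclideanSpace ℝ (Fin p) => v i) M.mean_zero
    simpa using this
  rw [ClassModel.totalCov, Matrix.of_apply, covariance, hmean, hmean]
  simp only [sub_zero]
  rw [ClassModel.featureLaw, integral_map measurable_fst.aemeasurable
      (Measurable.aestronglyMeasurable (by fun_prop)),
      M.integral_law (F := fun y => y.1 j * y.1 j') (by fun_prop)
      fun k => (memLp_two_eval_multivariateGaussian _ _ j).integrable_mul
        (memLp_two_eval_multivariateGaussian _ _ j')]
  simp only [integral_eval_mul_eval_multivariateGaussian _ M.covW_posSemidef, mul_add,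
    Finset.sum_add_distrib, ← Finset.sum_mul, M.prob_sum, one_mul]

lemma ClassModel.covW_diag_add_mean_sq_le (j : Fin p) (k : Fin K) :
    M.covW j j + M.mean k j ^ 2 ≤ M.tau ^ 2 := by
  have hj : 0 ≤ M.covW j j := M.covW_posSemidef.diag_nonneg
  have hk : M.mean k j ^ 2 ≤ ⨆ k : Fin K, (M.mean k j) ^ 2 :=
    le_ciSup (f := fun k : Fin K => (M.mean k j) ^ 2) (Set.finite_range _).bddAbove k
  have hsup : 0 ≤ ⨆ k : Fin K, (M.mean k j) ^ 2 := (sq_nonneg _).trans hk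
  have h1 : √(M.covW j j + ⨆ k : Fin K, (M.mean k j) ^ 2) ≤ M.tau :=
    le_ciSup (f := fun j : Fin p => √(M.covW j j + ⨆ k : Fin K, (M.mean k j) ^ 2))
      (Set.finite_range _).bddAbove j
  calc M.covW j j + M.mean k j ^ 2 ≤ M.covW j j + ⨆ k : Fin K, (M.mean k j) ^ 2 := by gcongr
    _ = √(M.covW j j + ⨆ k : Fin K, (M.mean k j) ^ 2) ^ 2 := (Real.sq_sqrt (by positivity)).symm
    _ ≤ M.tau ^ 2 := by gcongr

lemma ClassModel.tau_nonneg : 0 ≤ M.tau := Real.iSup_nonneg fun _ => Real.sqrt_nonneg _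

lemma ClassModel.abs_mean_le_tau (j : Fin p) (k : Fin K) : |M.mean k j| ≤ M.tau := by
  refine abs_le_of_sq_le_sq ?_ M.tau_nonneg
  have hj : 0 ≤ M.covW j j := M.covW_posSemidef.diag_nonneg
  linarith [M.covW_diag_add_mean_sq_le j k]

lemma ClassModel.covW_diag_le (hK : 0 < K) (j : Fin p) : M.covW j j ≤ M.tau ^ 2 := by
  have := M.covW_diag_add_mean_sq_le j ⟨0, hK⟩
  nlinarith [sq_nonneg (M.mean ⟨0, hK⟩ j)]

end Moments

/-! ### Class frequencies -/

section Frequencies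

variable {n p K : ℕ} {M : ClassModel p K} {Ω : Type*} [MeasurableSpace Ω] {P : Measure Ω}
  {x : Fin n → Ω → EuclideanSpace ℝ (Fin p)} {z : Fin n → Ω → Fin K}

/-- Relative frequency of the label `k` in the label sequence `κ`. -/
noncomputable def classFreq (κ : Fin n → Fin K) (k : Fin K) : ℝ := classCount κ k / n

lemma classFreq_nonneg (κ : Fin n → Fin K) (k : Fin K) : 0 ≤ classFreq κ k := by
  unfold classFreq classCount; positivity

lemma sum_comp_label (κ : Fin n → Fin K) (h : Fin K → ℝ) :
    (n : ℝ)⁻¹ * ∑ i, h (κ i) = ∑ k, classFreq κ k * h k := by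
  rw [← Finset.sum_fiberwise (s := Finset.univ) (g := κ), Finset.mul_sum]
  refine Finset.sum_congr rfl fun k _ => ?_
  have : ∑ i ∈ Finset.univ.filter (fun i => κ i = k), h (κ i)
      = ∑ i ∈ Finset.univ.filter (fun i => κ i = k), h k :=
    Finset.sum_congr rfl fun i hi => by rw [(Finset.mem_filter.1 hi).2]
  rw [this, Finset.sum_const, nsmul_eq_mul, classFreq, classCount]
  ring

/-- Pearson's chi-square distance between class frequencies and class probabilities. -/
noncomputable def ClassModel.chiSq (M : ClassModel p K) (κ : Fin n → Fin K) : ℝ :=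
  ∑ k, (classFreq κ k - M.prob k) ^ 2 / M.prob k

lemma ClassModel.chiSq_nonneg (M : ClassModel p K) (κ : Fin n → Fin K) : 0 ≤ M.chiSq κ :=
  Finset.sum_nonneg fun k _ => div_nonneg (sq_nonneg _) (M.prob_pos k).le

/-- Mean and variance of an average of a function of the labels. -/
lemma label_average_moments [IsProbabilityMeasure P] (hn : 0 < n)
    (hlaw : ∀ i, HasLaw (fun ω => (x i ω, z i ω)) M.law P)
    (hind : iIndepFun (fun i ω => (x i ω, z i ω)) P) (h : Fin K → ℝ) :
    MemLp (fun ω => ∑ k, classFreq (fun i => z i ω) k * h k) 2 P ∧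
    ∫ ω, ∑ k, classFreq (fun i => z i ω) k * h k ∂P = ∑ k, M.prob k * h k ∧
    Var[fun ω => ∑ k, classFreq (fun i => z i ω) k * h k; P]
      ≤ (∑ k, M.prob k * h k ^ 2) / n := by
  have hn0 : (n : ℝ) ≠ 0 := by exact_mod_cast hn.ne'
  have hzm : ∀ i, AEMeasurable (z i) P := fun i =>
    measurable_snd.comp_aemeasurable (hlaw i).aemeasurable
  have hint : ∀ g : Fin K → ℝ, ∀ i, ∫ ω, g (z i ω) ∂P = ∑ k, M.prob k * g k := by
    intro g i
    have h1 := (hlaw i).integral_comp (f := fun y => g y.2)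
      (Measurable.aestronglyMeasurable (by fun_prop))
    rw [M.integral_law (F := fun y => g y.2) (by fun_prop)
      (fun k => integrable_const (g k))] at h1
    simpa using h1
  have hX : ∀ i, MemLp (fun ω => h (z i ω)) 2 P := by
    intro i
    refine MemLp.of_bound ((by fun_prop : Measurable h).comp_aemeasurable
      (hzm i)).aestronglyMeasurable (∑ k, |h k|) (ae_of_all _ fun ω => ?_)
    rw [Real.norm_eq_abs]
    exact Finset.single_le_sum (f := fun k => |h k|) (fun k _ => abs_nonneg _)
      (Finset.mem_univ (z i ω))
  have hfun : (fun ω => ∑ k, classFreq (fun i => z i ω) k * h k)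
      = fun ω => (n : ℝ)⁻¹ * (∑ i, fun ω => h (z i ω)) ω := by
    ext ω
    rw [← sum_comp_label, Finset.sum_apply]
  have hmem : MemLp (∑ i, fun ω => h (z i ω)) 2 P := memLp_finsetSum' _ fun i _ => hX i
  rw [hfun]
  refine ⟨hmem.const_mul _, ?_, ?_⟩
  · rw [integral_const_mul]
    simp only [Finset.sum_apply]
    rw [integral_finsetSum _ fun i _ => (hX i).integrable (by norm_num)]
    simp only [hint]
    simp
    field_simp
  · rw [variance_const_mul, IndepFun.variance_sum fun i _ => hX i]
    · have hv : ∀ i, Var[fun ω => h (z i ω); P] ≤ ∑ k, M.prob k * h k ^ 2 := by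
        intro i
        refine (variance_le_expectation_sq (hX i).aestronglyMeasurable).trans (le_of_eq ?_)
        exact hint (fun k => h k ^ 2) i
      calc (n : ℝ)⁻¹ ^ 2 * ∑ i, Var[fun ω => h (z i ω); P]
          ≤ (n : ℝ)⁻¹ ^ 2 * ∑ i : Fin n, ∑ k, M.prob k * h k ^ 2 := by
            gcongr with i; exact hv i
        _ = _ := by
            simp only [Finset.sum_const, Finset.card_univ, Fintype.card_fin, nsmul_eq_mul]
            field_simp
    · intro i _ i' _ hii
      exact (hind.indepFun hii).comp (φ := fun y => h y.2) (ψ := fun y => h y.2)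
        (by fun_prop) (by fun_prop)

/-- Chebyshev's inequality for the average of a function of the labels. -/
lemma measure_label_average_le [IsProbabilityMeasure P] (hn : 0 < n)
    (hlaw : ∀ i, HasLaw (fun ω => (x i ω, z i ω)) M.law P)
    (hind : iIndepFun (fun i ω => (x i ω, z i ω)) P) (h : Fin K → ℝ) {m : ℝ} (hm : 0 < m)
    (hmean : ∑ k, M.prob k * h k ≤ m) :
    P {ω | 2 * m < ∑ k, classFreq (fun i => z i ω) k * h k}
      ≤ ENNReal.ofReal ((∑ k, M.prob k * h k ^ 2) / (n * m ^ 2)) := by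
  obtain ⟨h1, h2, h3⟩ := label_average_moments hn hlaw hind h
  refine (measure_mono ?_).trans ((meas_ge_le_variance_div_sq h1 hm).trans
    (ENNReal.ofReal_le_ofReal ?_))
  · intro ω hω
    simp only [Set.mem_ofPred_eq] at hω ⊢
    rw [h2]
    refine le_trans ?_ (le_abs_self _)
    linarith
  · rw [← div_div]
    gcongr

/-- Markov's inequality for the chi-square distance, which has expectation at most `K / n` whatever
the class probabilities are. -/
lemma measure_chiSq_le [IsProbabilityMeasure P] (hn : 0 < n)
    (hlaw : ∀ i, HasLaw (fun ω => (x i ω, z i ω)) M.law P)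
    (hind : iIndepFun (fun i ω => (x i ω, z i ω)) P) {t : ℝ} (ht : 0 < t) :
    P {ω | t < M.chiSq (fun i => z i ω)} ≤ ENNReal.ofReal (K / (n * t)) := by
  have hk : ∀ k, Integrable (fun ω => (classFreq (fun i => z i ω) k - M.prob k) ^ 2 / M.prob k) P ∧
      ∫ ω, (classFreq (fun i => z i ω) k - M.prob k) ^ 2 / M.prob k ∂P ≤ 1 / n := by
    intro k
    obtain ⟨h1, h2, h3⟩ := label_average_moments hn hlaw hind (fun k' => if k' = k then 1 else 0)
    simp only [mul_ite, mul_one, mul_zero, Finset.sum_ite_eq', Finset.mem_univ, if_true, ite_pow,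
      one_pow, ne_eq, OfNat.ofNat_ne_zero, not_false_eq_true, zero_pow] at h1 h2 h3
    have hsub : MemLp (fun ω => classFreq (fun i => z i ω) k - M.prob k) 2 P :=
      h1.sub (memLp_const _)
    refine ⟨hsub.integrable_sq.div_const _, ?_⟩
    rw [integral_div]
    rw [variance_eq_integral h1.aemeasurable, h2] at h3
    rw [div_le_iff₀ (M.prob_pos k)]
    exact h3.trans (le_of_eq (by ring))
  have hint : Integrable (fun ω => M.chiSq (fun i => z i ω)) P :=
    integrable_finsetSum _ fun k _ => (hk k).1
  have hE : ∫ ω, M.chiSq (fun i => z i ω) ∂P ≤ K / n := by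
    simp only [ClassModel.chiSq]
    rw [integral_finsetSum _ fun k _ => (hk k).1]
    calc _ ≤ ∑ k : Fin K, 1 / (n : ℝ) := Finset.sum_le_sum fun k _ => (hk k).2
      _ = _ := by simp [div_eq_mul_inv]
  have hM := mul_meas_ge_le_integral_of_nonneg (ae_of_all _ fun ω => M.chiSq_nonneg _) hint t
  rw [← ENNReal.ofReal_toReal (measure_ne_top P _)]
  apply ENNReal.ofReal_le_ofReal
  calc (P {ω | t < M.chiSq (fun i => z i ω)}).toReal
      ≤ P.real {ω | t ≤ M.chiSq (fun i => z i ω)} :=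
        measureReal_mono fun ω (hω : t < _) => hω.le
    _ ≤ K / n / t := by
        rw [le_div_iff₀ ht, mul_comm]; exact hM.trans hE
    _ = _ := div_div _ _ _

end Frequencies

/-! ### Orthogonal contrasts -/

section Contrasts

variable {n K : ℕ}

/-- The `r`-th orthogonal contrast, for class weights `q`, of a function `h` of the class. -/
noncomputable def contrast (q h : Fin K → ℝ) (r : Fin (K - 1)) : ℝ :=
  √(q (nextClass r)) *
    (∑ k ∈ Finset.univ.filter (fun k : Fin K => (k : ℕ) ≤ r), q k * (h k - h (nextClass r))) /
    √(cumWeight q r * cumWeight q (r + 1))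

lemma ClassModel.contrasts_apply {p : ℕ} (M : ClassModel p K) (j : Fin p) (r : Fin (K - 1)) :
    M.contrasts j r = contrast M.prob (fun k => M.mean k j) r := rfl

lemma cumWeight_succ (q : Fin K → ℝ) (r : Fin (K - 1)) :
    cumWeight q (r + 1) = cumWeight q r + q (nextClass r) := by
  have h : Finset.univ.filter (fun k : Fin K => (k : ℕ) ≤ r + 1)
      = insert (nextClass r) (Finset.univ.filter (fun k : Fin K => (k : ℕ) ≤ r)) := by
    ext k
    simp only [Finset.mem_filter, Finset.mem_univ, true_and, Finset.mem_insert, nextClass,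
      Fin.ext_iff]
    omega
  rw [cumWeight, h, Finset.sum_insert (by simp [nextClass]), cumWeight, add_comm]

lemma cumWeight_nonneg {q : Fin K → ℝ} (hq : ∀ k, 0 ≤ q k) (m : ℕ) : 0 ≤ cumWeight q m :=
  Finset.sum_nonneg fun k _ => hq k

lemma cumWeight_pos {q : Fin K → ℝ} (hq : ∀ k, 0 < q k) (r : Fin (K - 1)) :
    0 < cumWeight q r := by
  have hr := r.2
  refine Finset.sum_pos (fun k _ => hq k) ⟨⟨0, by omega⟩, ?_⟩
  simp

lemma abs_cumWeight_le {u v : Fin K → ℝ} (huv : ∀ k, |u k| ≤ v k) (m : ℕ) :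
    |cumWeight u m| ≤ cumWeight v m :=
  (Finset.abs_sum_le_sum_abs _ _).trans (Finset.sum_le_sum fun k _ => huv k)

/-- The sum in a contrast, with the class `r + 1` separated. -/
lemma sum_contrast_eq (q h : Fin K → ℝ) (r : Fin (K - 1)) :
    ∑ k ∈ Finset.univ.filter (fun k : Fin K => (k : ℕ) ≤ r), q k * (h k - h (nextClass r))
      = cumWeight (fun k => q k * h k) r - cumWeight q r * h (nextClass r) := by
  simp only [mul_sub, Finset.sum_sub_distrib, ← Finset.sum_mul, cumWeight]

/-- A contrast is a scaled difference between the mean of `h` over the first classes and its value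
at the next class. -/
lemma contrast_eq_mean_sub {q : Fin K → ℝ} (hq : ∀ k, 0 ≤ q k) (h : Fin K → ℝ)
    (r : Fin (K - 1)) :
    contrast q h r = √(q (nextClass r)) * (√(cumWeight q r) / √(cumWeight q (r + 1))) *
      (cumWeight (fun k => q k * h k) r / cumWeight q r - h (nextClass r)) := by
  have hs := cumWeight_nonneg hq r
  rw [contrast, sum_contrast_eq, Real.sqrt_mul hs]
  rcases hs.eq_or_lt with h0 | h0
  · simp [← h0]
  · have e : cumWeight q r = √(cumWeight q r) * √(cumWeight q r) := (Real.mul_self_sqrt hs).symm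
    have e0 : √(cumWeight q r) ≠ 0 := (Real.sqrt_pos.2 h0).ne'
    generalize √(cumWeight q r) = u at *
    rw [e]
    rcases eq_or_ne √(cumWeight q (r + 1)) 0 with h1 | h1
    · simp [h1]
    · field_simp

/-- Scalar form of the telescoping identity behind Bessel's inequality. -/
lemma contrast_sq_le_aux {Q s T h : ℝ} (hQ : 0 ≤ Q) (hs : 0 ≤ s) (hT : s = 0 → T = 0) :
    (√Q * (T - s * h) / √(s * (s + Q))) ^ 2
      ≤ Q * h ^ 2 + (T ^ 2 / s - (T + Q * h) ^ 2 / (s + Q)) := by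
  rw [div_pow, mul_pow, Real.sq_sqrt hQ, Real.sq_sqrt (by positivity)]
  rcases hs.eq_or_lt with h0 | h0
  · subst h0
    rw [hT rfl]
    rcases hQ.eq_or_lt with h1 | h1
    · simp [← h1]
    · apply le_of_eq
      field_simp
      ring
  · apply le_of_eq
    have : s + Q ≠ 0 := by positivity
    field_simp
    ring

/-- Bessel's inequality: the contrasts are the coefficients of `h` in an orthonormal system of
the space of functions of the class, weighted by `q`. -/
lemma sum_contrast_sq_le {q : Fin K → ℝ} (hq : ∀ k, 0 ≤ q k) (h : Fin K → ℝ) :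
    ∑ r, contrast q h r ^ 2 ≤ ∑ k, q k * h k ^ 2 := by
  rcases K with _ | m
  · simp
  -- `Φ r` is the squared norm of the part of `h` that is constant on the classes `0, …, r`.
  set Φ : ℕ → ℝ := fun r => cumWeight (fun k => q k * h k) r ^ 2 / cumWeight q r with hΦ
  have hstep : ∀ r : Fin (m + 1 - 1), contrast q h r ^ 2
      ≤ q (nextClass r) * h (nextClass r) ^ 2 + (Φ r - Φ (r + 1)) := by
    intro r
    have hs := cumWeight_nonneg hq r
    have h1 := contrast_sq_le_aux (hq (nextClass r)) hs (h := h (nextClass r))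
      (T := cumWeight (fun k => q k * h k) r) (by
        intro h0
        have h2 := (Finset.sum_eq_zero_iff_of_nonneg fun k _ => hq k).1 h0
        exact Finset.sum_eq_zero fun k hk => by simp [h2 k hk])
    simp only [hΦ]
    rw [contrast, sum_contrast_eq, cumWeight_succ, cumWeight_succ]
    exact h1
  have htel : ∑ r : Fin (m + 1 - 1), (Φ r - Φ (r + 1)) = Φ 0 - Φ m := by
    rw [Fin.sum_univ_eq_sum_range (fun r => Φ r - Φ (r + 1)), Finset.sum_range_sub']
    rfl
  have hΦm : 0 ≤ Φ m := div_nonneg (sq_nonneg _) (cumWeight_nonneg hq _)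
  have hΦ0 : Φ 0 ≤ q 0 * h 0 ^ 2 := by
    have hf : ∀ u : Fin (m + 1) → ℝ, cumWeight u 0 = u 0 := by
      intro u
      rw [cumWeight, Finset.sum_eq_single_of_mem 0 (by simp)]
      intro k hk hk0
      simp only [Finset.mem_filter, Finset.mem_univ, true_and, nonpos_iff_eq_zero] at hk
      exact absurd (Fin.ext hk) hk0
    simp only [hΦ, hf]
    rcases (hq 0).eq_or_lt with h0 | h0
    · simp [← h0]
    · apply le_of_eq; field_simp
  calc ∑ r, contrast q h r ^ 2
      ≤ ∑ r : Fin (m + 1 - 1), (q (nextClass r) * h (nextClass r) ^ 2 + (Φ r - Φ (r + 1))) :=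
        Finset.sum_le_sum fun r _ => hstep r
    _ = ∑ r : Fin (m + 1 - 1), q (nextClass r) * h (nextClass r) ^ 2 + (Φ 0 - Φ m) := by
        rw [Finset.sum_add_distrib, htel]
    _ ≤ q 0 * h 0 ^ 2 + ∑ r : Fin (m + 1 - 1), q (nextClass r) * h (nextClass r) ^ 2 := by
        linarith
    _ = ∑ k, q k * h k ^ 2 := (Fin.sum_univ_succ fun k => q k * h k ^ 2).symm

lemma contrast_const (q : Fin K → ℝ) (a : ℝ) (r : Fin (K - 1)) :
    contrast q (fun _ => a) r = 0 := by simp [contrast]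

lemma contrast_add (q h h' : Fin K → ℝ) (r : Fin (K - 1)) :
    contrast q (fun k => h k + h' k) r = contrast q h r + contrast q h' r := by
  rw [contrast, contrast, contrast, ← add_div, ← mul_add, ← Finset.sum_add_distrib]
  congr 2
  exact Finset.sum_congr rfl fun k _ => by ring

lemma contrast_const_mul (q h : Fin K → ℝ) (a : ℝ) (r : Fin (K - 1)) :
    contrast q (fun k => a * h k) r = a * contrast q h r := by
  simp only [contrast, ← mul_sub, mul_left_comm _ a, ← Finset.mul_sum]
  ring

lemma contrast_sum {ι : Type*} (s : Finset ι) (q : Fin K → ℝ) (h : ι → Fin K → ℝ)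
    (r : Fin (K - 1)) :
    contrast q (fun k => ∑ i ∈ s, h i k) r = ∑ i ∈ s, contrast q (h i) r := by
  classical
  induction s using Finset.induction_on with
  | empty => simpa using contrast_const q 0 r
  | insert i s hi ih => simp only [Finset.sum_insert hi, contrast_add, ih]

lemma abs_sqrt_sub_sqrt_le {x y d : ℝ} (hx : 0 ≤ x) (hy : 0 < y) (hd : |x - y| ≤ y * d) :
    |√x - √y| ≤ √y * d := by
  have hy' := Real.sqrt_pos.2 hy
  have h1 : |√x - √y| * (√x + √y) = |x - y| := by
    rw [← abs_of_nonneg (by positivity : 0 ≤ √x + √y), ← abs_mul]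
    congr 1
    nlinarith [Real.mul_self_sqrt hx, Real.mul_self_sqrt hy.le]
  have h2 : |√x - √y| * √y ≤ √y * d * √y := by
    calc |√x - √y| * √y ≤ |√x - √y| * (√x + √y) := by
          gcongr; linarith [Real.sqrt_nonneg x]
      _ ≤ y * d := h1.le.trans hd
      _ = √y * d * √y := by
          rw [mul_right_comm, Real.mul_self_sqrt hy.le]
  exact le_of_mul_le_mul_right h2 hy'

/-- Perturbation of one contrast, in scalar form: `s` and `Q` are the weights of the first classes
and of the next class, `T / s` is the mean over the first classes. -/
lemma abs_contrast_sub_le_aux {Q s T Q' s' T' f τ G A : ℝ} (hQ : 0 < Q) (hs : 0 < s)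
    (hQ' : 0 ≤ Q') (hs' : 0 ≤ s') (hτ : 0 ≤ τ) (hG : 0 ≤ G) (hA : 0 ≤ A)
    (hf : |f| ≤ τ) (hT' : |T'| ≤ τ * s') (hdQ : |Q' - Q| ≤ Q * G)
    (hds : |s' - s| ≤ s * A) (hdT : |T' - T| ≤ τ * (s * A)) :
    |√Q' * (√s' / √(s' + Q')) * (T' / s' - f) - √Q * (√s / √(s + Q)) * (T / s - f)|
      ≤ 2 * τ * (√Q * (2 * G + 3 * (√s / √(s + Q) * A))) := by
  set ρ := √s / √(s + Q) with hρ
  set ρ' := √s' / √(s' + Q') with hρ'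
  have hsQ : 0 < √(s + Q) := Real.sqrt_pos.2 (by positivity)
  have hρ0 : 0 ≤ ρ := by positivity
  have hρ'0 : 0 ≤ ρ' := by positivity
  have hρ1 : ρ ≤ 1 := div_le_one_of_le₀ (Real.sqrt_le_sqrt (by linarith)) (by positivity)
  have hρ'1 : ρ' ≤ 1 := div_le_one_of_le₀ (Real.sqrt_le_sqrt (by linarith)) (by positivity)
  have hm' : |T' / s'| ≤ τ := by
    rw [abs_div, abs_of_nonneg hs']
    exact div_le_of_le_mul₀ hs' hτ hT'
  have he' : |T' / s' - f| ≤ 2 * τ := (abs_sub _ _).trans (by linarith)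
  have h1 : |√Q' - √Q| ≤ √Q * G := abs_sqrt_sub_sqrt_le hQ' hQ hdQ
  have h2 : |√s' - √s| ≤ √s * A := abs_sqrt_sub_sqrt_le hs' hs hds
  have hρsq : ρ ^ 2 = s / (s + Q) := by
    rw [hρ, div_pow, Real.sq_sqrt hs.le, Real.sq_sqrt (by positivity)]
  have h3 : |√(s' + Q') - √(s + Q)| ≤ √(s + Q) * (ρ * A + G) := by
    refine abs_sqrt_sub_sqrt_le (by positivity) (by positivity) ?_
    have e : s' + Q' - (s + Q) = (s' - s) + (Q' - Q) := by ring
    rw [e]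
    refine (abs_add_le _ _).trans ((add_le_add hds hdQ).trans ?_)
    have e2 : s ≤ (s + Q) * ρ := by
      have : (s + Q) * ρ ^ 2 = s := by rw [hρsq]; field_simp
      calc s = (s + Q) * (ρ * ρ) := by rw [← sq, this]
        _ ≤ (s + Q) * (ρ * 1) := by gcongr
        _ = _ := by ring
    nlinarith [mul_le_mul_of_nonneg_right e2 hA, mul_nonneg hs.le hG]
  have h4 : |ρ' - ρ| ≤ 2 * (ρ * A) + G := by
    have hk : ρ' * √(s' + Q') = √s' := by
      rcases eq_or_ne √(s' + Q') 0 with h0 | h0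
      · have h5 : s' + Q' = 0 := by
          rwa [Real.sqrt_eq_zero (by positivity)] at h0
        have h6 : s' = 0 := by linarith
        rw [h0, h6]; simp
      · rw [hρ']; field_simp
    have hk2 : ρ * √(s + Q) = √s := by rw [hρ]; field_simp
    have e : (ρ' - ρ) * √(s + Q) = (√s' - √s) - ρ' * (√(s' + Q') - √(s + Q)) := by
      linear_combination hk - hk2
    have h5 : |ρ' - ρ| * √(s + Q) ≤ (2 * (ρ * A) + G) * √(s + Q) := by
      rw [← abs_of_pos hsQ, ← abs_mul, abs_of_pos hsQ, e]
      refine (abs_sub _ _).trans ?_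
      rw [abs_mul, abs_of_nonneg hρ'0]
      calc |√s' - √s| + ρ' * |√(s' + Q') - √(s + Q)|
          ≤ √s * A + 1 * (√(s + Q) * (ρ * A + G)) := by gcongr
        _ = _ := by rw [← hk2]; ring
    exact le_of_mul_le_mul_right h5 hsQ
  have h6 : |T' / s' - T / s| ≤ 2 * τ * A := by
    have hk : T' / s' * s' = T' := by
      rcases eq_or_ne s' 0 with h0 | h0
      · rw [h0, mul_zero] at hT'
        have : T' = 0 := abs_nonpos_iff.1 hT'
        simp [this]
      · field_simp
    have e : (T' / s' - T / s) * s = (T' - T) - T' / s' * (s' - s) := by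
      have : T / s * s = T := by field_simp
      linear_combination hk - this
    have h7 : |T' / s' - T / s| * s ≤ 2 * τ * A * s := by
      rw [← abs_of_pos hs, ← abs_mul, abs_of_pos hs, e]
      refine (abs_sub _ _).trans ?_
      rw [abs_mul]
      calc |T' - T| + |T' / s'| * |s' - s| ≤ τ * (s * A) + τ * (s * A) := by gcongr
        _ = _ := by ring
    exact le_of_mul_le_mul_right h7 hs
  have hsplit : √Q' * ρ' * (T' / s' - f) - √Q * ρ * (T / s - f)
      = (√Q' - √Q) * ρ' * (T' / s' - f) + √Q * (ρ' - ρ) * (T' / s' - f)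
        + √Q * ρ * (T' / s' - T / s) := by ring
  rw [hsplit]
  have hQ0 := Real.sqrt_nonneg Q
  calc _ ≤ |√Q' - √Q| * ρ' * |T' / s' - f| + √Q * |ρ' - ρ| * |T' / s' - f|
        + √Q * ρ * |T' / s' - T / s| := by
        refine (abs_add_three _ _ _).trans (le_of_eq ?_)
        simp only [abs_mul, abs_of_nonneg hρ0, abs_of_nonneg hρ'0, abs_of_nonneg hQ0]
    _ ≤ (√Q * G) * 1 * (2 * τ) + √Q * (2 * (ρ * A) + G) * (2 * τ) + √Q * ρ * (2 * τ * A) := by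
        gcongr
    _ = _ := by ring

/-- Stability of the contrasts of a bounded function under a relative perturbation `g` of the
weights. The averages of `|g|` over the first classes that occur are controlled by a Hardy
inequality, which is Bessel's inequality for the function `|g|`. -/
lemma sum_contrast_sub_sq_le {q q' f g : Fin K → ℝ} (hq : ∀ k, 0 < q k) (hq' : ∀ k, 0 ≤ q' k)
    {τ : ℝ} (hf : ∀ k, |f k| ≤ τ) (hg : ∀ k, q' k - q k = q k * g k) :
    ∑ r, (contrast q' f r - contrast q f r) ^ 2 ≤ 272 * τ ^ 2 * ∑ k, q k * g k ^ 2 := by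
  have hstep : ∀ r : Fin (K - 1), |contrast q' f r - contrast q f r|
      ≤ 2 * τ * (5 * (√(q (nextClass r)) * |g (nextClass r)|)
        + 3 * |contrast q (fun k => |g k|) r|) := by
    intro r
    have hτ : 0 ≤ τ := (abs_nonneg _).trans (hf (nextClass r))
    have hs := cumWeight_pos hq r
    set A := cumWeight (fun k => q k * |g k|) r / cumWeight q r with hA
    have hA0 : 0 ≤ A :=
      div_nonneg (cumWeight_nonneg (fun k => mul_nonneg (hq k).le (abs_nonneg _)) _) hs.le
    have hsA : cumWeight q r * A = cumWeight (fun k => q k * |g k|) r := by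
      rw [hA]; field_simp
    have hsub : ∀ u v : Fin K → ℝ, cumWeight u r - cumWeight v r
        = cumWeight (fun k => u k - v k) r := by
      intro u v; simp only [cumWeight, Finset.sum_sub_distrib]
    have hmul : ∀ u : Fin K → ℝ, τ * cumWeight u r = cumWeight (fun k => τ * u k) r := by
      intro u; simp only [cumWeight, Finset.mul_sum]
    have key := abs_contrast_sub_le_aux (Q := q (nextClass r)) (s := cumWeight q r)
      (T := cumWeight (fun k => q k * f k) r) (Q' := q' (nextClass r)) (s' := cumWeight q' r)
      (T' := cumWeight (fun k => q' k * f k) r) (f := f (nextClass r)) (τ := τ)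
      (G := |g (nextClass r)|) (A := A) (hq _) hs (hq' _) (cumWeight_nonneg hq' _) hτ
      (abs_nonneg _) hA0 (hf _)
      (by
        rw [hmul]
        refine abs_cumWeight_le (fun k => ?_) _
        rw [abs_mul, abs_of_nonneg (hq' k), mul_comm]
        exact mul_le_mul_of_nonneg_right (hf k) (hq' k))
      (by rw [hg, abs_mul, abs_of_pos (hq _)])
      (by
        rw [hsA, hsub]
        refine abs_cumWeight_le (fun k => ?_) _
        rw [hg, abs_mul, abs_of_pos (hq k)])
      (by
        rw [hsA, hsub, hmul]
        refine abs_cumWeight_le (fun k => ?_) _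
        rw [← sub_mul, hg, abs_mul, abs_mul, abs_of_pos (hq k), mul_comm]
        exact mul_le_mul_of_nonneg_right (hf k) (mul_nonneg (hq k).le (abs_nonneg _)))
    rw [contrast_eq_mean_sub hq', contrast_eq_mean_sub (fun k => (hq k).le), cumWeight_succ,
      cumWeight_succ]
    refine key.trans ?_
    rw [contrast_eq_mean_sub (fun k => (hq k).le), cumWeight_succ, ← hA]
    have hQ0 := Real.sqrt_nonneg (q (nextClass r))
    have hρ0 : 0 ≤ √(cumWeight q r) / √(cumWeight q r + q (nextClass r)) := by positivity
    have hρ1 : √(cumWeight q r) / √(cumWeight q r + q (nextClass r)) ≤ 1 :=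
      div_le_one_of_le₀ (Real.sqrt_le_sqrt (by linarith [hq (nextClass r)])) (by positivity)
    generalize √(cumWeight q r) / √(cumWeight q r + q (nextClass r)) = ρ at *
    generalize √(q (nextClass r)) = Q at *
    have hG := abs_nonneg (g (nextClass r))
    generalize |g (nextClass r)| = G at *
    gcongr
    -- `A` is the mean of `|g|` over the first classes, and `Q ρ (A - G)` is a contrast of `|g|`.
    have h1 : Q * ρ * (A - G) ≤ |Q * ρ * (A - G)| := le_abs_self _
    have h2 : Q * ρ * G ≤ Q * 1 * G := by gcongr
    nlinarith
  have hB := sum_contrast_sq_le (fun k => (hq k).le) (fun k => |g k|)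
  simp only [sq_abs] at hB
  have hnext : ∑ r : Fin (K - 1), q (nextClass r) * g (nextClass r) ^ 2 ≤ ∑ k, q k * g k ^ 2 := by
    rcases K with _ | m
    · simp
    · rw [Fin.sum_univ_succ]
      have := mul_nonneg (hq 0).le (sq_nonneg (g 0))
      refine le_trans (le_of_eq ?_) (le_add_of_nonneg_left this)
      rfl
  calc ∑ r, (contrast q' f r - contrast q f r) ^ 2
      ≤ ∑ r : Fin (K - 1), 8 * τ ^ 2 * (25 * (q (nextClass r) * g (nextClass r) ^ 2)
        + 9 * contrast q (fun k => |g k|) r ^ 2) := by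
        refine Finset.sum_le_sum fun r _ => ?_
        have h1 := pow_le_pow_left₀ (abs_nonneg _) (hstep r) 2
        rw [sq_abs] at h1
        refine h1.trans ?_
        have e1 : (√(q (nextClass r)) * |g (nextClass r)|) ^ 2
            = q (nextClass r) * g (nextClass r) ^ 2 := by
          rw [mul_pow, sq_abs, Real.sq_sqrt (hq _).le]
        have e2 := sq_abs (contrast q (fun k => |g k|) r)
        rw [← e1, ← e2, mul_pow]
        generalize √(q (nextClass r)) * |g (nextClass r)| = u
        generalize |contrast q (fun k => |g k|) r| = v
        nlinarith [mul_nonneg (sq_nonneg τ) (sq_nonneg (5 * u - 3 * v))]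
    _ = 8 * τ ^ 2 * (25 * ∑ r : Fin (K - 1), q (nextClass r) * g (nextClass r) ^ 2
        + 9 * ∑ r, contrast q (fun k => |g k|) r ^ 2) := by
        simp only [← Finset.mul_sum, Finset.sum_add_distrib]
    _ ≤ 8 * τ ^ 2 * (25 * ∑ k, q k * g k ^ 2 + 9 * ∑ k, q k * g k ^ 2) := by gcongr
    _ = _ := by ring

end Contrasts

/-! ### The basic inequality of the group lasso -/

section Optimization

lemma abs_sum_mul_le_sqrt_mul_sqrt {ι : Type*} (s : Finset ι) (u v : ι → ℝ) :
    |∑ l ∈ s, u l * v l| ≤ √(∑ l ∈ s, u l ^ 2) * √(∑ l ∈ s, v l ^ 2) := by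
  rw [← Real.sqrt_mul (Finset.sum_nonneg fun l _ => sq_nonneg _)]
  exact Real.abs_le_sqrt (Finset.sum_mul_sq_le_sq_mul_sq s u v)

lemma sqrt_sum_sq_sub_le {ι : Type*} [Fintype ι] (u v : ι → ℝ) :
    √(∑ l, (u l - v l) ^ 2) ≤ √(∑ l, u l ^ 2) + √(∑ l, v l ^ 2) := by
  have h := norm_sub_le (WithLp.toLp 2 u : EuclideanSpace ℝ ι) (WithLp.toLp 2 v)
  simpa [EuclideanSpace.norm_eq] using h

variable {n p m : ℕ}

lemma norm12_sub_le (A B : Matrix (Fin p) (Fin m) ℝ) :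
    norm12 (A - B) ≤ norm12 A + norm12 B := by
  rw [norm12, norm12, norm12, ← Finset.sum_add_distrib]
  exact Finset.sum_le_sum fun j _ => sqrt_sum_sq_sub_le (fun l => A j l) (fun l => B j l)

lemma norm12_nonneg (A : Matrix (Fin p) (Fin m) ℝ) : 0 ≤ norm12 A :=
  Finset.sum_nonneg fun _ _ => Real.sqrt_nonneg _

lemma predError_eq_sum (S : Matrix (Fin p) (Fin p) ℝ) (A B : Matrix (Fin p) (Fin m) ℝ) :
    predError S A B = ∑ l, (fun j => (A - B) j l) ⬝ᵥ S *ᵥ (fun j => (A - B) j l) := by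
  rw [predError, Matrix.trace]
  refine Finset.sum_congr rfl fun l _ => ?_
  rw [Matrix.diag_apply, Matrix.mul_assoc, Matrix.mul_apply']
  rfl

lemma predError_eq_sum_rows (S : Matrix (Fin p) (Fin p) ℝ) (A B : Matrix (Fin p) (Fin m) ℝ) :
    predError S A B
      = ∑ j, ∑ k, S j k * ∑ l, (A - B) j l * (A - B) k l := by
  rw [predError_eq_sum]
  simp only [dotProduct, Matrix.mulVec, Finset.mul_sum]
  rw [Finset.sum_comm]
  refine Finset.sum_congr rfl fun j _ => ?_
  rw [Finset.sum_comm]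
  exact Finset.sum_congr rfl fun k _ => Finset.sum_congr rfl fun l _ => by ring

/-- Slow-rate bound for the penalized least squares estimator: the only inputs are that the tuning
parameter dominates the gradient at `Bs` and that the Gram matrix is entrywise close to `S`. -/
lemma predError_le_of_isMinOn (hn : 0 < n) {X : Matrix (Fin n) (Fin p) ℝ}
    {Y : Matrix (Fin n) (Fin m) ℝ} {lam ε : ℝ} (hlam : 0 < lam) {Bh Bs : Matrix (Fin p) (Fin m) ℝ}
    (hmin : IsMinOn (penalizedLoss X Y lam) Set.univ Bh) {S : Matrix (Fin p) (Fin p) ℝ}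
    (hgrad : ∀ j, ∑ l, ((n : ℝ)⁻¹ * ∑ i, X i j * (Y i l - ∑ k, X i k * Bs k l)) ^ 2
      ≤ (lam / 2) ^ 2)
    (hgram : ∀ j k, |S j k - (n : ℝ)⁻¹ * ∑ i, X i j * X i k| ≤ ε) :
    predError S Bh Bs ≤ 3 * lam * norm12 Bs + 16 * ε * norm12 Bs ^ 2 := by
  have hn0 : (0 : ℝ) < n := by exact_mod_cast hn
  set D := Bh - Bs with hD
  set E : Fin p → Fin m → ℝ := fun j l =>
    (n : ℝ)⁻¹ * ∑ i, X i j * (Y i l - ∑ k, X i k * Bs k l) with hE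
  have h1 : penalizedLoss X Y lam Bh ≤ penalizedLoss X Y lam Bs := hmin (Set.mem_univ Bs)
  have hexp : frobSq (Y - X * Bh) = frobSq (Y - X * Bs)
      - 2 * (n * ∑ j, ∑ l, D j l * E j l) + frobSq (X * D) := by
    have hXB : X * Bh = X * Bs + X * D := by rw [hD, Matrix.mul_sub]; abel
    have hcross : n * ∑ j, ∑ l, D j l * E j l
        = ∑ i, ∑ l, (Y - X * Bs) i l * (X * D) i l := by
      simp only [hE, Matrix.sub_apply, Matrix.mul_apply, Finset.mul_sum]
      rw [Finset.sum_comm]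
      rw [Finset.sum_comm (s := (Finset.univ : Finset (Fin n)))]
      refine Finset.sum_congr rfl fun l _ => ?_
      rw [Finset.sum_comm]
      refine Finset.sum_congr rfl fun i _ => Finset.sum_congr rfl fun j _ => ?_
      field_simp
    rw [hcross, hXB]
    simp only [frobSq, Finset.mul_sum, ← Finset.sum_sub_distrib, ← Finset.sum_add_distrib]
    refine Finset.sum_congr rfl fun i _ => Finset.sum_congr rfl fun l _ => ?_
    simp only [Matrix.sub_apply, Matrix.add_apply]
    ring
  have hgram' : ∑ j, ∑ k, ((n : ℝ)⁻¹ * ∑ i, X i j * X i k) * ∑ l, D j l * D k l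
      = (n : ℝ)⁻¹ * frobSq (X * D) := by
    have : ∀ i l, (X * D) i l ^ 2 = ∑ j, ∑ k, X i j * X i k * (D j l * D k l) := by
      intro i l
      rw [sq, Matrix.mul_apply, Finset.sum_mul_sum]
      exact Finset.sum_congr rfl fun j _ => Finset.sum_congr rfl fun k _ => by ring
    simp only [frobSq, this]
    have e1 : ∀ j k, ((n : ℝ)⁻¹ * ∑ i, X i j * X i k) * ∑ l, D j l * D k l
        = (n : ℝ)⁻¹ * ∑ i, ∑ l, X i j * X i k * (D j l * D k l) := by
      intro j k
      rw [mul_assoc, Finset.sum_mul_sum]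
    simp only [e1]
    have e2 : ∑ j, ∑ k, (n : ℝ)⁻¹ * ∑ i, ∑ l, X i j * X i k * (D j l * D k l)
        = (n : ℝ)⁻¹ * ∑ j, ∑ k, ∑ i, ∑ l, X i j * X i k * (D j l * D k l) := by
      rw [Finset.mul_sum]
      exact Finset.sum_congr rfl fun j _ => (Finset.mul_sum _ _ _).symm
    rw [e2]
    congr 1
    calc ∑ j, ∑ k, ∑ i, ∑ l, X i j * X i k * (D j l * D k l)
        = ∑ j, ∑ i, ∑ k, ∑ l, X i j * X i k * (D j l * D k l) :=
          Finset.sum_congr rfl fun j _ => Finset.sum_comm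
      _ = ∑ i, ∑ j, ∑ k, ∑ l, X i j * X i k * (D j l * D k l) := Finset.sum_comm
      _ = ∑ i, ∑ j, ∑ l, ∑ k, X i j * X i k * (D j l * D k l) :=
          Finset.sum_congr rfl fun i _ => Finset.sum_congr rfl fun j _ => Finset.sum_comm
      _ = ∑ i, ∑ l, ∑ j, ∑ k, X i j * X i k * (D j l * D k l) :=
          Finset.sum_congr rfl fun i _ => Finset.sum_comm
  have hDE : ∑ j, ∑ l, D j l * E j l ≤ lam / 2 * norm12 D := by
    rw [norm12, Finset.mul_sum]
    refine Finset.sum_le_sum fun j _ => ?_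
    refine (le_abs_self _).trans ((abs_sum_mul_le_sqrt_mul_sqrt _ _ _).trans ?_)
    rw [mul_comm]
    gcongr
    exact Real.sqrt_le_iff.2 ⟨by positivity, hgrad j⟩
  have hDle : norm12 D ≤ norm12 Bh + norm12 Bs := norm12_sub_le _ _
  have hD0 := norm12_nonneg D
  have hBs0 := norm12_nonneg Bs
  have hfrob : 0 ≤ frobSq (X * D) :=
    Finset.sum_nonneg fun i _ => Finset.sum_nonneg fun l _ => sq_nonneg _
  have hbasic : (n : ℝ)⁻¹ * frobSq (X * D) + lam * norm12 Bh ≤ 3 * lam * norm12 Bs := by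
    simp only [penalizedLoss] at h1
    rw [hexp] at h1
    have e : (2 * (n : ℝ))⁻¹ * (frobSq (Y - X * Bs) - 2 * (n * ∑ j, ∑ l, D j l * E j l)
        + frobSq (X * D)) = (2 * (n : ℝ))⁻¹ * frobSq (Y - X * Bs) - ∑ j, ∑ l, D j l * E j l
          + 1 / 2 * ((n : ℝ)⁻¹ * frobSq (X * D)) := by
      field_simp
    rw [e] at h1
    nlinarith [mul_le_mul_of_nonneg_left hDle hlam.le]
  have hBh : norm12 Bh ≤ 3 * norm12 Bs := by
    have : lam * norm12 Bh ≤ lam * (3 * norm12 Bs) := by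
      have : 0 ≤ (n : ℝ)⁻¹ * frobSq (X * D) := by positivity
      linarith
    exact le_of_mul_le_mul_left this hlam
  have hdiff : predError S Bh Bs - (n : ℝ)⁻¹ * frobSq (X * D) ≤ ε * norm12 D ^ 2 := by
    rw [predError_eq_sum_rows, ← hgram', ← Finset.sum_sub_distrib, sq, norm12,
      Finset.sum_mul_sum, Finset.mul_sum]
    refine Finset.sum_le_sum fun j _ => ?_
    rw [← Finset.sum_sub_distrib, Finset.mul_sum]
    refine Finset.sum_le_sum fun k _ => ?_
    rw [← sub_mul]
    refine (le_abs_self _).trans ?_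
    rw [abs_mul]
    exact mul_le_mul (hgram j k) (abs_sum_mul_le_sqrt_mul_sqrt _ _ _) (abs_nonneg _)
      ((abs_nonneg _).trans (hgram j k))
  have hlamB : 0 ≤ lam * norm12 Bh := mul_nonneg hlam.le (norm12_nonneg _)
  rcases Nat.eq_zero_or_pos p with hp | hp
  · subst hp
    simp [predError_eq_sum_rows, norm12]
  · have hε : 0 ≤ ε := (abs_nonneg _).trans (hgram ⟨0, hp⟩ ⟨0, hp⟩)
    have h4 : norm12 D ^ 2 ≤ 16 * norm12 Bs ^ 2 := by
      have : norm12 D ≤ 4 * norm12 Bs := by linarith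
      calc norm12 D ^ 2 ≤ (4 * norm12 Bs) ^ 2 := by gcongr
        _ = _ := by ring
    nlinarith [mul_le_mul_of_nonneg_left h4 hε]

end Optimization

/-! ### Least eigenvalue -/

section LeastEigenvalue

variable {p m : ℕ}

/-- The least eigenvalue bounds the quadratic form from below. -/
lemma lambdaMin_mul_le {S : Matrix (Fin p) (Fin p) ℝ} (hS : S.PosSemidef) (v : Fin p → ℝ) :
    lambdaMin S * ∑ j, v j ^ 2 ≤ v ⬝ᵥ S *ᵥ v := by
  have hpsd : (S - lambdaMin S • (1 : Matrix (Fin p) (Fin p) ℝ)).PosSemidef := by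
    have hherm : (S - lambdaMin S • (1 : Matrix (Fin p) (Fin p) ℝ)).IsHermitian := by
      refine hS.isHermitian.sub ?_
      simp [Matrix.IsHermitian]
    rw [hherm.posSemidef_iff_eigenvalues_nonneg]
    intro i
    have hshift : ∀ y ∈ spectrum ℝ (S - lambdaMin S • (1 : Matrix (Fin p) (Fin p) ℝ)),
        y + lambdaMin S ∈ spectrum ℝ S := by
      intro y hy
      rw [← Algebra.algebraMap_eq_smul_one, ← spectrum.sub_singleton_eq] at hy
      obtain ⟨y', hy', c, hc, rfl⟩ := Set.mem_sub.1 hy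
      rw [Set.mem_singleton_iff] at hc
      rwa [hc, sub_add_cancel]
    have hmem2 := hshift _ (hherm.eigenvalues_mem_spectrum_real i)
    have hbdd : BddBelow (spectrum ℝ S) := (Matrix.finite_real_spectrum (A := S)).bddBelow
    have hle : lambdaMin S ≤ hherm.eigenvalues i + lambdaMin S := csInf_le hbdd hmem2
    simpa using hle
  have h := hpsd.dotProduct_mulVec_nonneg v
  rw [Matrix.sub_mulVec, dotProduct_sub, Matrix.smul_mulVec, Matrix.one_mulVec,
    dotProduct_smul, smul_eq_mul] at h
  have e : star v ⬝ᵥ v = ∑ j, v j ^ 2 := by simp [dotProduct, sq]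
  rw [e] at h
  simpa using h

lemma lambdaMin_mul_frobSq_le {S : Matrix (Fin p) (Fin p) ℝ} (hS : S.PosSemidef)
    (A B : Matrix (Fin p) (Fin m) ℝ) :
    lambdaMin S * frobSq (A - B) ≤ predError S A B := by
  rw [predError_eq_sum, frobSq, Finset.sum_comm, Finset.mul_sum]
  exact Finset.sum_le_sum fun l _ => lambdaMin_mul_le hS fun j => (A - B) j l

lemma predError_nonneg {S : Matrix (Fin p) (Fin p) ℝ} (hS : S.PosSemidef)
    (A B : Matrix (Fin p) (Fin m) ℝ) : 0 ≤ predError S A B := by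
  rw [predError_eq_sum]
  exact Finset.sum_nonneg fun l _ => by
    simpa using hS.dotProduct_mulVec_nonneg fun j => (A - B) j l

end LeastEigenvalue

/-! ### Optimal scores -/

section Scores

variable {n K : ℕ}

lemma response_apply (κ : Fin n → Fin K) (i : Fin n) (l : Fin (K - 1)) :
    response κ i l = scores κ (κ i) l := by
  simp [response, indicatorMatrix, Matrix.mul_apply]

/-- A sum over the classes of a function that is supported by the classes `0, …, l + 1`. -/
lemma sum_ite_class (a b : Fin K → ℝ) (l : Fin (K - 1)) :
    ∑ k : Fin K, (if (k : ℕ) ≤ l then a k else if (k : ℕ) = l + 1 then b k else 0)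
      = cumWeight a l + b (nextClass l) := by
  have h : b (nextClass l) = ∑ k, if k = nextClass l then b k else 0 := by simp
  rw [cumWeight, Finset.sum_filter, h, ← Finset.sum_add_distrib]
  refine Finset.sum_congr rfl fun k _ => ?_
  by_cases h1 : (k : ℕ) ≤ l
  · have : k ≠ nextClass l := fun h => by rw [h] at h1; simp [nextClass] at h1
    simp [h1, this]
  · by_cases h2 : (k : ℕ) = l + 1
    · have : k = nextClass l := Fin.ext h2
      rw [if_neg h1, if_pos h2, if_neg h1, if_pos this, zero_add]
    · have : k ≠ nextClass l := fun h => h2 (by rw [h]; rfl)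
      simp [h1, h2, this]

lemma cumWeight_classFreq (κ : Fin n → Fin K) (m : ℕ) :
    cumWeight (classFreq κ) m = cumWeight (classCount κ) m / n := by
  simp only [cumWeight, classFreq, Finset.sum_div]

lemma classCount_nonneg (κ : Fin n → Fin K) (k : Fin K) : 0 ≤ classCount κ k := by
  unfold classCount; positivity

/-- The scores turn averages over the sample into contrasts with respect to the empirical class
frequencies. -/
lemma sum_mul_response (hn : 0 < n) (κ : Fin n → Fin K) (f : Fin K → ℝ) (l : Fin (K - 1)) :
    (n : ℝ)⁻¹ * ∑ i, f (κ i) * response κ i l = contrast (classFreq κ) f l := by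
  have hn0 : (0 : ℝ) < n := by exact_mod_cast hn
  simp only [response_apply]
  rw [sum_comp_label κ (fun k => f k * scores κ k l), contrast, sum_contrast_eq]
  have hs : 0 ≤ cumWeight (classCount κ) l := cumWeight_nonneg (classCount_nonneg κ) l
  have hQ := classCount_nonneg κ (nextClass l)
  have hT : cumWeight (fun k => classFreq κ k * f k) l
      = cumWeight (fun k => classCount κ k * f k) l / n := by
    simp only [cumWeight, classFreq, Finset.sum_div]
    exact Finset.sum_congr rfl fun k _ => by ring
  have e : ∀ k, classFreq κ k * (f k * scores κ k l)
      = if (k : ℕ) ≤ l then (classCount κ k * f k) * ((n : ℝ)⁻¹ *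
          √(n * classCount κ (nextClass l) /
          (cumWeight (classCount κ) l * cumWeight (classCount κ) (l + 1))))
        else if (k : ℕ) = l + 1 then -(classCount κ k * f k * ((n : ℝ)⁻¹ *
          √(n * cumWeight (classCount κ) l /
          (classCount κ (nextClass l) * cumWeight (classCount κ) (l + 1))))) else 0 := by
    intro k
    simp only [scores, Matrix.of_apply, classFreq]
    split_ifs <;> ring
  simp only [e]
  rw [sum_ite_class (fun k => (classCount κ k * f k) * ((n : ℝ)⁻¹ *
          √(n * classCount κ (nextClass l) /
          (cumWeight (classCount κ) l * cumWeight (classCount κ) (l + 1)))))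
      (fun k => -(classCount κ k * f k * ((n : ℝ)⁻¹ *
          √(n * cumWeight (classCount κ) l /
          (classCount κ (nextClass l) * cumWeight (classCount κ) (l + 1)))))), hT,
    cumWeight_classFreq, cumWeight_classFreq, classFreq, cumWeight_succ]
  have hT0 : cumWeight (classCount κ) l = 0 →
      cumWeight (fun k => classCount κ k * f k) l = 0 := by
    intro h0
    have h2 := (Finset.sum_eq_zero_iff_of_nonneg fun k _ => classCount_nonneg κ k).1 h0
    exact Finset.sum_eq_zero fun k hk => by simp [h2 k hk]
  have hTmul : ∀ t : ℝ, cumWeight (fun k => classCount κ k * f k * t) l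
      = cumWeight (fun k => classCount κ k * f k) l * t := by
    intro t; simp only [cumWeight, Finset.sum_mul]
  rw [hTmul]
  generalize cumWeight (fun k => classCount κ k * f k) l = T at *
  generalize cumWeight (classCount κ) l = s at *
  generalize classCount κ (nextClass l) = Q at *
  generalize f (nextClass l) = y
  -- If the next class or all first classes are empty, both sides vanish.
  rcases hQ.eq_or_lt with rfl | hQ'
  · simp
  rcases hs.eq_or_lt with rfl | hs'
  · simp [hT0 rfl]
  have hN := Real.mul_self_sqrt hn0.le
  have hN0 := (Real.sqrt_pos.2 hn0).ne'
  have hq := Real.mul_self_sqrt hQ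
  have hq0 := (Real.sqrt_pos.2 hQ').ne'
  have hss := Real.mul_self_sqrt hs
  have hss0 := (Real.sqrt_pos.2 hs').ne'
  have hsQ0 := (Real.sqrt_pos.2 (add_pos hs' hQ')).ne'
  rw [Real.sqrt_div (by positivity), Real.sqrt_div (by positivity), Real.sqrt_div (by positivity),
    Real.sqrt_mul hn0.le, Real.sqrt_mul hs, Real.sqrt_mul hn0.le, Real.sqrt_mul hQ,
    Real.sqrt_mul (by positivity), Real.sqrt_div hs, Real.sqrt_div (by positivity)]
  generalize √(n : ℝ) = N at *
  generalize √(s + Q) = S at *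
  rw [← hN]
  generalize √s = s1 at *
  generalize √Q = q1 at *
  rw [← hss, ← hq]
  field_simp
  ring

lemma sum_response_eq_zero (hn : 0 < n) (κ : Fin n → Fin K) (l : Fin (K - 1)) :
    ∑ i, response κ i l = 0 := by
  have h := sum_mul_response hn κ (fun _ => 1) l
  rw [contrast_const] at h
  have hn0 : (n : ℝ)⁻¹ ≠ 0 := by positivity
  simpa using (mul_eq_zero.1 h).resolve_left hn0

/-- The inequality is strict if empty classes make the scores vanish. -/
lemma sum_response_sq_le (κ : Fin n → Fin K) (l : Fin (K - 1)) :
    ∑ i, response κ i l ^ 2 ≤ n := by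
  rcases Nat.eq_zero_or_pos n with h0 | hn
  · subst h0; simp
  have hn0 : (0 : ℝ) < n := by exact_mod_cast hn
  have hs : 0 ≤ cumWeight (classCount κ) l := cumWeight_nonneg (classCount_nonneg κ) l
  have hQ := classCount_nonneg κ (nextClass l)
  have hsQ : 0 ≤ cumWeight (classCount κ) (l + 1) := cumWeight_nonneg (classCount_nonneg κ) _
  simp only [response_apply]
  have h1 := sum_comp_label κ (fun k => scores κ k l ^ 2)
  have e : ∀ k, classFreq κ k * scores κ k l ^ 2
      = if (k : ℕ) ≤ l then classCount κ k * (classCount κ (nextClass l) /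
          (cumWeight (classCount κ) l * cumWeight (classCount κ) (l + 1)))
        else if (k : ℕ) = l + 1 then classCount κ k * (cumWeight (classCount κ) l /
          (classCount κ (nextClass l) * cumWeight (classCount κ) (l + 1))) else 0 := by
    intro k
    simp only [scores, Matrix.of_apply, classFreq]
    split_ifs
    · rw [Real.sq_sqrt (by positivity)]; field_simp
    · rw [neg_sq, Real.sq_sqrt (by positivity)]; field_simp
    · simp
  simp only [e] at h1
  rw [sum_ite_class (fun k => classCount κ k * (classCount κ (nextClass l) /
          (cumWeight (classCount κ) l * cumWeight (classCount κ) (l + 1))))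
      (fun k => classCount κ k * (cumWeight (classCount κ) l /
          (classCount κ (nextClass l) * cumWeight (classCount κ) (l + 1))))] at h1
  have hmul : ∀ t : ℝ, cumWeight (fun k => classCount κ k * t) l
      = cumWeight (classCount κ) l * t := by
    intro t; simp only [cumWeight, Finset.sum_mul]
  rw [hmul, cumWeight_succ] at h1
  have h2 : (n : ℝ)⁻¹ * ∑ i, scores κ (κ i) l ^ 2 ≤ 1 := by
    rw [h1]
    generalize cumWeight (classCount κ) l = s at *
    generalize classCount κ (nextClass l) = Q at *
    rcases hQ.eq_or_lt with rfl | hQ'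
    · simp
    rcases hs.eq_or_lt with rfl | hs'
    · simp
    apply le_of_eq
    have : s + Q ≠ 0 := by positivity
    field_simp
    ring
  rwa [inv_mul_le_iff₀ hn0, mul_one] at h2

end Scores

/-! ### The population regression -/

section Population

variable {p K : ℕ} (M : ClassModel p K) {Bs : Matrix (Fin p) (Fin (K - 1)) ℝ}

lemma ClassModel.dotProduct_totalCov_mulVec (a v : Fin p → ℝ) :
    a ⬝ᵥ M.totalCov *ᵥ v = a ⬝ᵥ M.covW *ᵥ v
      + ∑ k, M.prob k * ((∑ j, M.mean k j * a j) * ∑ j, M.mean k j * v j) := by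
  have h : M.totalCov *ᵥ v = M.covW *ᵥ v
      + fun j => ∑ k, M.prob k * (M.mean k j * ∑ j', M.mean k j' * v j') := by
    ext j
    simp only [Matrix.mulVec, dotProduct, Pi.add_apply, M.totalCov_apply, add_mul,
      Finset.sum_add_distrib, Finset.sum_mul, Finset.mul_sum]
    congr 1
    rw [Finset.sum_comm]
    exact Finset.sum_congr rfl fun k _ => Finset.sum_congr rfl fun j' _ => by ring
  rw [h, dotProduct_add]
  congr 1
  simp only [dotProduct, Finset.mul_sum, Finset.sum_mul]
  rw [Finset.sum_comm]
  refine Finset.sum_congr rfl fun k _ => ?_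
  rw [Finset.sum_comm]
  exact Finset.sum_congr rfl fun j' _ => Finset.sum_congr rfl fun j _ => by ring

lemma ClassModel.totalCov_posSemidef : M.totalCov.PosSemidef := by
  refine Matrix.PosSemidef.of_dotProduct_mulVec_nonneg ?_ fun v => ?_
  · ext i j
    have hW : M.covW j i = M.covW i j := by
      simpa using congrFun (congrFun M.covW_posSemidef.isHermitian.eq i) j
    rw [Matrix.conjTranspose_apply, star_trivial, M.totalCov_apply, M.totalCov_apply, hW]
    congr 1
    exact Finset.sum_congr rfl fun k _ => by ring
  · rw [star_trivial, M.dotProduct_totalCov_mulVec]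
    refine add_nonneg (by simpa using M.covW_posSemidef.dotProduct_mulVec_nonneg v) ?_
    exact Finset.sum_nonneg fun k _ => mul_nonneg (M.prob_pos k).le (mul_self_nonneg _)

/-- The mean of the fitted scores `Bsᵀ x` in class `k`. -/
def ClassModel.fittedMean (M : ClassModel p K) (Bs : Matrix (Fin p) (Fin (K - 1)) ℝ)
    (k : Fin K) (l : Fin (K - 1)) : ℝ := ∑ j, M.mean k j * Bs j l

/-- The population least squares fit is a projection of the optimal scores, which have identity
covariance. Therefore the covariance matrix of the fitted scores is at most the identity. -/
lemma ClassModel.fitted_cov_le (hBs : M.totalCov * Bs = M.contrasts) (u : Fin (K - 1) → ℝ) :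
    (Bs *ᵥ u) ⬝ᵥ M.covW *ᵥ (Bs *ᵥ u) + ∑ k, M.prob k * (∑ l, M.fittedMean Bs k l * u l) ^ 2
      ≤ ∑ l, u l ^ 2 := by
  set v := Bs *ᵥ u with hv
  have hμ : ∀ k, ∑ j, M.mean k j * v j = ∑ l, M.fittedMean Bs k l * u l := by
    intro k
    simp only [hv, ClassModel.fittedMean, Matrix.mulVec, dotProduct, Finset.mul_sum,
      Finset.sum_mul]
    rw [Finset.sum_comm]
    exact Finset.sum_congr rfl fun l _ => Finset.sum_congr rfl fun j _ => by ring
  have h1 := M.dotProduct_totalCov_mulVec v v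
  simp only [hμ, ← sq] at h1
  set R := ∑ k, M.prob k * (∑ l, M.fittedMean Bs k l * u l) ^ 2 with hR
  have hW : 0 ≤ v ⬝ᵥ M.covW *ᵥ v := by simpa using M.covW_posSemidef.dotProduct_mulVec_nonneg v
  have hR0 : 0 ≤ R := Finset.sum_nonneg fun k _ => mul_nonneg (M.prob_pos k).le (sq_nonneg _)
  have h2 : v ⬝ᵥ M.totalCov *ᵥ v
      = ∑ l, u l * contrast M.prob (fun k => ∑ l', M.fittedMean Bs k l' * u l') l := by
    have e1 : M.totalCov *ᵥ v = M.contrasts *ᵥ u := by rw [hv, Matrix.mulVec_mulVec, hBs]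
    have e2 : ∀ l, contrast M.prob (fun k => ∑ l', M.fittedMean Bs k l' * u l') l
        = ∑ j, v j * M.contrasts j l := by
      intro l
      simp only [← hμ, M.contrasts_apply, ← contrast_const_mul]
      rw [← contrast_sum]
      congr 1
      ext k
      exact Finset.sum_congr rfl fun j _ => mul_comm _ _
    rw [e1]
    simp only [e2, Matrix.mulVec, dotProduct, Finset.mul_sum]
    rw [Finset.sum_comm]
    exact Finset.sum_congr rfl fun l _ => Finset.sum_congr rfl fun j _ => by ring
  have hbessel := sum_contrast_sq_le (fun k => (M.prob_pos k).le)
    (fun k => ∑ l', M.fittedMean Bs k l' * u l')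
  set Qf := v ⬝ᵥ M.totalCov *ᵥ v with hQf
  -- The quadratic form of the total covariance is `Qf = ⟨u, contrasts⟩`, and `R ≤ Qf`, so that
  -- Cauchy-Schwarz and Bessel give `Qf² ≤ |u|² R ≤ |u|² Qf`.
  have h3 : Qf ^ 2 ≤ (∑ l, u l ^ 2) * R := by
    rw [h2]
    exact (Finset.sum_mul_sq_le_sq_mul_sq _ _ _).trans
      (mul_le_mul_of_nonneg_left hbessel (Finset.sum_nonneg fun l _ => sq_nonneg _))
  rw [← h1]
  have hu : 0 ≤ ∑ l, u l ^ 2 := Finset.sum_nonneg fun l _ => sq_nonneg _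
  by_contra hcon
  push Not at hcon
  have hQ0 : 0 < Qf := hu.trans_lt hcon
  nlinarith [mul_le_mul_of_nonneg_left (show R ≤ Qf by linarith) hu,
    mul_lt_mul_of_pos_right hcon hQ0]

lemma ClassModel.covW_column_le_one (hBs : M.totalCov * Bs = M.contrasts) (l : Fin (K - 1)) :
    (fun j => Bs j l) ⬝ᵥ M.covW *ᵥ (fun j => Bs j l) ≤ 1 := by
  have h := M.fitted_cov_le hBs (Pi.single l 1)
  have e : Bs *ᵥ Pi.single l 1 = fun j => Bs j l := by ext j; simp [Matrix.col_apply]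
  have hs : ∑ l', (Pi.single l 1 : Fin (K - 1) → ℝ) l' ^ 2 = 1 := by
    rw [Finset.sum_eq_single l] <;> simp +contextual
  rw [e, hs] at h
  have : 0 ≤ ∑ k, M.prob k *
      (∑ l', M.fittedMean Bs k l' * (Pi.single l 1 : Fin (K - 1) → ℝ) l') ^ 2 :=
    Finset.sum_nonneg fun k _ => mul_nonneg (M.prob_pos k).le (sq_nonneg _)
  linarith

lemma ClassModel.sum_prob_fittedMean_sq_le (hBs : M.totalCov * Bs = M.contrasts)
    (u : Fin (K - 1) → ℝ) :
    ∑ k, M.prob k * (∑ l, M.fittedMean Bs k l * u l) ^ 2 ≤ ∑ l, u l ^ 2 := by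
  have h := M.fitted_cov_le hBs u
  have : 0 ≤ (Bs *ᵥ u) ⬝ᵥ M.covW *ᵥ (Bs *ᵥ u) := by
    simpa using M.covW_posSemidef.dotProduct_mulVec_nonneg (Bs *ᵥ u)
  linarith

/-- Bessel's inequality for the fitted scores, the dual form of `sum_prob_fittedMean_sq_le`. -/
lemma ClassModel.sum_sq_sum_prob_mul_fittedMean_le (hBs : M.totalCov * Bs = M.contrasts)
    (h : Fin K → ℝ) :
    ∑ l, (∑ k, M.prob k * (h k * M.fittedMean Bs k l)) ^ 2 ≤ ∑ k, M.prob k * h k ^ 2 := by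
  set u : Fin (K - 1) → ℝ := fun l => ∑ k, M.prob k * (h k * M.fittedMean Bs k l) with hu
  set U := ∑ l, u l ^ 2 with hU
  have hU0 : 0 ≤ U := Finset.sum_nonneg fun l _ => sq_nonneg _
  have e : U = ∑ k, (√(M.prob k) * h k) * (√(M.prob k) * ∑ l, M.fittedMean Bs k l * u l) := by
    have : ∀ l, u l ^ 2 = ∑ k, M.prob k * (h k * M.fittedMean Bs k l) * u l := by
      intro l; rw [sq, ← Finset.sum_mul]
    simp only [hU, this]
    rw [Finset.sum_comm]
    refine Finset.sum_congr rfl fun k _ => ?_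
    rw [mul_mul_mul_comm, Real.mul_self_sqrt (M.prob_pos k).le, Finset.mul_sum, Finset.mul_sum]
    exact Finset.sum_congr rfl fun l _ => by ring
  have hcs := Finset.sum_mul_sq_le_sq_mul_sq Finset.univ (fun k => √(M.prob k) * h k)
    (fun k => √(M.prob k) * ∑ l, M.fittedMean Bs k l * u l)
  rw [← e] at hcs
  simp only [mul_pow, Real.sq_sqrt (M.prob_pos _).le] at hcs
  have h2 := M.sum_prob_fittedMean_sq_le hBs u
  have hH : 0 ≤ ∑ k, M.prob k * h k ^ 2 :=
    Finset.sum_nonneg fun k _ => mul_nonneg (M.prob_pos k).le (sq_nonneg _)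
  by_contra hcon
  push Not at hcon
  have hU1 : 0 < U := hH.trans_lt hcon
  nlinarith [mul_le_mul_of_nonneg_left h2 hH, mul_lt_mul_of_pos_right hcon hU1]

/-- A class of probability `π` has a fitted mean of squared norm at most `1 / π`. -/
lemma ClassModel.prob_mul_sum_fittedMean_sq_le (hBs : M.totalCov * Bs = M.contrasts)
    (k : Fin K) : M.prob k * ∑ l, M.fittedMean Bs k l ^ 2 ≤ 1 := by
  set U := ∑ l, M.fittedMean Bs k l ^ 2 with hU
  have h := M.sum_prob_fittedMean_sq_le hBs (M.fittedMean Bs k)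
  have h1 : M.prob k * (∑ l, M.fittedMean Bs k l * M.fittedMean Bs k l) ^ 2 ≤ U :=
    (Finset.single_le_sum (f := fun k' => M.prob k' *
      (∑ l, M.fittedMean Bs k' l * M.fittedMean Bs k l) ^ 2)
      (fun k' _ => mul_nonneg (M.prob_pos k').le (sq_nonneg _)) (Finset.mem_univ k)).trans h
  simp only [← sq] at h1
  rw [← hU] at h1
  have hU0 : 0 ≤ U := Finset.sum_nonneg fun l _ => sq_nonneg _
  rcases hU0.eq_or_lt with h0 | h0
  · rw [← h0]; simp
  · have : M.prob k * U * U ≤ 1 * U := by nlinarith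
    exact le_of_mul_le_mul_right this h0

lemma ClassModel.sum_prob_sum_fittedMean_sq_le (hBs : M.totalCov * Bs = M.contrasts) (hK : 1 ≤ K) :
    ∑ k, M.prob k * ∑ l, M.fittedMean Bs k l ^ 2 ≤ (K : ℝ) - 1 := by
  have h : ∀ l, ∑ k, M.prob k * M.fittedMean Bs k l ^ 2 ≤ 1 := by
    intro l
    have h1 := M.sum_prob_fittedMean_sq_le hBs (Pi.single l 1)
    have hs : ∑ l', (Pi.single l 1 : Fin (K - 1) → ℝ) l' ^ 2 = 1 := by
      rw [Finset.sum_eq_single l] <;> simp +contextual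
    rw [hs] at h1
    simpa [Pi.single_apply] using h1
  simp only [Finset.mul_sum]
  rw [Finset.sum_comm]
  calc _ ≤ ∑ l : Fin (K - 1), (1 : ℝ) := Finset.sum_le_sum fun l _ => h l
    _ = _ := by simp [Nat.cast_sub hK]

end Population

/-! ### Decomposition of the gradient and of the Gram matrix -/

section Decomposition

variable {n p K : ℕ} (M : ClassModel p K) {Bs : Matrix (Fin p) (Fin (K - 1)) ℝ}
  (ξ : Fin n → EuclideanSpace ℝ (Fin p)) (κ : Fin n → Fin K)

/-- Average over the sample of forms of the observations, which are centred at the means of their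
classes. -/
noncomputable def ClassModel.noiseAvg (a b : Fin p → ℝ) (α β : Fin n → ℝ) (γ : ℝ) : ℝ :=
  (n : ℝ)⁻¹ * ∑ i, obsForm (M.mean (κ i)) M.covW a b (α i) (β i) γ (ξ i)

lemma obsForm_single (μ : EuclideanSpace ℝ (Fin p)) (S : Matrix (Fin p) (Fin p) ℝ) (j : Fin p)
    (b : Fin p → ℝ) (α β γ : ℝ) (y : EuclideanSpace ℝ (Fin p)) :
    obsForm μ S (Pi.single j 1) b α β γ y = α * (y j - μ j) + β * (∑ j, b j * (y j - μ j))
      + γ * ((y j - μ j) * (∑ j, b j * (y j - μ j)) - (S *ᵥ b) j) := by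
  simp [obsForm, Pi.single_apply]

lemma ClassModel.totalCov_mulVec_apply (b : Fin p → ℝ) (j : Fin p) :
    (M.totalCov *ᵥ b) j = (M.covW *ᵥ b) j
      + ∑ k, M.prob k * (M.mean k j * ∑ j', M.mean k j' * b j') := by
  have h := M.dotProduct_totalCov_mulVec (Pi.single j 1) b
  simpa [Pi.single_apply] using h

lemma ClassModel.sum_prob_mul_mean (j : Fin p) : ∑ k, M.prob k * M.mean k j = 0 := by
  have := congrArg (fun v : EuclideanSpace ℝ (Fin p) => v j) M.mean_zero
  simpa using this

/-- Relative deviation of the class frequencies from the class probabilities. -/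
noncomputable def ClassModel.relDev (k : Fin K) : ℝ := (classFreq κ k - M.prob k) / M.prob k

lemma ClassModel.prob_mul_relDev (k : Fin K) :
    M.prob k * M.relDev κ k = classFreq κ k - M.prob k := by
  have := (M.prob_pos k).ne'
  unfold ClassModel.relDev; field_simp

lemma ClassModel.chiSq_eq : M.chiSq κ = ∑ k, M.prob k * M.relDev κ k ^ 2 := by
  refine Finset.sum_congr rfl fun k _ => ?_
  have := (M.prob_pos k).ne'
  unfold ClassModel.relDev; field_simp

/-- Replacement of class frequencies by class probabilities in an average. -/
lemma ClassModel.sum_classFreq_mul (h : Fin K → ℝ) :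
    ∑ k, classFreq κ k * h k
      = ∑ k, M.prob k * h k + ∑ k, M.prob k * (M.relDev κ k * h k) := by
  rw [← Finset.sum_add_distrib]
  refine Finset.sum_congr rfl fun k _ => ?_
  rw [← mul_assoc, M.prob_mul_relDev]
  ring

/-- One entry of the Gram matrix, applied to a vector `b`. -/
lemma ClassModel.gram_mulVec_eq (hn : 0 < n) (j : Fin p) (b : Fin p → ℝ) :
    (n : ℝ)⁻¹ * ∑ i, ξ i j * ∑ j', ξ i j' * b j' = (M.totalCov *ᵥ b) j
      + ∑ k, M.prob k * (M.relDev κ k * (M.mean k j * ∑ j', M.mean k j' * b j'))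
      + M.noiseAvg ξ κ (Pi.single j 1) b (fun i => ∑ j', M.mean (κ i) j' * b j')
          (fun i => M.mean (κ i) j) 1 := by
  have hn0 : (n : ℝ) ≠ 0 := by positivity
  have h1 := M.sum_classFreq_mul κ (fun k => M.mean k j * ∑ j', M.mean k j' * b j')
  rw [← sum_comp_label κ (fun k => M.mean k j * ∑ j', M.mean k j' * b j')] at h1
  rw [M.totalCov_mulVec_apply]
  have h2 : (n : ℝ)⁻¹ * ∑ i, ξ i j * ∑ j', ξ i j' * b j'
      = (n : ℝ)⁻¹ * ∑ i, (M.mean (κ i) j * ∑ j', M.mean (κ i) j' * b j')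
        + (M.covW *ᵥ b) j + M.noiseAvg ξ κ (Pi.single j 1) b
          (fun i => ∑ j', M.mean (κ i) j' * b j') (fun i => M.mean (κ i) j) 1 := by
    have hc : (M.covW *ᵥ b) j = (n : ℝ)⁻¹ * ∑ _i : Fin n, (M.covW *ᵥ b) j := by
      simp [hn0]
    rw [ClassModel.noiseAvg, hc, ← mul_add, ← mul_add, ← Finset.sum_add_distrib,
      ← Finset.sum_add_distrib]
    congr 1
    refine Finset.sum_congr rfl fun i _ => ?_
    have e : ∑ j, b j * (ξ i j - M.mean (κ i) j)
        = ∑ j', ξ i j' * b j' - ∑ j', M.mean (κ i) j' * b j' := by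
      rw [← Finset.sum_sub_distrib]
      exact Finset.sum_congr rfl fun j' _ => by ring
    rw [obsForm_single, e]
    ring
  rw [h2, h1]
  ring

/-- The gradient of the least squares loss at the population coefficients. -/
lemma ClassModel.gradient_eq (hBs : M.totalCov * Bs = M.contrasts) (hn : 0 < n) (j : Fin p)
    (l : Fin (K - 1)) :
    (n : ℝ)⁻¹ * ∑ i, ξ i j * (response κ i l - ∑ j', ξ i j' * Bs j' l)
      = (contrast (classFreq κ) (fun k => M.mean k j) l - contrast M.prob (fun k => M.mean k j) l)
        - ∑ k, M.prob k * (M.relDev κ k * M.mean k j * M.fittedMean Bs k l)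
        + M.noiseAvg ξ κ (Pi.single j 1) (fun j' => Bs j' l)
          (fun i => response κ i l - M.fittedMean Bs (κ i) l) (fun i => -M.mean (κ i) j) (-1) := by
  have h1 := M.gram_mulVec_eq ξ κ hn j (fun j' => Bs j' l)
  have h2 : (M.totalCov *ᵥ fun j' => Bs j' l) j = contrast M.prob (fun k => M.mean k j) l := by
    rw [← M.contrasts_apply, ← hBs]; rfl
  have h3 := sum_mul_response hn κ (fun k => M.mean k j) l
  have h4 : M.noiseAvg ξ κ (Pi.single j 1) (fun j' => Bs j' l)
        (fun i => response κ i l - M.fittedMean Bs (κ i) l) (fun i => -M.mean (κ i) j) (-1)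
      = (n : ℝ)⁻¹ * ∑ i, ξ i j * response κ i l
        - (n : ℝ)⁻¹ * ∑ i, M.mean (κ i) j * response κ i l
        - M.noiseAvg ξ κ (Pi.single j 1) (fun j' => Bs j' l)
          (fun i => ∑ j', M.mean (κ i) j' * Bs j' l) (fun i => M.mean (κ i) j) 1 := by
    simp only [ClassModel.noiseAvg, ← mul_sub, ← Finset.sum_sub_distrib]
    congr 1
    refine Finset.sum_congr rfl fun i _ => ?_
    rw [obsForm_single, obsForm_single, ClassModel.fittedMean]
    ring
  have h5 : ∑ k, M.prob k * (M.relDev κ k * (M.mean k j * ∑ j', M.mean k j' * Bs j' l))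
      = ∑ k, M.prob k * (M.relDev κ k * M.mean k j * M.fittedMean Bs k l) :=
    Finset.sum_congr rfl fun k _ => by rw [ClassModel.fittedMean]; ring
  rw [h2, h5] at h1
  have h6 : (n : ℝ)⁻¹ * ∑ i, ξ i j * (response κ i l - ∑ j', ξ i j' * Bs j' l)
      = (n : ℝ)⁻¹ * ∑ i, ξ i j * response κ i l
        - (n : ℝ)⁻¹ * ∑ i, ξ i j * ∑ j', ξ i j' * Bs j' l := by
    simp only [mul_sub, Finset.sum_sub_distrib]
  rw [h6, h4, h1, h3]
  ring

/-- The sample mean of a linear form of the features. -/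
lemma ClassModel.mean_linearForm_eq (b : Fin p → ℝ) :
    (n : ℝ)⁻¹ * ∑ i, ∑ j, ξ i j * b j
      = ∑ k, M.prob k * (M.relDev κ k * ∑ j, M.mean k j * b j)
        + (n : ℝ)⁻¹ * ∑ i, ∑ j, b j * (ξ i j - M.mean (κ i) j) := by
  have h1 := M.sum_classFreq_mul κ (fun k => ∑ j, M.mean k j * b j)
  have h0 : ∑ k, M.prob k * ∑ j, M.mean k j * b j = 0 := by
    simp only [Finset.mul_sum, ← mul_assoc]
    rw [Finset.sum_comm]
    simp only [← Finset.sum_mul, M.sum_prob_mul_mean, zero_mul, Finset.sum_const_zero]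
  rw [h0, zero_add, ← sum_comp_label] at h1
  rw [← h1, ← mul_add, ← Finset.sum_add_distrib]
  congr 1
  refine Finset.sum_congr rfl fun i _ => ?_
  rw [← Finset.sum_add_distrib]
  exact Finset.sum_congr rfl fun j _ => by ring

/-- Effect of column-centering (`δ = 1`) or of its absence (`δ = 0`) on the Gram matrix and on the
gradient. The response has mean zero in the sample. -/
lemma exists_centering_factor (hn : 0 < n) {X : Matrix (Fin n) (Fin p) ℝ}
    (hX : X = centerColumns (dataMatrix ξ) ∨ X = dataMatrix ξ)
    (Bs : Matrix (Fin p) (Fin (K - 1)) ℝ) :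
    ∃ δ : ℝ, δ ^ 2 ≤ 1 ∧
      (∀ j k, (n : ℝ)⁻¹ * ∑ i, X i j * X i k = (n : ℝ)⁻¹ * ∑ i, ξ i j * ξ i k
        - δ * (((n : ℝ)⁻¹ * ∑ i, ξ i j) * ((n : ℝ)⁻¹ * ∑ i, ξ i k))) ∧
      (∀ j l, (n : ℝ)⁻¹ * ∑ i, X i j * (response κ i l - ∑ k, X i k * Bs k l)
        = (n : ℝ)⁻¹ * ∑ i, ξ i j * (response κ i l - ∑ k, ξ i k * Bs k l)
        + δ * (((n : ℝ)⁻¹ * ∑ i, ξ i j) * ((n : ℝ)⁻¹ * ∑ i, ∑ k, ξ i k * Bs k l))) := by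
  have hn0 : (n : ℝ) ≠ 0 := by positivity
  rcases hX with rfl | rfl
  · refine ⟨1, by norm_num, fun j k => ?_, fun j l => ?_⟩
    · simp only [centerColumns, dataMatrix, Matrix.of_apply]
      set u := (n : ℝ)⁻¹ * ∑ i, ξ i j with hu
      set v := (n : ℝ)⁻¹ * ∑ i, ξ i k with hv
      have h : ∀ i, (ξ i j - u) * (ξ i k - v)
          = ξ i j * ξ i k - u * ξ i k - v * ξ i j + u * v := fun i => by ring
      simp only [h, Finset.sum_add_distrib, Finset.sum_sub_distrib, ← Finset.mul_sum,
        Finset.sum_const, Finset.card_univ, Fintype.card_fin, nsmul_eq_mul]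
      have hu' : ∑ i, ξ i j = n * u := by rw [hu]; field_simp
      have hv' : ∑ i, ξ i k = n * v := by rw [hv]; field_simp
      rw [hu', hv']
      field_simp
      ring
    · simp only [centerColumns, dataMatrix, Matrix.of_apply]
      set u := (n : ℝ)⁻¹ * ∑ i, ξ i j with hu
      set v := (n : ℝ)⁻¹ * ∑ i, ∑ k, ξ i k * Bs k l with hv
      have hfit : ∀ i, ∑ k, (ξ i k - (n : ℝ)⁻¹ * ∑ i', ξ i' k) * Bs k l
          = ∑ k, ξ i k * Bs k l - v := by
        intro i
        simp only [sub_mul, Finset.sum_sub_distrib, hv]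
        congr 1
        rw [Finset.sum_comm, Finset.mul_sum]
        refine Finset.sum_congr rfl fun k _ => ?_
        rw [mul_assoc, Finset.sum_mul]
      simp only [hfit]
      have h : ∀ i, (ξ i j - u) * (response κ i l - (∑ k, ξ i k * Bs k l - v))
          = ξ i j * (response κ i l - ∑ k, ξ i k * Bs k l) + v * ξ i j
            - u * response κ i l + u * (∑ k, ξ i k * Bs k l) - u * v := fun i => by ring
      simp only [h, Finset.sum_add_distrib, Finset.sum_sub_distrib, ← Finset.mul_sum,
        Finset.sum_const, Finset.card_univ, Fintype.card_fin, nsmul_eq_mul,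
        sum_response_eq_zero hn]
      have hu' : ∑ i, ξ i j = n * u := by rw [hu]; field_simp
      have hv' : ∑ i, ∑ k, ξ i k * Bs k l = n * v := by rw [hv]; field_simp
      rw [hu', hv']
      field_simp
      ring
  · exact ⟨0, by norm_num, fun j k => by simp [dataMatrix], fun j l => by simp [dataMatrix]⟩

end Decomposition

/-! ### The event on which the estimator is accurate -/

section GoodEvent

variable {n p K : ℕ} (M : ClassModel p K) (Bs : Matrix (Fin p) (Fin (K - 1)) ℝ)
  (ξ : Fin n → EuclideanSpace ℝ (Fin p)) (κ : Fin n → Fin K)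

/-- The sample behaves well at level `t`: the class frequencies and all averages of the noise are
of the order of their standard deviations times `√t`. -/
structure ClassModel.WellBehaved (t : ℝ) : Prop where
  chiSq_le : M.chiSq κ ≤ ((K : ℝ) - 1) * t / n
  gradient_le : ∀ j, ∑ l, M.noiseAvg ξ κ (Pi.single j 1) (fun j' => Bs j' l)
      (fun i => response κ i l - M.fittedMean Bs (κ i) l) (fun i => -M.mean (κ i) j) (-1) ^ 2
    ≤ 8 * ((K : ℝ) - 1) * M.tau ^ 2 * t / n
  gram_le : ∀ j k, M.noiseAvg ξ κ (Pi.single j 1) (Pi.single k 1)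
      (fun i => M.mean (κ i) k) (fun i => M.mean (κ i) j) 1 ^ 2 ≤ 8 * M.tau ^ 4 * t / n
  mean_le : ∀ j, ((n : ℝ)⁻¹ * ∑ i, (ξ i j - M.mean (κ i) j)) ^ 2 ≤ 8 * M.tau ^ 2 * t / n
  fit_le : ∑ l, ((n : ℝ)⁻¹ * ∑ i, ∑ j, Bs j l * (ξ i j - M.mean (κ i) j)) ^ 2
    ≤ 8 * ((K : ℝ) - 1) * t / n

variable {M Bs ξ κ}

lemma ClassModel.sq_sum_prob_mul_relDev_le {h : Fin K → ℝ} {H : ℝ} (hh : ∀ k, |h k| ≤ H) :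
    (∑ k, M.prob k * (M.relDev κ k * h k)) ^ 2 ≤ H ^ 2 * M.chiSq κ := by
  have hcs := Finset.sum_mul_sq_le_sq_mul_sq Finset.univ (fun k => √(M.prob k) * M.relDev κ k)
    (fun k => √(M.prob k) * h k)
  have e : ∀ k, √(M.prob k) * M.relDev κ k * (√(M.prob k) * h k)
      = M.prob k * (M.relDev κ k * h k) := fun k => by
    rw [mul_mul_mul_comm, Real.mul_self_sqrt (M.prob_pos k).le]
  simp only [e, mul_pow, Real.sq_sqrt (M.prob_pos _).le, ← M.chiSq_eq] at hcs
  have h2 : ∑ k, M.prob k * h k ^ 2 ≤ H ^ 2 := by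
    calc ∑ k, M.prob k * h k ^ 2 ≤ ∑ k, M.prob k * H ^ 2 := by
          refine Finset.sum_le_sum fun k _ => mul_le_mul_of_nonneg_left ?_ (M.prob_pos k).le
          exact sq_le_sq.2 ((hh k).trans (le_abs_self H))
      _ = H ^ 2 := by rw [← Finset.sum_mul, M.prob_sum, one_mul]
  rw [mul_comm (H ^ 2)]
  exact hcs.trans (mul_le_mul_of_nonneg_left h2 (M.chiSq_nonneg κ))

variable {t : ℝ}

lemma ClassModel.WellBehaved.sq_mean_le (h : M.WellBehaved Bs ξ κ t) (hn : 0 < n) (ht : 8 * t ≤ n)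
    (j : Fin p) :
    ((n : ℝ)⁻¹ * ∑ i, ξ i j) ^ 2 ≤ 4 * M.tau ^ 2 := by
  have hn0 : (0 : ℝ) < n := by exact_mod_cast hn
  have e : (n : ℝ)⁻¹ * ∑ i, ξ i j = (n : ℝ)⁻¹ * ∑ i, M.mean (κ i) j
      + (n : ℝ)⁻¹ * ∑ i, (ξ i j - M.mean (κ i) j) := by
    rw [← mul_add, ← Finset.sum_add_distrib]
    congr 1
    exact Finset.sum_congr rfl fun i _ => by ring
  have h1 : ((n : ℝ)⁻¹ * ∑ i, M.mean (κ i) j) ^ 2 ≤ M.tau ^ 2 := by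
    refine sq_le_sq.2 (le_trans ?_ (le_abs_self _))
    rw [abs_mul, abs_of_pos (inv_pos.2 hn0), inv_mul_le_iff₀ hn0]
    calc |∑ i, M.mean (κ i) j| ≤ ∑ i, |M.mean (κ i) j| := Finset.abs_sum_le_sum_abs _ _
      _ ≤ ∑ i : Fin n, M.tau := Finset.sum_le_sum fun i _ => M.abs_mean_le_tau j _
      _ = n * M.tau := by simp
  have h2 := h.mean_le j
  have h3 : 8 * M.tau ^ 2 * t / n ≤ M.tau ^ 2 := by
    rw [div_le_iff₀ hn0]; nlinarith [sq_nonneg M.tau]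
  rw [e]
  generalize (n : ℝ)⁻¹ * ∑ i, M.mean (κ i) j = u at *
  generalize (n : ℝ)⁻¹ * ∑ i, (ξ i j - M.mean (κ i) j) = v at *
  nlinarith [sq_nonneg (u - v)]

/-- The column means are small; together with the crude bound `sq_mean_le`, which is used for one
factor of each product of means, it controls the effect of centering. -/
lemma ClassModel.WellBehaved.sq_mean_le' (h : M.WellBehaved Bs ξ κ t) (hK : 2 ≤ K) (ht : 0 ≤ t)
    (j : Fin p) :
    ((n : ℝ)⁻¹ * ∑ i, ξ i j) ^ 2 ≤ 18 * (M.tau ^ 2 * (((K : ℝ) - 1) * t / n)) := by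
  have hK1 : (1 : ℝ) ≤ (K : ℝ) - 1 := by
    have : (2 : ℝ) ≤ K := by exact_mod_cast hK
    linarith
  have e := M.mean_linearForm_eq ξ κ (Pi.single j 1)
  simp only [Pi.single_apply, mul_ite, mul_one, mul_zero, Finset.sum_ite_eq', Finset.mem_univ,
    if_true, ite_mul, one_mul, zero_mul] at e
  have h1 := M.sq_sum_prob_mul_relDev_le (κ := κ) (h := fun k => M.mean k j)
    fun k => M.abs_mean_le_tau j k
  have h2 := h.mean_le j
  have h3 := mul_le_mul_of_nonneg_left h.chiSq_le (sq_nonneg M.tau)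
  have h4 : 8 * M.tau ^ 2 * t / n ≤ 8 * (M.tau ^ 2 * (((K : ℝ) - 1) * t / n)) := by
    have : 0 ≤ 8 * (M.tau ^ 2 * (t / n)) := by positivity
    calc 8 * M.tau ^ 2 * t / n = 1 * (8 * (M.tau ^ 2 * (t / n))) := by ring
      _ ≤ ((K : ℝ) - 1) * (8 * (M.tau ^ 2 * (t / n))) := by gcongr
      _ = _ := by ring
  rw [e]
  generalize ∑ k, M.prob k * (M.relDev κ k * M.mean k j) = u at *
  generalize (n : ℝ)⁻¹ * ∑ i, (ξ i j - M.mean (κ i) j) = v at *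
  nlinarith [sq_nonneg (u - v)]

lemma ClassModel.WellBehaved.sum_sq_mean_fit_le (h : M.WellBehaved Bs ξ κ t)
    (hBs : M.totalCov * Bs = M.contrasts) :
    ∑ l, ((n : ℝ)⁻¹ * ∑ i, ∑ k, ξ i k * Bs k l) ^ 2 ≤ 18 * (((K : ℝ) - 1) * t / n) := by
  have h1 := M.sum_sq_sum_prob_mul_fittedMean_le hBs (M.relDev κ)
  rw [← M.chiSq_eq] at h1
  have h2 := h.fit_le
  calc ∑ l, ((n : ℝ)⁻¹ * ∑ i, ∑ k, ξ i k * Bs k l) ^ 2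
      ≤ ∑ l, (2 * (∑ k, M.prob k * (M.relDev κ k * M.fittedMean Bs k l)) ^ 2
        + 2 * ((n : ℝ)⁻¹ * ∑ i, ∑ j, Bs j l * (ξ i j - M.mean (κ i) j)) ^ 2) := by
        refine Finset.sum_le_sum fun l _ => ?_
        have e := M.mean_linearForm_eq ξ κ (fun j => Bs j l)
        rw [e]
        simp only [ClassModel.fittedMean]
        generalize ∑ k, M.prob k * (M.relDev κ k * ∑ j, M.mean k j * Bs j l) = u
        generalize (n : ℝ)⁻¹ * ∑ i, ∑ j, Bs j l * (ξ i j - M.mean (κ i) j) = v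
        nlinarith [sq_nonneg (u - v)]
    _ ≤ 2 * (((K : ℝ) - 1) * t / n) + 2 * (8 * ((K : ℝ) - 1) * t / n) := by
        rw [Finset.sum_add_distrib, ← Finset.mul_sum, ← Finset.mul_sum]
        gcongr
        exact h1.trans h.chiSq_le
    _ = _ := by ring

/-- On the good event, the rows of the gradient are of the order of the tuning scale. -/
lemma ClassModel.WellBehaved.sum_sq_gradient_le (h : M.WellBehaved Bs ξ κ t)
    (hBs : M.totalCov * Bs = M.contrasts) (hn : 0 < n) (hK : 2 ≤ K) (ht0 : 0 ≤ t)
    (ht : 8 * t ≤ n) {X : Matrix (Fin n) (Fin p) ℝ}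
    (hX : X = centerColumns (dataMatrix ξ) ∨ X = dataMatrix ξ) (j : Fin p) :
    ∑ l, ((n : ℝ)⁻¹ * ∑ i, X i j * (response κ i l - ∑ k, X i k * Bs k l)) ^ 2
      ≤ 1600 * (M.tau ^ 2 * (((K : ℝ) - 1) * t / n)) := by
  obtain ⟨δ, hδ, -, hgrad⟩ := exists_centering_factor ξ κ hn hX Bs
  have hK1 : (1 : ℝ) ≤ (K : ℝ) - 1 := by
    have : (2 : ℝ) ≤ K := by exact_mod_cast hK
    linarith
  set R := ((K : ℝ) - 1) * t / n with hR
  have hR0 : 0 ≤ R := by positivity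
  have h1 := sum_contrast_sub_sq_le (q := M.prob) (q' := classFreq κ) (f := fun k => M.mean k j)
    (g := M.relDev κ) M.prob_pos (classFreq_nonneg κ) (fun k => M.abs_mean_le_tau j k)
    fun k => (M.prob_mul_relDev κ k).symm
  rw [← M.chiSq_eq] at h1
  have h2 := M.sum_sq_sum_prob_mul_fittedMean_le hBs (fun k => M.relDev κ k * M.mean k j)
  have h2' : ∑ k, M.prob k * (M.relDev κ k * M.mean k j) ^ 2 ≤ M.tau ^ 2 * M.chiSq κ := by
    rw [M.chiSq_eq, Finset.mul_sum]
    refine Finset.sum_le_sum fun k _ => ?_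
    have hm := sq_le_sq.2 ((M.abs_mean_le_tau j k).trans (le_abs_self M.tau))
    have hp : 0 ≤ M.prob k * M.relDev κ k ^ 2 := mul_nonneg (M.prob_pos k).le (sq_nonneg _)
    nlinarith [mul_le_mul_of_nonneg_left hm hp]
  have h3 := h.gradient_le j
  have h4 := h.sum_sq_mean_fit_le hBs
  have h5 := h.sq_mean_le hn ht j
  have hchi := h.chiSq_le
  set x1 : Fin (K - 1) → ℝ := fun l => contrast (classFreq κ) (fun k => M.mean k j) l
    - contrast M.prob (fun k => M.mean k j) l
  set x2 : Fin (K - 1) → ℝ := fun l =>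
    ∑ k, M.prob k * (M.relDev κ k * M.mean k j * M.fittedMean Bs k l)
  set x3 : Fin (K - 1) → ℝ := fun l => M.noiseAvg ξ κ (Pi.single j 1) (fun j' => Bs j' l)
      (fun i => response κ i l - M.fittedMean Bs (κ i) l) (fun i => -M.mean (κ i) j) (-1)
  set xb := (n : ℝ)⁻¹ * ∑ i, ξ i j
  set x4 : Fin (K - 1) → ℝ := fun l => (n : ℝ)⁻¹ * ∑ i, ∑ k, ξ i k * Bs k l
  have hstep : ∀ l, ((n : ℝ)⁻¹ * ∑ i, X i j * (response κ i l - ∑ k, X i k * Bs k l)) ^ 2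
      ≤ 4 * (x1 l ^ 2 + x2 l ^ 2 + x3 l ^ 2 + 4 * M.tau ^ 2 * x4 l ^ 2) := by
    intro l
    rw [hgrad, M.gradient_eq ξ κ hBs hn]
    change (x1 l - x2 l + x3 l + δ * (xb * x4 l)) ^ 2 ≤ _
    have h6 : (δ * (xb * x4 l)) ^ 2 ≤ 4 * M.tau ^ 2 * x4 l ^ 2 := by
      calc (δ * (xb * x4 l)) ^ 2 = δ ^ 2 * (xb ^ 2 * x4 l ^ 2) := by ring
        _ ≤ 1 * (4 * M.tau ^ 2 * x4 l ^ 2) := by gcongr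
        _ = _ := one_mul _
    generalize δ * (xb * x4 l) = y at *
    nlinarith [sq_nonneg (x1 l + x2 l), sq_nonneg (x1 l - x3 l), sq_nonneg (x1 l - y),
      sq_nonneg (x2 l + x3 l), sq_nonneg (x2 l + y), sq_nonneg (x3 l - y)]
  calc _ ≤ ∑ l, 4 * (x1 l ^ 2 + x2 l ^ 2 + x3 l ^ 2 + 4 * M.tau ^ 2 * x4 l ^ 2) :=
        Finset.sum_le_sum fun l _ => hstep l
    _ = 4 * (∑ l, x1 l ^ 2 + ∑ l, x2 l ^ 2 + ∑ l, x3 l ^ 2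
        + 4 * M.tau ^ 2 * ∑ l, x4 l ^ 2) := by
        simp only [Finset.mul_sum, Finset.sum_add_distrib, mul_add]
    _ ≤ 4 * (272 * M.tau ^ 2 * R + M.tau ^ 2 * R + 8 * ((K : ℝ) - 1) * M.tau ^ 2 * t / n
        + 4 * M.tau ^ 2 * (18 * R)) := by
        gcongr
        · exact h1.trans (by gcongr)
        · exact h2.trans (h2'.trans (by gcongr))
    _ = 4 * 353 * (M.tau ^ 2 * R) := by rw [hR]; ring
    _ ≤ _ := by
        have : 0 ≤ M.tau ^ 2 * R := by positivity
        linarith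

/-- On the good event, the Gram matrix is entrywise close to the total covariance. -/
lemma ClassModel.WellBehaved.sq_gram_sub_le (h : M.WellBehaved Bs ξ κ t) (hn : 0 < n) (hK : 2 ≤ K)
    (ht0 : 0 ≤ t) (ht : 8 * t ≤ n) {X : Matrix (Fin n) (Fin p) ℝ}
    (hX : X = centerColumns (dataMatrix ξ) ∨ X = dataMatrix ξ) (j k : Fin p) :
    (M.totalCov j k - (n : ℝ)⁻¹ * ∑ i, X i j * X i k) ^ 2
      ≤ 1600 * (M.tau ^ 4 * (((K : ℝ) - 1) * t / n)) := by
  obtain ⟨δ, hδ, hgram, -⟩ := exists_centering_factor ξ κ hn hX Bs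
  have hK1 : (1 : ℝ) ≤ (K : ℝ) - 1 := by
    have : (2 : ℝ) ≤ K := by exact_mod_cast hK
    linarith
  have e := M.gram_mulVec_eq ξ κ hn j (Pi.single k 1)
  simp only [Pi.single_apply, mul_ite, mul_one, mul_zero, Finset.sum_ite_eq', Finset.mem_univ,
    if_true, Matrix.mulVec_single_one, Matrix.col_apply] at e
  have h1 := M.sq_sum_prob_mul_relDev_le (κ := κ) (h := fun k' => M.mean k' j * M.mean k' k)
    (H := M.tau * M.tau) fun k' => by
      rw [abs_mul]
      exact mul_le_mul (M.abs_mean_le_tau j k') (M.abs_mean_le_tau k k') (abs_nonneg _) M.tau_nonneg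
  have h2 := h.gram_le j k
  have h3 := h.sq_mean_le hn ht j
  have h4 := h.sq_mean_le' hK ht0 k
  have hchi := mul_le_mul_of_nonneg_left h.chiSq_le (sq_nonneg (M.tau * M.tau))
  set R := ((K : ℝ) - 1) * t / n with hR
  have hR0 : 0 ≤ R := by positivity
  have h5 : 8 * M.tau ^ 4 * t / n ≤ 8 * (M.tau ^ 4 * R) := by
    have : 0 ≤ 8 * (M.tau ^ 4 * (t / n)) := by positivity
    calc 8 * M.tau ^ 4 * t / n = 1 * (8 * (M.tau ^ 4 * (t / n))) := by ring
      _ ≤ ((K : ℝ) - 1) * (8 * (M.tau ^ 4 * (t / n))) := by gcongr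
      _ = _ := by rw [hR]; ring
  set xb := (n : ℝ)⁻¹ * ∑ i, ξ i j
  set yb := (n : ℝ)⁻¹ * ∑ i, ξ i k
  have h6 : (δ * (xb * yb)) ^ 2 ≤ 72 * (M.tau ^ 4 * R) := by
    calc (δ * (xb * yb)) ^ 2 = δ ^ 2 * (xb ^ 2 * yb ^ 2) := by ring
      _ ≤ 1 * ((4 * M.tau ^ 2) * (18 * (M.tau ^ 2 * R))) := by gcongr
      _ = _ := by ring
  rw [hgram, e]
  have hpos : 0 ≤ M.tau ^ 4 * R := by positivity
  have hpow : (M.tau * M.tau) ^ 2 * R = M.tau ^ 4 * R := by ring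
  rw [hpow] at hchi
  generalize ∑ k', M.prob k' * (M.relDev κ k' * (M.mean k' j * M.mean k' k)) = u at *
  generalize M.noiseAvg ξ κ (Pi.single j 1) (Pi.single k 1)
      (fun i => M.mean (κ i) k) (fun i => M.mean (κ i) j) 1 = v at *
  generalize δ * (xb * yb) = y at *
  nlinarith [sq_nonneg (u - v), sq_nonneg (u + y), sq_nonneg (v + y)]

end GoodEvent

/-! ### Probability of the good event -/

section Probability

variable {n p K : ℕ} {M : ClassModel p K} {Bs : Matrix (Fin p) (Fin (K - 1)) ℝ} {Ω : Type*}
  [MeasurableSpace Ω] {P : Measure Ω} {x : Fin n → Ω → EuclideanSpace ℝ (Fin p)}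
  {z : Fin n → Ω → Fin K}

lemma sum_sub_sq_le {ι : Type*} (s : Finset ι) (u v : ι → ℝ) :
    ∑ i ∈ s, (u i - v i) ^ 2 ≤ 2 * ∑ i ∈ s, u i ^ 2 + 2 * ∑ i ∈ s, v i ^ 2 := by
  rw [Finset.mul_sum, Finset.mul_sum, ← Finset.sum_add_distrib]
  exact Finset.sum_le_sum fun i _ => by nlinarith [sq_nonneg (u i + v i)]

lemma sum_sq_le_of_abs_le {n : ℕ} {u : Fin n → ℝ} {τ : ℝ} (h : ∀ i, |u i| ≤ τ) :
    ∑ i, u i ^ 2 ≤ n * τ ^ 2 := by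
  calc ∑ i, u i ^ 2 ≤ ∑ _i : Fin n, τ ^ 2 :=
        Finset.sum_le_sum fun i _ => sq_le_sq.2 ((h i).trans (le_abs_self τ))
    _ = _ := by simp

lemma ClassModel.dotProduct_covW_single_le (M : ClassModel p K) (hK : 0 < K) (j : Fin p) :
    (Pi.single j 1 : Fin p → ℝ) ⬝ᵥ M.covW *ᵥ Pi.single j 1 ≤ M.tau ^ 2 := by
  simpa using M.covW_diag_le hK j

/-- The mean squared norm of the fitted class means does not exceed twice its expectation, with
high probability. The lower bound for the class probabilities enters here. -/
lemma measure_fittedMean_le [IsProbabilityMeasure P] (hn : 0 < n)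
    (hlaw : ∀ i, HasLaw (fun ω => (x i ω, z i ω)) M.law P)
    (hind : iIndepFun (fun i ω => (x i ω, z i ω)) P) (hK : 2 ≤ K)
    (hBs : M.totalCov * Bs = M.contrasts) {c : ℝ} (hc : 0 < c) (hprob : ∀ k, c / K ≤ M.prob k) :
    P {ω | 2 * ((K : ℝ) - 1)
        < ∑ k, classFreq (fun i => z i ω) k * ∑ l, M.fittedMean Bs k l ^ 2}
      ≤ ENNReal.ofReal (2 / (c * n)) := by
  have hn0 : (0 : ℝ) < n := by exact_mod_cast hn
  have hK2 : (2 : ℝ) ≤ K := by exact_mod_cast hK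
  have hK1 : 0 < (K : ℝ) - 1 := by linarith
  have hmean := M.sum_prob_sum_fittedMean_sq_le hBs (by omega)
  refine (measure_label_average_le hn hlaw hind (fun k => ∑ l, M.fittedMean Bs k l ^ 2) hK1
    hmean).trans (ENNReal.ofReal_le_ofReal ?_)
  have hmax : ∀ k, ∑ l, M.fittedMean Bs k l ^ 2 ≤ K / c := by
    intro k
    have h1 := M.prob_mul_sum_fittedMean_sq_le hBs k
    have h0 : 0 ≤ ∑ l, M.fittedMean Bs k l ^ 2 := Finset.sum_nonneg fun l _ => sq_nonneg _
    have h2 := (mul_le_mul_of_nonneg_right (hprob k) h0).trans h1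
    rw [le_div_iff₀ hc]
    rw [div_mul_eq_mul_div, div_le_one (by linarith)] at h2
    linarith
  have h4 : ∑ k, M.prob k * (∑ l, M.fittedMean Bs k l ^ 2) ^ 2 ≤ K / c * ((K : ℝ) - 1) := by
    calc ∑ k, M.prob k * (∑ l, M.fittedMean Bs k l ^ 2) ^ 2
        ≤ ∑ k, K / c * (M.prob k * ∑ l, M.fittedMean Bs k l ^ 2) := by
          refine Finset.sum_le_sum fun k _ => ?_
          have h0 : 0 ≤ ∑ l, M.fittedMean Bs k l ^ 2 := Finset.sum_nonneg fun l _ => sq_nonneg _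
          have := mul_le_mul_of_nonneg_left (hmax k) (mul_nonneg (M.prob_pos k).le h0)
          nlinarith
      _ ≤ _ := by rw [← Finset.mul_sum]; gcongr
  calc _ ≤ K / c * ((K : ℝ) - 1) / (n * ((K : ℝ) - 1) ^ 2) := by gcongr
    _ = K / ((K : ℝ) - 1) / (c * n) := by field_simp
    _ ≤ 2 / (c * n) := by
        gcongr
        rw [div_le_iff₀ hK1]; linarith

/-- The exceptional probability. The constant `34` leaves room for the union bound over the `p²`
entries of the Gram matrix after a tail of order `p ^ (32 - A)`. -/
lemma measure_not_wellBehaved_le [IsProbabilityMeasure P] (hn : 0 < n)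
    (hlaw : ∀ i, HasLaw (fun ω => (x i ω, z i ω)) M.law P)
    (hind : iIndepFun (fun i ω => (x i ω, z i ω)) P) (hp : 2 ≤ p) (hK : 2 ≤ K)
    (hBs : M.totalCov * Bs = M.contrasts) {c : ℝ} (hc : 0 < c) (hprob : ∀ k, c / K ≤ M.prob k)
    (hτ : 0 < M.tau) {A : ℝ} (hA : 0 < A) (hpn : 256 * Real.log p ≤ n) :
    P {ω | ¬ M.WellBehaved Bs (fun i => x i ω) (fun i => z i ω) (A ^ 2 * Real.log p)}
      ≤ ENNReal.ofReal (2 / (A ^ 2 * Real.log p) + 2 / (c * n)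
        + 8 * Real.exp ((34 - A) * Real.log p)) := by
  have hn0 : (0 : ℝ) < n := by exact_mod_cast hn
  have hK2 : (2 : ℝ) ≤ K := by exact_mod_cast hK
  have hK1 : 0 < (K : ℝ) - 1 := by linarith
  have hKc : ((K - 1 : ℕ) : ℝ) = (K : ℝ) - 1 := by rw [Nat.cast_sub (by omega)]; simp
  have hp2 : (2 : ℝ) ≤ p := by exact_mod_cast hp
  set L := Real.log p with hL
  have hL0 : 0 < L := Real.log_pos (by linarith)
  have hexpL : Real.exp L = p := Real.exp_log (by linarith)
  set s := √L with hs
  have hs2 : s ^ 2 = L := Real.sq_sqrt hL0.le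
  have hsn : 256 * s ^ 2 ≤ n := by rwa [hs2]
  have hAs : (A * s) ^ 2 = A ^ 2 * L := by rw [mul_pow, hs2]
  set η := 2 * Real.exp ((32 - A) * L) with hη
  have hη0 : 0 ≤ η := by positivity
  set G : Set (Fin n → Fin K) :=
    {κ | ∑ k, classFreq κ k * ∑ l, M.fittedMean Bs k l ^ 2 ≤ 2 * ((K : ℝ) - 1)} with hG
  set B1 : Set Ω := {ω | ((K : ℝ) - 1) * (A ^ 2 * L) / n < M.chiSq (fun i => z i ω)} with hB1
  set B2 : Set Ω := {ω | (fun i => z i ω) ∉ G} with hB2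
  set B3 : Fin p → Set Ω := fun j => {ω | (fun i => z i ω) ∈ G ∧
    8 * ((K : ℝ) - 1) * M.tau ^ 2 * (A ^ 2 * L) / n < ∑ l, M.noiseAvg (fun i => x i ω)
      (fun i => z i ω) (Pi.single j 1) (fun j' => Bs j' l)
      (fun i => response (fun i => z i ω) i l - M.fittedMean Bs (z i ω) l)
      (fun i => -M.mean (z i ω) j) (-1) ^ 2} with hB3
  set B4 : Fin p → Fin p → Set Ω := fun j k => {ω | 8 * M.tau ^ 4 * (A ^ 2 * L) / n <
    M.noiseAvg (fun i => x i ω) (fun i => z i ω) (Pi.single j 1) (Pi.single k 1)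
      (fun i => M.mean (z i ω) k) (fun i => M.mean (z i ω) j) 1 ^ 2} with hB4
  set B5 : Fin p → Set Ω := fun j => {ω | 8 * M.tau ^ 2 * (A ^ 2 * L) / n <
    ((n : ℝ)⁻¹ * ∑ i, (x i ω j - M.mean (z i ω) j)) ^ 2} with hB5
  set B6 : Set Ω := {ω | 8 * ((K : ℝ) - 1) * (A ^ 2 * L) / n <
    ∑ l, ((n : ℝ)⁻¹ * ∑ i, ∑ j, Bs j l * (x i ω j - M.mean (z i ω) j)) ^ 2} with hB6
  have hsub : {ω | ¬ M.WellBehaved Bs (fun i => x i ω) (fun i => z i ω) (A ^ 2 * L)}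
      ⊆ B1 ∪ B2 ∪ (⋃ j, B3 j) ∪ (⋃ j, ⋃ k, B4 j k) ∪ (⋃ j, B5 j) ∪ B6 := by
    intro ω hω
    by_contra hcon
    simp only [Set.mem_union, Set.mem_iUnion, not_or, not_exists] at hcon
    obtain ⟨⟨⟨⟨⟨h1, h2⟩, h3⟩, h4⟩, h5⟩, h6⟩ := hcon
    have hzG : (fun i => z i ω) ∈ G := not_not.1 h2
    exact hω ⟨not_lt.1 h1, fun j => not_lt.1 fun hlt => h3 j ⟨hzG, hlt⟩,
      fun j k => not_lt.1 (h4 j k), fun j => not_lt.1 (h5 j), not_lt.1 h6⟩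
  have p1 : P B1 ≤ ENNReal.ofReal (2 / (A ^ 2 * L)) := by
    refine (measure_chiSq_le hn hlaw hind (by positivity)).trans (ENNReal.ofReal_le_ofReal ?_)
    rw [div_le_div_iff₀ (by positivity) (by positivity)]
    have e : (n : ℝ) * (((K : ℝ) - 1) * (A ^ 2 * L) / n) = ((K : ℝ) - 1) * (A ^ 2 * L) := by
      field_simp
    rw [e]
    have : 0 < A ^ 2 * L := by positivity
    nlinarith
  have p2 : P B2 ≤ ENNReal.ofReal (2 / (c * n)) := by
    refine le_trans (measure_mono fun ω hω => ?_)
      (measure_fittedMean_le hn hlaw hind hK hBs hc hprob)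
    have hω' : ¬ (∑ k, classFreq (fun i => z i ω) k * ∑ l, M.fittedMean Bs k l ^ 2
        ≤ 2 * ((K : ℝ) - 1)) := hω
    exact not_le.1 hω'
  have p3 : ∀ j, P (B3 j) ≤ ENNReal.ofReal η := by
    intro j
    have h := measure_obsForm_tail hlaw hind hn G (m := K - 1) (by omega) (Pi.single j 1)
      (fun l j' => Bs j' l) hτ one_pos (M.dotProduct_covW_single_le (by omega) j)
      (fun l => by rw [one_pow]; exact M.covW_column_le_one hBs l)
      (fun κ i l => response κ i l - M.fittedMean Bs (κ i) l) (fun κ i l => -M.mean (κ i) j)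
      (γ := -1) (fun κ l => 2 + 2 * ∑ k, classFreq κ k * M.fittedMean Bs k l ^ 2)
      (by simp)
      (fun κ _ l => by
        refine (sum_sub_sq_le _ _ _).trans ?_
        have h1 := sum_response_sq_le κ l
        have h2 := sum_comp_label κ (fun k => M.fittedMean Bs k l ^ 2)
        rw [← h2]
        have e : (n : ℝ) * (1 ^ 2 * (2 + 2 * ((n : ℝ)⁻¹ * ∑ i, M.fittedMean Bs (κ i) l ^ 2)))
            = 2 * n + 2 * ∑ i, M.fittedMean Bs (κ i) l ^ 2 := by field_simp
        rw [e]
        linarith)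
      (fun κ _ i l => by rw [abs_neg]; exact M.abs_mean_le_tau j _)
      (fun κ hκ => by
        have h1 : ∑ l, ∑ k, classFreq κ k * M.fittedMean Bs k l ^ 2 ≤ 2 * ((K : ℝ) - 1) := by
          have hκ' : ∑ k, classFreq κ k * ∑ l, M.fittedMean Bs k l ^ 2 ≤ 2 * ((K : ℝ) - 1) := hκ
          rw [Finset.sum_comm]
          simpa only [← Finset.mul_sum] using hκ'
        rw [Finset.sum_add_distrib, ← Finset.mul_sum, hKc]
        simp only [Finset.sum_const, Finset.card_univ, Fintype.card_fin, nsmul_eq_mul, hKc]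
        linarith)
      (A := A) (Real.sqrt_nonneg L) hsn
    rw [hs2] at h
    refine le_trans (measure_mono fun ω hω => ?_) h
    refine ⟨hω.1, lt_of_eq_of_lt ?_ hω.2⟩
    rw [hAs, hKc]; ring
  have p4 : ∀ j k, P (B4 j k) ≤ ENNReal.ofReal η := by
    intro j k
    have h := measure_obsForm_tail hlaw hind hn Set.univ (m := 1) one_pos (Pi.single j 1)
      (fun _ => Pi.single k 1) hτ hτ (M.dotProduct_covW_single_le (by omega) j)
      (fun _ => M.dotProduct_covW_single_le (by omega) k)
      (fun κ i _ => M.mean (κ i) k) (fun κ i _ => M.mean (κ i) j)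
      (γ := 1) (fun _ _ => 1) (by simp)
      (fun κ _ _ => by
        rw [mul_one]; exact sum_sq_le_of_abs_le fun i => M.abs_mean_le_tau k _)
      (fun κ _ i _ => M.abs_mean_le_tau j _) (fun κ _ => by simp)
      (A := A) (Real.sqrt_nonneg L) hsn
    rw [hs2] at h
    refine le_trans (measure_mono fun ω hω => ?_) h
    refine ⟨Set.mem_univ _, ?_⟩
    rw [Fin.sum_univ_one]
    refine lt_of_eq_of_lt ?_ hω
    rw [hAs]; push_cast; ring
  -- For the mean and the fit the linear term of the form has coefficient `τ`, which cancels: in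
  -- this way one tail bound serves all averages.
  have p5 : ∀ j, P (B5 j) ≤ ENNReal.ofReal η := by
    intro j
    have h := measure_obsForm_tail hlaw hind hn Set.univ (m := 1) one_pos (Pi.single j 1)
      (fun _ => Pi.single j 1) hτ hτ (M.dotProduct_covW_single_le (by omega) j)
      (fun _ => M.dotProduct_covW_single_le (by omega) j)
      (fun _ _ _ => M.tau) (fun _ _ _ => 0)
      (γ := 0) (fun _ _ => 1) (by simp)
      (fun κ _ _ => by simp) (fun κ _ i _ => by simpa using hτ.le) (fun κ _ => by simp)
      (A := A) (Real.sqrt_nonneg L) hsn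
    rw [hs2] at h
    refine le_trans (measure_mono fun ω hω => ?_) h
    refine ⟨Set.mem_univ _, ?_⟩
    have hω' : 8 * M.tau ^ 2 * (A ^ 2 * L) / n <
      ((n : ℝ)⁻¹ * ∑ i, (x i ω j - M.mean (z i ω) j)) ^ 2 := hω
    rw [Fin.sum_univ_one, hAs]
    simp only [obsForm_single, zero_mul, add_zero, ← Finset.mul_sum]
    rw [mul_left_comm _ M.tau, mul_pow]
    calc _ = M.tau ^ 2 * (8 * M.tau ^ 2 * (A ^ 2 * L) / n) := by push_cast; ring
      _ < _ := by gcongr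
  have p6 : P B6 ≤ ENNReal.ofReal η := by
    have h := measure_obsForm_tail hlaw hind hn Set.univ (m := K - 1) (by omega) 0
      (fun l j' => Bs j' l) hτ one_pos (by simpa using sq_nonneg M.tau)
      (fun l => by rw [one_pow]; exact M.covW_column_le_one hBs l)
      (fun _ _ _ => 0) (fun _ _ _ => M.tau)
      (γ := 0) (fun _ _ => 0) (by simp)
      (fun κ _ _ => by simp) (fun κ _ i _ => (abs_of_pos hτ).le) (fun κ _ => by simp)
      (A := A) (Real.sqrt_nonneg L) hsn
    rw [hs2] at h
    refine le_trans (measure_mono fun ω hω => ?_) h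
    refine ⟨Set.mem_univ _, ?_⟩
    have hω' : 8 * ((K : ℝ) - 1) * (A ^ 2 * L) / n <
      ∑ l, ((n : ℝ)⁻¹ * ∑ i, ∑ j, Bs j l * (x i ω j - M.mean (z i ω) j)) ^ 2 := hω
    have e : ∀ l, ((n : ℝ)⁻¹ * ∑ i, obsForm (M.mean (z i ω)) M.covW 0 (fun j' => Bs j' l) 0
          M.tau 0 (x i ω)) ^ 2
        = M.tau ^ 2 * ((n : ℝ)⁻¹ * ∑ i, ∑ j, Bs j l * (x i ω j - M.mean (z i ω) j)) ^ 2 := by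
      intro l
      simp only [obsForm, zero_mul, add_zero, zero_add, ← Finset.mul_sum]
      rw [mul_left_comm _ M.tau, mul_pow]
    simp only [e, ← Finset.mul_sum]
    rw [hAs, hKc]
    calc _ = M.tau ^ 2 * (8 * ((K : ℝ) - 1) * (A ^ 2 * L) / n) := by ring
      _ < _ := mul_lt_mul_of_pos_left hω' (by positivity)
  have hsum : P {ω | ¬ M.WellBehaved Bs (fun i => x i ω) (fun i => z i ω) (A ^ 2 * L)}
      ≤ ENNReal.ofReal (2 / (A ^ 2 * L)) + ENNReal.ofReal (2 / (c * n))
        + ∑ _j : Fin p, ENNReal.ofReal η + ∑ _j : Fin p, ∑ _k : Fin p, ENNReal.ofReal η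
        + ∑ _j : Fin p, ENNReal.ofReal η + ENNReal.ofReal η := by
    refine (measure_mono hsub).trans ?_
    refine (measure_union_le _ _).trans (add_le_add ?_ p6)
    refine (measure_union_le _ _).trans (add_le_add ?_
      ((measure_iUnion_fintype_le _ _).trans (Finset.sum_le_sum fun j _ => p5 j)))
    refine (measure_union_le _ _).trans (add_le_add ?_
      ((measure_iUnion_fintype_le _ _).trans (Finset.sum_le_sum fun j _ =>
        (measure_iUnion_fintype_le _ _).trans (Finset.sum_le_sum fun k _ => p4 j k))))
    refine (measure_union_le _ _).trans (add_le_add ?_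
      ((measure_iUnion_fintype_le _ _).trans (Finset.sum_le_sum fun j _ => p3 j)))
    exact (measure_union_le _ _).trans (add_le_add p1 p2)
  refine hsum.trans ?_
  have hconst : ∀ y : ℝ, ∑ _j : Fin p, ENNReal.ofReal y = ENNReal.ofReal (p * y) := by
    intro y
    rw [Finset.sum_const, Finset.card_univ, Fintype.card_fin, nsmul_eq_mul,
      ENNReal.ofReal_mul (Nat.cast_nonneg p), ENNReal.ofReal_natCast]
  rw [hconst, hconst, ← ENNReal.ofReal_add (by positivity) (by positivity),
    ← ENNReal.ofReal_add (by positivity) (by positivity),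
    ← ENNReal.ofReal_add (by positivity) (by positivity),
    ← ENNReal.ofReal_add (by positivity) (by positivity),
    ← ENNReal.ofReal_add (by positivity) (by positivity)]
  apply ENNReal.ofReal_le_ofReal
  have hexp : Real.exp ((34 - A) * L) = p * (p * Real.exp ((32 - A) * L)) := by
    rw [← hexpL, ← Real.exp_add, ← Real.exp_add]
    congr 1; ring
  rw [hexp, hη]
  have hE := Real.exp_pos ((32 - A) * L)
  generalize Real.exp ((32 - A) * L) = e at *
  have h1 : (p : ℝ) * e ≤ p * (p * e) := by nlinarith [mul_pos (by linarith : (0 : ℝ) < p) hE]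
  have h2 : e ≤ p * e := by nlinarith
  nlinarith

end Probability

/-! ### Rate of the estimator -/

section Rate

variable {n p K : ℕ} {M : ClassModel p K} {Bs : Matrix (Fin p) (Fin (K - 1)) ℝ} {Ω : Type*}
  [MeasurableSpace Ω] {P : Measure Ω} {x : Fin n → Ω → EuclideanSpace ℝ (Fin p)}
  {z : Fin n → Ω → Fin K}

/-- If `τ = 0` the features are almost surely zero. -/
lemma ClassModel.totalCov_eq_zero_of_tau_eq_zero (M : ClassModel p K) (hK : 0 < K)
    (hτ : M.tau = 0) : M.totalCov = 0 := by
  refine M.totalCov_posSemidef.trace_eq_zero_iff.1 (Finset.sum_eq_zero fun j _ => ?_)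
  have h1 : M.covW j j ≤ 0 := by simpa [hτ] using M.covW_diag_le hK j
  have h2 : M.covW j j = 0 := le_antisymm h1 M.covW_posSemidef.diag_nonneg
  have h3 : ∀ k, M.mean k j = 0 := fun k => by
    simpa [hτ] using M.abs_mean_le_tau j k
  simp [Matrix.diag_apply, M.totalCov_apply, h2, h3]

/-- The slow rate on the good event. The tuning parameter dominates the gradient because
`(40 A r)² = 1600 τ² (K - 1) A² log p / n`, where `r` is the tuning scale. -/
lemma ClassModel.WellBehaved.predError_le {ξ : Fin n → EuclideanSpace ℝ (Fin p)} {κ : Fin n → Fin K}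
    {A : ℝ} (h : M.WellBehaved Bs ξ κ (A ^ 2 * Real.log p))
    (hBs : M.totalCov * Bs = M.contrasts) (hn : 0 < n) (hp : 2 ≤ p) (hK : 2 ≤ K)
    (hτ : 0 < M.tau) (hA : 0 < A) (hpn : 8 * (A ^ 2 * Real.log p) ≤ n)
    {X : Matrix (Fin n) (Fin p) ℝ}
    (hX : X = centerColumns (dataMatrix ξ) ∨ X = dataMatrix ξ) {lam C' : ℝ}
    (hlam : 80 * A * tuningScale M n ≤ lam) (hlam' : lam ≤ C' * tuningScale M n)
    {Bh : Matrix (Fin p) (Fin (K - 1)) ℝ}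
    (hmin : IsMinOn (penalizedLoss X (response κ) lam) Set.univ Bh) :
    predError M.totalCov Bh Bs ≤ (3 * |C'| + 640 * A) * slowRate M Bs n := by
  have hn0 : (0 : ℝ) < n := by exact_mod_cast hn
  have hK1 : 0 < (K : ℝ) - 1 := by
    have : (2 : ℝ) ≤ K := by exact_mod_cast hK
    linarith
  have hL0 : 0 < Real.log p := by
    have : (2 : ℝ) ≤ p := by exact_mod_cast hp
    exact Real.log_pos (by linarith)
  set v := ((K : ℝ) - 1) * Real.log p / n with hv
  have hv0 : 0 < v := by positivity
  have hsv : √v ^ 2 = v := Real.sq_sqrt hv0.le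
  have hsv0 : 0 < √v := Real.sqrt_pos.2 hv0
  have hr : tuningScale M n = M.tau * √v := rfl
  have hlam0 : 0 < lam := lt_of_lt_of_le (by rw [hr]; positivity) hlam
  have ht : ((K : ℝ) - 1) * (A ^ 2 * Real.log p) / n = A ^ 2 * v := by rw [hv]; ring
  have hgrad := h.sum_sq_gradient_le hBs hn hK (by positivity) hpn hX
  have hgram := h.sq_gram_sub_le hn hK (by positivity) hpn hX
  rw [ht] at hgrad hgram
  have hbound := predError_le_of_isMinOn hn hlam0 hmin (S := M.totalCov) (Bs := Bs)
    (ε := 40 * A * M.tau ^ 2 * √v)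
    (fun j => (hgrad j).trans <| by
      calc 1600 * (M.tau ^ 2 * (A ^ 2 * v)) = (40 * A * (M.tau * √v)) ^ 2 := by
            rw [mul_pow, mul_pow, mul_pow, hsv]; ring
        _ ≤ (lam / 2) ^ 2 := by
            gcongr
            rw [← hr]; linarith)
    (fun j k => abs_le_of_sq_le_sq ((hgram j k).trans_eq <| by
      rw [mul_pow, hsv]; ring) (by positivity))
  refine hbound.trans ?_
  have hB := norm12_nonneg Bs
  set b := M.tau * norm12 Bs with hb
  have hb0 : 0 ≤ b := by positivity
  have h1 : b * √v ≤ slowRate M Bs n := by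
    rw [slowRate, ← hb, ← hv]
    gcongr
    exact le_mul_of_one_le_left hb0 (le_max_left _ _)
  have h2 : b * b * √v ≤ slowRate M Bs n := by
    rw [slowRate, ← hb, ← hv]
    gcongr
    exact le_max_right _ _
  have h3 : lam * norm12 Bs ≤ |C'| * (b * √v) := by
    calc lam * norm12 Bs ≤ |C'| * (M.tau * √v) * norm12 Bs := by
          gcongr
          refine hlam'.trans ?_
          rw [hr]
          gcongr
          exact le_abs_self C'
      _ = _ := by rw [hb]; ring
  have h4 : 16 * (40 * A * M.tau ^ 2 * √v) * norm12 Bs ^ 2 = 640 * A * (b * b * √v) := by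
    rw [hb]; ring
  have h5 := mul_le_mul_of_nonneg_left h1 (abs_nonneg C')
  have h6 := mul_le_mul_of_nonneg_left h2 hA.le
  rw [h4]
  linarith

lemma measure_slowRate_lt_predError_le [IsProbabilityMeasure P] (hn : 0 < n)
    (hlaw : ∀ i, HasLaw (fun ω => (x i ω, z i ω)) M.law P)
    (hind : iIndepFun (fun i ω => (x i ω, z i ω)) P) (hp : 2 ≤ p) (hK : 2 ≤ K)
    (hBs : M.totalCov * Bs = M.contrasts) {c : ℝ} (hc : 0 < c) (hprob : ∀ k, c / K ≤ M.prob k)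
    {A : ℝ} (hA : 0 < A) (hpn : 256 * Real.log p ≤ n) (hpn' : 8 * (A ^ 2 * Real.log p) ≤ n)
    {X : Ω → Matrix (Fin n) (Fin p) ℝ}
    (hX : (∀ ω, X ω = centerColumns (dataMatrix fun i => x i ω)) ∨
      (∀ ω, X ω = dataMatrix fun i => x i ω)) {lam C' : ℝ}
    (hlam : 80 * A * tuningScale M n ≤ lam) (hlam' : lam ≤ C' * tuningScale M n)
    {Bh : Ω → Matrix (Fin p) (Fin (K - 1)) ℝ}
    (hmin : ∀ ω, IsMinOn (penalizedLoss (X ω) (response fun i => z i ω) lam) Set.univ (Bh ω)) :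
    P {ω | (3 * |C'| + 640 * A) * slowRate M Bs n < |predError M.totalCov (Bh ω) Bs|}
      ≤ ENNReal.ofReal (2 / (A ^ 2 * Real.log p) + 2 / (c * n)
        + 8 * Real.exp ((34 - A) * Real.log p)) := by
  rcases M.tau_nonneg.eq_or_lt with hτ | hτ
  -- If `τ = 0` the tuning parameter may vanish and the estimator is arbitrary, but the prediction
  -- error is zero.
  · have h0 := M.totalCov_eq_zero_of_tau_eq_zero (by omega) hτ.symm
    simp [h0, predError, slowRate, ← hτ]
  · refine le_trans (measure_mono ?_)
      (measure_not_wellBehaved_le hn hlaw hind hp hK hBs hc hprob hτ hA hpn)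
    intro ω hω
    have hω' : (3 * |C'| + 640 * A) * slowRate M Bs n < |predError M.totalCov (Bh ω) Bs| := hω
    rw [abs_of_nonneg (predError_nonneg M.totalCov_posSemidef _ _)] at hω'
    refine fun hwell => hω'.not_ge ?_
    exact hwell.predError_le hBs hn hp hK hτ hA hpn' (X := X ω)
      (hX.imp (fun h => h ω) fun h => h ω) hlam hlam' (hmin ω)

end Rate

/-! ### Rates in probability along a sequence of models -/

section Sequence

variable {p K : ℕ → ℕ} {M : ∀ n, ClassModel (p n) (K n)}
  {Bs : ∀ n, Matrix (Fin (p n)) (Fin (K n - 1)) ℝ} {Ω : ℕ → Type*} [∀ n, MeasurableSpace (Ω n)]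
  {P : ∀ n, Measure (Ω n)} {x : ∀ n, Fin n → Ω n → EuclideanSpace ℝ (Fin (p n))}
  {z : ∀ n, Fin n → Ω n → Fin (K n)}

lemma BoundedAtLevel.frobSq_of_predError [∀ n, IsProbabilityMeasure (P n)]
    {Bh : ∀ n, Ω n → Matrix (Fin (p n)) (Fin (K n - 1)) ℝ} {a : ℕ → ℝ} {ε : ℝ}
    (h : BoundedAtLevel P (fun n ω => predError (M n).totalCov (Bh n ω) (Bs n)) a ε)
    (hpos : ∀ n, 0 < lambdaMin (M n).totalCov) :
    BoundedAtLevel P (fun n ω => frobSq (Bh n ω - Bs n))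
      (fun n => a n / lambdaMin (M n).totalCov) ε := by
  obtain ⟨D, hD⟩ := h
  refine ⟨D, hD.mono fun n hn => (measureReal_mono fun ω hω => ?_).trans_lt hn⟩
  have hfrob : 0 ≤ frobSq (Bh n ω - Bs n) :=
    Finset.sum_nonneg fun i _ => Finset.sum_nonneg fun l _ => sq_nonneg _
  rw [Set.mem_ofPred_eq, abs_of_nonneg hfrob, ← mul_div_assoc, div_lt_iff₀ (hpos n), mul_comm _
    (lambdaMin _)] at hω
  exact (hω.trans_le (lambdaMin_mul_frobSq_le (M n).totalCov_posSemidef _ _)).trans_le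
    (le_abs_self _)

lemma boundedAtLevel_predError [∀ n, IsProbabilityMeasure (P n)]
    (hp : ∀ n, 2 ≤ p n) (hK : ∀ n, 2 ≤ K n)
    (hBs : ∀ n, (M n).totalCov * Bs n = (M n).contrasts)
    {c : ℝ} (hc : 0 < c) (hprob : ∀ n k, c / K n ≤ (M n).prob k)
    (hlog : (fun n => Real.log (p n)) =o[atTop] (fun n : ℕ => (n : ℝ)))
    (hlaw : ∀ n i, HasLaw (fun ω => (x n i ω, z n i ω)) (M n).law (P n))
    (hind : ∀ n, iIndepFun (fun i ω => (x n i ω, z n i ω)) (P n))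
    {X : ∀ n, Ω n → Matrix (Fin n) (Fin (p n)) ℝ}
    (hX : (∀ n ω, X n ω = centerColumns (dataMatrix fun i => x n i ω)) ∨
      (∀ n ω, X n ω = dataMatrix fun i => x n i ω))
    {lam : ℕ → ℝ} {Bh : ∀ n, Ω n → Matrix (Fin (p n)) (Fin (K n - 1)) ℝ}
    (hmin : ∀ n ω, IsMinOn (penalizedLoss (X n ω) (response fun i => z n i ω) (lam n))
      Set.univ (Bh n ω))
    {C' : ℝ} (hlam' : ∀ᶠ n in atTop, lam n ≤ C' * tuningScale (M n) n)
    {A : ℝ} (hA : 0 < A) (hlam : ∀ᶠ n in atTop, 80 * A * tuningScale (M n) n ≤ lam n)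
    {ε : ℝ} (hε : 0 < ε)
    (hprobA : ∀ᶠ n in atTop, 2 / (A ^ 2 * Real.log (p n))
      + 8 * Real.exp ((34 - A) * Real.log (p n)) < ε / 2) :
    BoundedAtLevel P (fun n ω => predError (M n).totalCov (Bh n ω) (Bs n))
      (fun n => slowRate (M n) (Bs n) n) ε := by
  have hsmall : ∀ D : ℝ, 0 < D → ∀ᶠ n : ℕ in atTop, D * Real.log (p n) ≤ n := by
    intro D hD
    filter_upwards [hlog.bound (inv_pos.2 hD)] with n hn
    have h := (le_abs_self _).trans hn
    rw [Real.norm_natCast, inv_mul_eq_div, le_div_iff₀ hD] at h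
    linarith
  have hcn : ∀ᶠ n : ℕ in atTop, 2 / (c * n) < ε / 2 := by
    have h : Tendsto (fun n : ℕ => 2 / (c * (n : ℝ))) atTop (nhds 0) :=
      tendsto_const_nhds.div_atTop (tendsto_natCast_atTop_atTop.const_mul_atTop hc)
    exact h.eventually_lt_const (by positivity)
  refine ⟨3 * |C'| + 640 * A, ?_⟩
  filter_upwards [hlam, hlam', hprobA, hcn, hsmall 256 (by norm_num),
    hsmall (8 * A ^ 2) (by positivity), eventually_gt_atTop 0] with n h1 h2 h3 h4 h5 h6 h7
  have h := measure_slowRate_lt_predError_le h7 (hlaw n) (hind n) (hp n) (hK n) (hBs n) hc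
    (hprob n) hA h5 (by linarith) (hX.imp (fun h => h n) fun h => h n) h1 h2 (hmin n)
  have hL : 0 ≤ Real.log (p n) := Real.log_natCast_nonneg _
  refine (ENNReal.toReal_le_of_le_ofReal (by positivity) h).trans_lt ?_
  linarith

end Sequence

/-- For a given level, a large constant in the tuning parameter makes the exceptional
probability small even when the dimension stays bounded. -/
lemma exceptional_prob_lt {ε A L : ℝ} (hε : 0 < ε) (hA : A = 35 + 40 / ε) (hL : 1 / 2 < L) :
    2 / (A ^ 2 * L) + 8 * Real.exp ((34 - A) * L) < ε / 2 := by
  set B := A - 34 with hB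
  have hq : 0 < 40 / ε := by positivity
  have hB1 : 1 + 40 / ε = B := by rw [hB, hA]; ring
  have hBpos : 0 < B := by linarith
  have h1 : 2 / (A ^ 2 * L) ≤ 4 / B := by
    rw [div_le_div_iff₀ (by nlinarith) hBpos]
    nlinarith
  have h2 : 8 * Real.exp ((34 - A) * L) ≤ 16 / B := by
    have e : (34 - A) * L = -(B * L) := by rw [hB]; ring
    have h3 := Real.add_one_le_exp (B * L)
    have h4 : B / 2 ≤ Real.exp (B * L) := by nlinarith
    rw [e, Real.exp_neg, ← div_eq_mul_inv, div_le_div_iff₀ (Real.exp_pos _) hBpos]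
    linarith
  have h5 : 20 / B < ε / 2 := by
    rw [div_lt_div_iff₀ hBpos two_pos, ← hB1, mul_add, mul_div_cancel₀ _ hε.ne']
    linarith
  have h6 : 4 / B + 16 / B = 20 / B := by rw [← add_div]; norm_num
  linarith

theorem theorem4 :
    ∃ (C : ℝ) (Clevel : ℝ → ℝ), 0 < C ∧ (∀ ε, 0 < Clevel ε) ∧
      -- a sequence of models: dimensions, parameters, population coefficients
      ∀ (p K : ℕ → ℕ) (_ : ∀ n, 2 ≤ p n) (_ : ∀ n, 2 ≤ K n)
        (M : ∀ n, ClassModel (p n) (K n))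
        (Bstar : ∀ n, Matrix (Fin (p n)) (Fin (K n - 1)) ℝ)
        (_ : ∀ n, (M n).totalCov * Bstar n = (M n).contrasts)
        -- class probabilities of the same order
        (c : ℝ) (_ : 0 < c) (_ : ∀ n k, c / K n ≤ (M n).prob k)
        -- sample size
        (_ : (fun n => Real.log (p n)) =o[atTop] (fun n : ℕ => (n : ℝ)))
        -- independent samples of size n
        (Ω : ℕ → Type*) (_ : ∀ n, MeasurableSpace (Ω n)) (P : ∀ n, Measure (Ω n))
        (_ : ∀ n, IsProbabilityMeasure (P n))
        (x : ∀ n, Fin n → Ω n → EuclideanSpace ℝ (Fin (p n)))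
        (z : ∀ n, Fin n → Ω n → Fin (K n))
        (_ : ∀ n i, HasLaw (fun ω => (x n i ω, z n i ω)) (M n).law (P n))
        (_ : ∀ n, iIndepFun (fun i ω => (x n i ω, z n i ω)) (P n))
        -- data matrix, column-centered or not
        (X : ∀ n, Ω n → Matrix (Fin n) (Fin (p n)) ℝ)
        (_ : (∀ n ω, X n ω = centerColumns (dataMatrix fun i => x n i ω)) ∨
          (∀ n ω, X n ω = dataMatrix fun i => x n i ω))
        -- tuning parameter and estimator
        (lam : ℕ → ℝ) (Bhat : ∀ n, Ω n → Matrix (Fin (p n)) (Fin (K n - 1)) ℝ)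
        (_ : ∀ n ω, IsMinOn (penalizedLoss (X n ω) (response fun i => z n i ω) (lam n))
          Set.univ (Bhat n ω))
        (C' : ℝ) (_ : ∀ᶠ n in atTop, lam n ≤ C' * tuningScale (M n) n),
        -- a single constant for all levels when the number of features diverges
        (Tendsto p atTop atTop →
          (∀ᶠ n in atTop, C * tuningScale (M n) n ≤ lam n) →
            IsBigOp P (fun n ω => predError (M n).totalCov (Bhat n ω) (Bstar n))
              (fun n => slowRate (M n) (Bstar n) n) ∧
            ((∀ n, 0 < lambdaMin (M n).totalCov) →
              IsBigOp P (fun n ω => frobSq (Bhat n ω - Bstar n))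
                (fun n => slowRate (M n) (Bstar n) n / lambdaMin (M n).totalCov))) ∧
        -- in general, a constant for each level
        (∀ ε : ℝ, 0 < ε →
          (∀ᶠ n in atTop, Clevel ε * tuningScale (M n) n ≤ lam n) →
            BoundedAtLevel P (fun n ω => predError (M n).totalCov (Bhat n ω) (Bstar n))
              (fun n => slowRate (M n) (Bstar n) n) ε ∧
            ((∀ n, 0 < lambdaMin (M n).totalCov) →
              BoundedAtLevel P (fun n ω => frobSq (Bhat n ω - Bstar n))
                (fun n => slowRate (M n) (Bstar n) n / lambdaMin (M n).totalCov) ε)) := by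
  refine ⟨80 * 35, fun ε => 80 * (35 + 40 / |ε|), by norm_num, fun ε => by positivity, ?_⟩
  intro p K hp hK M Bs hBs c hc hprob hlog Ω _ P _ x z hlaw hind X hX lam Bh hmin C' hlam'
  refine ⟨fun hptop hlam => ?_, fun ε hε hlam => ?_⟩
  -- `A = 35` exceeds `34`, so the exceptional probability tends to zero with `1 / log p`.
  · have hL : Tendsto (fun n => Real.log (p n)) atTop atTop :=
      Real.tendsto_log_atTop.comp (tendsto_natCast_atTop_atTop.comp hptop)
    have hbound : IsBigOp P (fun n ω => predError (M n).totalCov (Bh n ω) (Bs n))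
        (fun n => slowRate (M n) (Bs n) n) := by
      intro ε hε
      refine boundedAtLevel_predError hp hK hBs hc hprob hlog hlaw hind hX hmin hlam'
        (by norm_num : (0 : ℝ) < 35) hlam hε ?_
      have h1 : Tendsto (fun n => 2 / ((35 : ℝ) ^ 2 * Real.log (p n))) atTop (nhds 0) :=
        tendsto_const_nhds.div_atTop (hL.const_mul_atTop (by norm_num))
      have h2 : Tendsto (fun n => 8 * Real.exp ((34 - 35) * Real.log (p n))) atTop (nhds 0) := by
        have h := (Real.tendsto_exp_atBot.comp
          (hL.const_mul_atTop_of_neg (by norm_num : (34 - 35 : ℝ) < 0))).const_mul 8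
        simpa using h
      have h3 := h1.add h2
      rw [add_zero] at h3
      exact h3.eventually_lt_const (by positivity)
    exact ⟨hbound, fun hpos ε hε => (hbound ε hε).frobSq_of_predError hpos⟩
  · have hbound := boundedAtLevel_predError (Bh := Bh) hp hK hBs hc hprob hlog hlaw hind hX hmin
      hlam' (by positivity : 0 < 35 + 40 / ε) (by simpa only [abs_of_pos hε] using hlam) hε
      (Eventually.of_forall fun n => exceptional_prob_lt hε rfl <| by
        have h2 : (2 : ℝ) ≤ p n := by exact_mod_cast hp n
        have := Real.log_le_log two_pos h2
        linarith [Real.log_two_gt_d9])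
    exact ⟨hbound, fun hpos => hbound.frobSq_of_predError hpos⟩
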